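/- Let $\mathbb K$ be $\mathbb R$ or $\mathbb C$, let $M$ be a smooth manifold (finite-dimensional, Hausdorff, second countable), and let $(L,[\cdot,\cdot]_L,\rho_L)$ be a Lie $\mathbb K$-algebroid over $M$: a finite-rank smooth $\mathbb K$-vector bundle $L$ with a $\mathbb K$-Lie bracket on $\Gamma(L)$ and a bundle map $\rho_L:L\to TM\otimes_{\mathbb R}\mathbb K$ which is a Lie algebra homomorphism on sections and satisfies $[u,fv]_L=(\rho_L(u)f)v+f[u,v]_L$. Let $A\subset L$ be a Lie subalgebroid over $M$ (so $(L,A)$ is a Lie pair) and let $B\subset L$ be a smooth complementary subbundle, $L=A\oplus B\ (B\cong L/A)$, with projections $\mathrm{pr}_A,\mathrm{pr}_B$. For $a\in\Gamma(A)$, $b,b'\in\Gamma(B)$ put $\nabla_a b=\mathrm{pr}_B[a,b]_L$, $\eth_b a=\mathrm{pr}_A[b,a]_L$, $[b,b']_B=\mathrm{pr}_B[b,b']_L$. Let $\Omega_A^k(B)=\Gamma(\Lambda^kA^\vee\otimes B)$, with the differential $$(d_A^{\mathrm{Bott}}X)(a_1,\dots,a_{k+1})=\sum_i(-1)^{i+1}\nabla_{a_i}X(\dots,\hat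 a_i,\dots)+\sum_{i<j}(-1)^{i+j}X([a_i,a_j]_L,\dots,\hat a_i,\dots,\hat a_j,\dots),$$ and, for $X\in\Omega_A^p(B)$, $Y\in\Omega_A^q(B)$, the bracket $[X,Y]_2\in\Omega_A^{p+q}(B)$ whose value at $(a_1,\dots,a_{p+q})$ is $$\sum_{\sigma\in\mathrm{Sh}(p,q)}\mathrm{sgn}(\sigma)\Big(\sum_{i=1}^pX(x_1,\dots,\eth_{Y(y)}x_i,\dots,x_p)-\sum_{j=1}^qY(y_1,\dots,\eth_{X(x)}y_j,\dots,y_q)+[X(x),Y(y)]_B\Big),$$ where $x=(a_{\sigma(1)},\dots,a_{\sigma(p)})$ and $y=(a_{\sigma(p+1)},\dots,a_{\sigma(p+q)})$. Let $\mathrm{Der}(L)$ be the Lie algebra (under the commutator) of operators $\delta:\Gamma(L)\to\Gamma(L)$ that admit a symbol $s\in\mathscr X(M)\otimes\mathbb K$ with $\delta(fu)=s(f)u+f\delta(u)$, $[s,\rho_L(u)]=\rho_L(\delta(u))$ and $\delta[u,v]_L=[\delta(u),v]_L+[u,\delta(v)]_L$. Let $\kappa:\mathrm{Der}(L)\to\Omega_A^1(B)$,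 $\kappa(\delta)(a)=-\mathrm{pr}_B\delta(a)$, and for $\delta\in\mathrm{Der}(L)$, $X\in\Omega_A^k(B)$ let $$(\delta\triangleright X)(a_1,\dots,a_k)=-\sum_{j=1}^kX(a_1,\dots,\mathrm{pr}_A\delta(a_j),\dots,a_k)+\mathrm{pr}_B\delta\big(X(a_1,\dots,a_k)\big)\in\Omega_A^k(B).$$ Then: 1. $\mathrm{Der}(L,A):=\ker\kappa=\{\delta\in\mathrm{Der}(L)\mid\delta\Gamma(A)\subset\Gamma(A)\}$ is a Lie subalgebra of $\mathrm{Der}(L)$. 2. These maps are well defined, $(d_A^{\mathrm{Bott}})^2=0$, and $[\cdot,\cdot]_2$ induces a graded Lie algebra structure on the cohomology $H_{\mathrm{CE}}(A;B)=H(\Omega_A^\bullet(B),d_A^{\mathrm{Bott}})$, $[\overline X,\overline Y]=\overline{[X,Y]_2}$. 3. $\mathrm{Der}(L,A)$ acts on $H_{\mathrm{CE}}(A;B)$ by $\delta\triangleright\overline X=\overline{\delta\triangleright X}$ (this is well defined, preserves the degree and is a Lie algebra representation), and it acts by derivations: $\delta\triangleright[x,y]=[\delta\triangleright x,y]+[x,\delta\triangleright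 y]$ for all $x,y\in H_{\mathrm{CE}}(A;B)$. -/

import Mathlib

open scoped Manifold ContDiff Topology DirectSum TensorProduct
open Bundle

attribute [local instance] LieRing.ofAssociativeRing

noncomputable section

namespace LiePairs

/-! ## Lie-Rinehart pairs: the structure carried by the sections of a Lie pair -/

section Algebra

/-- The structure on the module `𝓛` of sections of a Lie algebroid over the algebra `R` of
`K`-valued smooth functions: a `K`-Lie bracket and an anchor with values in the vector fields
(the derivations of `R`), which is `R`-linear and a Lie algebra homomorphism, subject to the
Leibniz rule. -/
structure LieRinehart (K R 𝓛 : Type*) [Field K] [CommRing R] [Algebra K R] [AddCommGroup 𝓛]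
    [Module K 𝓛] [Module R 𝓛] where
  bracket : 𝓛 →ₗ[K] 𝓛 →ₗ[K] 𝓛
  anchor : 𝓛 →ₗ[R] Derivation K R R
  bracket_self : ∀ u, bracket u u = 0
  jacobi : ∀ u v w, bracket u (bracket v w) = bracket (bracket u v) w + bracket v (bracket u w)
  anchor_bracket : ∀ u v, anchor (bracket u v) = ⁅anchor u, anchor v⁆
  leibniz : ∀ u (f : R) v, bracket u (f • v) = anchor u f • v + f • bracket u v

variable {K R 𝓛 : Type*} [Field K] [CommRing R] [Algebra K R] [AddCommGroup 𝓛]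
  [Module K 𝓛] [Module R 𝓛] [IsScalarTower K R 𝓛]

/-- The Lie algebra `Der(L)`: operators `δ` on sections that admit a symbol `s` (a vector field)
with `δ (f u) = s(f) u + f δ u`, `[s, ρ u] = ρ (δ u)` and `δ [u, v] = [δ u, v] + [u, δ v]`.
The Lie bracket is the commutator. -/
def LieRinehart.Der (𝔏 : LieRinehart K R 𝓛) : LieSubalgebra K (Module.End K 𝓛) where
  carrier := {δ | ∃ s : Derivation K R R,
    (∀ (f : R) u, δ (f • u) = s f • u + f • δ u) ∧
    (∀ u, ⁅s, 𝔏.anchor u⁆ = 𝔏.anchor (δ u)) ∧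
    (∀ u v, δ (𝔏.bracket u v) = 𝔏.bracket (δ u) v + 𝔏.bracket u (δ v))}
  add_mem' := by
    rintro δ δ' ⟨s, h1, h2, h3⟩ ⟨s', h1', h2', h3'⟩
    refine ⟨s + s', fun f u => ?_, fun u => ?_, fun u v => ?_⟩
    · simp only [LinearMap.add_apply, h1, h1', Derivation.add_apply, add_smul, smul_add]; abel
    · simp only [LinearMap.add_apply, add_lie, h2, h2', map_add]
    · simp only [LinearMap.add_apply, h3, h3', map_add]; abel
  zero_mem' := ⟨0, by simp, by simp, by simp⟩
  smul_mem' := by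
    rintro c δ ⟨s, h1, h2, h3⟩
    refine ⟨c • s, fun f u => ?_, fun u => ?_, fun u v => ?_⟩
    · simp only [LinearMap.smul_apply, h1, Derivation.smul_apply, smul_add, smul_assoc]
      rw [← algebraMap_smul R c (f • δ u), ← algebraMap_smul R c (δ u), smul_smul, smul_smul,
        mul_comm]
    · rw [LinearMap.smul_apply, smul_lie, h2, ← algebraMap_smul R c (δ u), map_smul,
        algebraMap_smul]
    · simp only [LinearMap.smul_apply, h3, map_smul, smul_add]
  lie_mem' := by
    rintro δ δ' ⟨s, h1, h2, h3⟩ ⟨s', h1', h2', h3'⟩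
    refine ⟨⁅s, s'⁆, fun f u => ?_, fun u => ?_, fun u v => ?_⟩
    · simp only [Ring.lie_def, LinearMap.sub_apply, Module.End.mul_apply, h1, h1', map_add,
        Derivation.commutator_apply, sub_smul, smul_sub]
      abel
    · simp only [Ring.lie_def, LinearMap.sub_apply, Module.End.mul_apply, map_sub, ← h2, ← h2']
      rw [lie_lie]
    · simp only [Ring.lie_def, LinearMap.sub_apply, Module.End.mul_apply, h3, h3', map_add,
        map_sub]
      abel

/-- The structure carried by the sections of a Lie pair `(L, A)` with a decomposition
`L = A ⊕ B`. -/
structure SplitPair (K R 𝓛 : Type*) [Field K] [CommRing R] [Algebra K R] [AddCommGroup 𝓛]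
    [Module K 𝓛] [Module R 𝓛] extends LieRinehart K R 𝓛 where
  A : Submodule R 𝓛
  B : Submodule R 𝓛
  isCompl : IsCompl A B
  bracket_mem : ∀ u ∈ A, ∀ v ∈ A, bracket u v ∈ A

namespace SplitPair

variable (S : SplitPair K R 𝓛)

/-- The projection `pr_A` of `L = A ⊕ B` onto `A`. -/
def prA : 𝓛 →ₗ[R] S.A := S.A.projectionOnto S.B S.isCompl

/-- The projection `pr_B` of `L = A ⊕ B` onto `B`. -/
def prB : 𝓛 →ₗ[R] S.B := S.B.projectionOnto S.A S.isCompl.symm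

/-- `[a₁, a₂]_A`. -/
def brA (a₁ a₂ : S.A) : S.A := ⟨S.bracket a₁ a₂, S.bracket_mem _ a₁.2 _ a₂.2⟩

/-- The Bott connection `∇_a b = pr_B [a, b]_L`. -/
def nabla (a : S.A) (b : S.B) : S.B := S.prB (S.bracket a b)

/-- The operation `ð_b a = pr_A [b, a]_L`. -/
def eth (b : S.B) (a : S.A) : S.A := S.prA (S.bracket b a)

/-- `[b₁, b₂]_B = pr_B [b₁, b₂]_L`. -/
def brB (b₁ b₂ : S.B) : S.B := S.prB (S.bracket b₁ b₂)

/-- Maps that send `k` sections of `A` to a section of `B`. -/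
abbrev Cochain (k : ℕ) : Type _ := (Fin k → S.A) → S.B

/-- `Ω_A^k(B) = Γ(Λ^k A^∨ ⊗ B)`: the alternating `R`-multilinear maps of `k` sections of `A` with
values in the sections of `B`, where `R` is the algebra of smooth functions. -/
def forms (k : ℕ) : Submodule K (S.Cochain k) where
  carrier := {X | ∃ w : S.A [⋀^Fin k]→ₗ[R] S.B, ⇑w = X}
  add_mem' := by
    rintro _ _ ⟨w, rfl⟩ ⟨w', rfl⟩
    exact ⟨w + w', rfl⟩
  zero_mem' := ⟨0, rfl⟩
  smul_mem' := by
    rintro c _ ⟨w, rfl⟩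
    refine ⟨algebraMap K R c • w, ?_⟩
    ext a
    simp

/-- The Chevalley-Eilenberg differential `d_A^Bott`. Indices start at `0`. The summand for a pair
`i < j` is `(-1)^(i+j) X([a_i, a_j], a_0, …, â_i, …, â_j, …, a_k)`, written here with `[a_i, a_j]`
moved from the first slot to slot `i`, which for an alternating `X` costs the sign `(-1)^i` and
leaves `(-1)^j`: in the list `a_0, …, â_j, …, a_k` the entry `a_i` is replaced by `[a_i, a_j]`. -/
def d (k : ℕ) : S.Cochain k →ₗ[K] S.Cochain (k + 1) where
  toFun X a :=
    (∑ i : Fin (k + 1), (-1 : K) ^ (i : ℕ) • S.nabla (a i) (X (fun l => a (i.succAbove l)))) +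
    ∑ j : Fin (k + 1), ∑ i : Fin k, if i.castSucc < j then
      (-1 : K) ^ (j : ℕ) • X (Function.update (fun l => a (j.succAbove l)) i
        (S.brA (a i.castSucc) (a j))) else 0
  map_add' X Y := by
    funext a
    simp only [Pi.add_apply, nabla, Submodule.coe_add, map_add, smul_add, Finset.sum_add_distrib]
    have (j : Fin (k + 1)) (i : Fin k) (x y : S.B) :
        (if i.castSucc < j then x + y else 0) =
          (if i.castSucc < j then x else 0) + (if i.castSucc < j then y else 0) := by
      split_ifs <;> simp
    simp only [this, Finset.sum_add_distrib]
    abel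
  map_smul' c X := by
    funext a
    have h (u : 𝓛) : S.prB (c • u) = c • S.prB u := by
      rw [← algebraMap_smul R c u, map_smul, algebraMap_smul]
    simp only [Pi.smul_apply, nabla, Submodule.coe_smul_of_tower, map_smul, h, smul_add,
      Finset.smul_sum, RingHom.id_apply, smul_ite, smul_zero, smul_comm c]

/-- The `(p, q)`-shuffles. -/
def shuffles (p q : ℕ) : Finset (Equiv.Perm (Fin (p + q))) :=
  Finset.univ.filter fun σ =>
    (∀ i j : Fin p, i < j → σ (Fin.castAdd q i) < σ (Fin.castAdd q j)) ∧
    (∀ i j : Fin q, i < j → σ (Fin.natAdd p i) < σ (Fin.natAdd p j))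

/-- The binary bracket `[X, Y]_2 ∈ Ω_A^{p+q}(B)` of `X ∈ Ω_A^p(B)` and `Y ∈ Ω_A^q(B)`. -/
def bracket₂ {p q : ℕ} (X : S.Cochain p) (Y : S.Cochain q) : S.Cochain (p + q) := fun a =>
  ∑ σ ∈ shuffles p q, ((Equiv.Perm.sign σ : ℤˣ) : ℤ) •
    let x : Fin p → S.A := fun i => a (σ (Fin.castAdd q i))
    let y : Fin q → S.A := fun j => a (σ (Fin.natAdd p j))
    (∑ i : Fin p, X (Function.update x i (S.eth (Y y) (x i)))
      - ∑ j : Fin q, Y (Function.update y j (S.eth (X x) (y j)))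
      + S.brB (X x) (Y y))

/-- The `0`-action `κ(δ)(a) = -pr_B (δ a)`. -/
def kappa : S.Der →ₗ[K] S.Cochain 1 where
  toFun δ a := -S.prB (δ.1 (a 0))
  map_add' δ δ' := by
    funext a
    change -S.prB (δ.1 (a 0) + δ'.1 (a 0)) = -S.prB (δ.1 (a 0)) + -S.prB (δ'.1 (a 0))
    rw [map_add, neg_add]
  map_smul' c δ := by
    funext a
    have h (u : 𝓛) : S.prB (c • u) = c • S.prB u := by
      rw [← algebraMap_smul R c u, map_smul, algebraMap_smul]
    simp [h]

/-- The `1`-action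
`(δ ▷ X)(a_1, …, a_k) = -∑_j X(a_1, …, pr_A (δ a_j), …, a_k) + pr_B (δ (X(a_1, …, a_k)))`;
for `k = 0` it is `δ ▷ b = pr_B (δ b)`. -/
def act (δ : S.Der) {k : ℕ} (X : S.Cochain k) : S.Cochain k := fun a =>
  -(∑ j : Fin k, X (Function.update a j (S.prA (δ.1 (a j))))) + S.prB (δ.1 (X a))

/-- Cocycles: the `X ∈ Ω_A^k(B)` with `d X = 0`. -/
def cocycles (k : ℕ) : Submodule K (S.Cochain k) := S.forms k ⊓ LinearMap.ker (S.d k)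

/-- Coboundaries: the `d Y` with `Y ∈ Ω_A^{k-1}(B)`. -/
def coboundaries : (k : ℕ) → Submodule K (S.Cochain k)
  | 0 => ⊥
  | k + 1 => (S.forms k).map (S.d k)

/-- The cohomology `H^k(Ω_A^•(B), d_A^Bott)`. -/
def Cohomology (k : ℕ) : Type _ :=
  S.cocycles k ⧸ (S.coboundaries k).submoduleOf (S.cocycles k)

instance (k : ℕ) : AddCommGroup (S.Cohomology k) :=
  inferInstanceAs (AddCommGroup (S.cocycles k ⧸ (S.coboundaries k).submoduleOf (S.cocycles k)))

instance (k : ℕ) : Module K (S.Cohomology k) :=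
  inferInstanceAs (Module K (S.cocycles k ⧸ (S.coboundaries k).submoduleOf (S.cocycles k)))

/-- The projection of cocycles to cohomology. -/
def toCohomology (k : ℕ) : S.cocycles k →ₗ[K] S.Cohomology k :=
  Submodule.mkQ ((S.coboundaries k).submoduleOf (S.cocycles k))

/-- The graded vector space `H_CE(A; B) = ⨁_k H^k(Ω_A^•(B), d_A^Bott)`. -/
abbrev H : Type _ := ⨁ k, S.Cohomology k

/-- The class in `H_CE(A; B)` of a cocycle of degree `k`. -/
def cls {k : ℕ} (X : S.Cochain k) (hX : X ∈ S.cocycles k) : S.H :=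
  DirectSum.lof K ℕ S.Cohomology k (S.toCohomology k ⟨X, hX⟩)

end SplitPair

/-- A graded Lie bracket on the graded vector space `⨁ k, V k`: it has degree `0`, is graded
skew-symmetric and satisfies the graded Jacobi identity. -/
structure IsGradedLieBracket {V : ℕ → Type*} [∀ k, AddCommGroup (V k)] [∀ k, Module K (V k)]
    (br : (⨁ k, V k) →ₗ[K] (⨁ k, V k) →ₗ[K] ⨁ k, V k) : Prop where
  degree : ∀ p q (x : V p) (y : V q), ∃ z : V (p + q),
    br (DirectSum.lof K ℕ V p x) (DirectSum.lof K ℕ V q y) = DirectSum.lof K ℕ V (p + q) z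
  skew : ∀ p q (x : V p) (y : V q),
    br (DirectSum.lof K ℕ V p x) (DirectSum.lof K ℕ V q y) =
      -(-1 : K) ^ (p * q) • br (DirectSum.lof K ℕ V q y) (DirectSum.lof K ℕ V p x)
  jacobi : ∀ p q (x : V p) (y : V q) (z : ⨁ k, V k),
    br (DirectSum.lof K ℕ V p x) (br (DirectSum.lof K ℕ V q y) z) =
      br (br (DirectSum.lof K ℕ V p x) (DirectSum.lof K ℕ V q y)) z +
      (-1 : K) ^ (p * q) • br (DirectSum.lof K ℕ V q y) (br (DirectSum.lof K ℕ V p x) z)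

end Algebra

/-! ## Lie algebroids and Lie pairs over a smooth manifold -/

section Geometry

variable (K : Type*) [RCLike K]
  (E : Type*) [NormedAddCommGroup E] [NormedSpace ℝ E]
  {M : Type*} [TopologicalSpace M] [ChartedSpace E M]

/-- The algebra of smooth functions, as a subalgebra of all functions `M → K`. -/
def smoothSubalgebra (M : Type*) [TopologicalSpace M] [ChartedSpace E M] :
    Subalgebra K (M → K) where
  carrier := {f | ContMDiff 𝓘(ℝ, E) 𝓘(ℝ, K) ∞ f}
  mul_mem' hf hg :=
    ((ContinuousLinearMap.mul ℝ K).contMDiff.comp (show ContMDiff _ _ _ _ from hf)).clm_apply hg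
  add_mem' hf hg := ContMDiff.add hf hg
  algebraMap_mem' _ := contMDiff_const

/-- The algebra `C^∞(M, K)`, with the pointwise operations. -/
def SmoothFun (M : Type*) [TopologicalSpace M] [ChartedSpace E M] : Type _ :=
  smoothSubalgebra K E M

instance : CommRing (SmoothFun K E M) := inferInstanceAs (CommRing (smoothSubalgebra K E M))

instance : Algebra K (SmoothFun K E M) := inferInstanceAs (Algebra K (smoothSubalgebra K E M))

instance : CoeFun (SmoothFun K E M) (fun _ => M → K) := ⟨fun f => f.1⟩

/-- The differential of `f : M → K` at `x`, extended `K`-linearly to `T_x M ⊗ K`: a vector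
`c ⊗ v` goes to `c • df_x(v)`. -/
def diffK {M : Type*} [TopologicalSpace M] [ChartedSpace E M] (f : M → K) (x : M) :
    (K ⊗[ℝ] TangentSpace 𝓘(ℝ, E) x) →ₗ[K] K :=
  LinearMap.liftBaseChange K
    (ContinuousLinearMap.toLinearMap
      (show TangentSpace 𝓘(ℝ, E) x →L[ℝ] K from mfderiv 𝓘(ℝ, E) 𝓘(ℝ, K) f x))

variable (F : Type*) [NormedAddCommGroup F] [NormedSpace ℝ F] [NormedSpace K F]
  [IsScalarTower ℝ K F]
  (V : M → Type*) [∀ x, AddCommGroup (V x)] [∀ x, Module ℝ (V x)] [∀ x, Module K (V x)]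
  [TopologicalSpace (TotalSpace F V)] [∀ x, TopologicalSpace (V x)]
  [FiberBundle F V] [VectorBundle ℝ F V] [VectorBundle K F V]

/-- The smooth sections of the `K`-vector bundle `V`, as a submodule of all sections. -/
def sectionSubmodule : Submodule (smoothSubalgebra K E M) (∀ x, V x) where
  carrier := {u | ContMDiff 𝓘(ℝ, E) (𝓘(ℝ, E).prod 𝓘(ℝ, F)) ∞ fun x => TotalSpace.mk' F x (u x)}
  add_mem' hu hv := ContMDiff.add_section hu hv
  zero_mem' := contMDiff_zeroSection ℝ V
  smul_mem' := by
    intro f u hu x₀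
    have hu' := hu x₀
    have hf : ContMDiffAt 𝓘(ℝ, E) 𝓘(ℝ, K) ∞ (f : M → K) x₀ := f.2 x₀
    rw [contMDiffAt_section] at hu' ⊢
    set e := trivializationAt F V x₀
    refine (((ContinuousLinearMap.lsmul ℝ K : K →L[ℝ] F →L[ℝ] F).contMDiff.contMDiffAt.comp x₀
      hf).clm_apply hu').congr_of_eventuallyEq ?_
    filter_upwards [e.open_baseSet.mem_nhds (mem_baseSet_trivializationAt F V x₀)] with x hx
    exact (e.linear K hx).2 _ _

/-- The `C^∞(M, K)`-module `Γ(V)` of smooth sections of the `K`-vector bundle `V`, with the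
pointwise operations. -/
def Sections : Type _ := sectionSubmodule K E F V

instance : AddCommGroup (Sections K E F V) :=
  inferInstanceAs (AddCommGroup (sectionSubmodule K E F V))

instance : Module (SmoothFun K E M) (Sections K E F V) :=
  inferInstanceAs (Module (smoothSubalgebra K E M) (sectionSubmodule K E F V))

instance : Module K (Sections K E F V) :=
  Module.compHom _ (algebraMap K (SmoothFun K E M))

instance : IsScalarTower K (SmoothFun K E M) (Sections K E F V) :=
  IsScalarTower.of_algebraMap_smul fun _ _ => rfl

instance : CoeFun (Sections K E F V) (fun _ => ∀ x, V x) := ⟨fun u => u.1⟩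

variable {K E F V}

theorem smul_section_apply (f : SmoothFun K E M) (u : Sections K E F V) (x : M) :
    (f • u) x = f x • u x := rfl

theorem const_smul_section_apply (c : K) (u : Sections K E F V) (x : M) :
    (c • u) x = c • u x := rfl

theorem add_section_apply (u v : Sections K E F V) (x : M) : (u + v) x = u x + v x := rfl

variable (K E F V)

/-- A Lie algebroid: a `K`-vector bundle `V` over `M` with a bundle map `ρ : V → TM ⊗ K` and a
`K`-Lie bracket on `Γ(V)`, such that `ρ` is a Lie algebra homomorphism on sections and the Leibniz
rule holds. A section `ρ(u)` of `TM ⊗ K` acts on functions through their differentials: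
`(ρ(u) f)(x) = diffK K E f x (anchor x (u x))`. It is smooth when it maps smooth functions to
smooth functions, and brackets of sections of `TM ⊗ K` are commutators of operators on
functions. -/
structure LieAlgebroid where
  anchor : ∀ x, V x →ₗ[K] K ⊗[ℝ] TangentSpace 𝓘(ℝ, E) x
  anchor_smooth : ∀ (u : Sections K E F V) (f : SmoothFun K E M),
    ContMDiff 𝓘(ℝ, E) 𝓘(ℝ, K) ∞ fun x => diffK K E f x (anchor x (u x))
  bracket : Sections K E F V →ₗ[K] Sections K E F V →ₗ[K] Sections K E F V
  bracket_self : ∀ u, bracket u u = 0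
  jacobi : ∀ u v w, bracket u (bracket v w) = bracket (bracket u v) w + bracket v (bracket u w)
  anchor_bracket : ∀ (u v : Sections K E F V) (f : SmoothFun K E M) (x : M),
    diffK K E f x (anchor x (bracket u v x)) =
      diffK K E (fun y => diffK K E f y (anchor y (v y))) x (anchor x (u x)) -
      diffK K E (fun y => diffK K E f y (anchor y (u y))) x (anchor x (v x))
  leibniz : ∀ (u : Sections K E F V) (f : SmoothFun K E M) (v : Sections K E F V) (x : M),
    bracket u (f • v) x = diffK K E f x (anchor x (u x)) • v x + f x • bracket u v x

variable {K E F V}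

section diffK

theorem diffK_add {f g : M → K} (hf : ContMDiff 𝓘(ℝ, E) 𝓘(ℝ, K) ∞ f)
    (hg : ContMDiff 𝓘(ℝ, E) 𝓘(ℝ, K) ∞ g) (x : M) :
    diffK K E (f + g) x = diffK K E f x + diffK K E g x := by
  ext v
  have h := ((hf x).mdifferentiableAt (by simp)).hasMFDerivAt.add
    ((hg x).mdifferentiableAt (by simp)).hasMFDerivAt
  simp [diffK, h.mfderiv]
  rfl

theorem diffK_mul {f g : M → K} (hf : ContMDiff 𝓘(ℝ, E) 𝓘(ℝ, K) ∞ f)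
    (hg : ContMDiff 𝓘(ℝ, E) 𝓘(ℝ, K) ∞ g) (x : M) :
    diffK K E (f * g) x = f x • diffK K E g x + g x • diffK K E f x := by
  ext v
  have h := ((hf x).mdifferentiableAt (by simp)).hasMFDerivAt.mul
    ((hg x).mdifferentiableAt (by simp)).hasMFDerivAt
  simp [diffK, h.mfderiv]
  rfl

theorem diffK_const (c : K) (x : M) : diffK K E (fun _ => c) x = 0 := by
  ext v
  simp only [diffK, mfderiv_const]
  change LinearMap.liftBaseChange K (0 : _ →ₗ[ℝ] K) (1 ⊗ₜ[ℝ] v) = 0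
  simp

end diffK

/-- The vector field `ρ(u)` with values in `TM ⊗ K`, as a derivation of `C^∞(M, K)`. -/
def LieAlgebroid.anchorDer (𝔏 : LieAlgebroid K E F V) (u : Sections K E F V) :
    Derivation K (SmoothFun K E M) (SmoothFun K E M) :=
  Derivation.mk'
    { toFun := fun f => ⟨fun x => diffK K E f x (𝔏.anchor x (u x)), 𝔏.anchor_smooth u f⟩
      map_add' := fun f g => Subtype.ext <| funext fun x =>
        congrArg (· (𝔏.anchor x (u x))) (diffK_add f.2 g.2 x)
      map_smul' := fun c f => Subtype.ext <| funext fun x => by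
        have h := congrArg (· (𝔏.anchor x (u x))) (diffK_mul (contMDiff_const (c := c)) f.2 x)
        rw [diffK_const, smul_zero, add_zero] at h
        exact h }
    (fun f g => Subtype.ext <| funext fun x =>
      congrArg (· (𝔏.anchor x (u x))) (diffK_mul f.2 g.2 x))

/-- The Lie-Rinehart structure on the sections of a Lie algebroid. -/
def LieAlgebroid.toLieRinehart (𝔏 : LieAlgebroid K E F V) :
    LieRinehart K (SmoothFun K E M) (Sections K E F V) where
  bracket := 𝔏.bracket
  anchor :=
    { toFun := 𝔏.anchorDer
      map_add' := fun u v => Derivation.ext fun f => Subtype.ext <| funext fun x => by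
        change diffK K E f x (𝔏.anchor x (u x + v x)) =
          diffK K E f x (𝔏.anchor x (u x)) + diffK K E f x (𝔏.anchor x (v x))
        rw [map_add, map_add]
      map_smul' := fun g u => Derivation.ext fun f => Subtype.ext <| funext fun x => by
        change diffK K E f x (𝔏.anchor x (g x • u x)) =
          g x * diffK K E f x (𝔏.anchor x (u x))
        rw [map_smul, map_smul, smul_eq_mul] }
  bracket_self := 𝔏.bracket_self
  jacobi := 𝔏.jacobi
  anchor_bracket u v := Derivation.ext fun f => Subtype.ext <| funext fun x =>
    (𝔏.anchor_bracket u v f x).trans (by rw [Derivation.commutator_apply]; rfl)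
  leibniz u f v := Subtype.ext <| funext fun x => 𝔏.leibniz u f v x

/-- A family of subspaces of the fibers of `V` is a smooth subbundle: locally it is spanned by
pointwise linearly independent smooth sections. -/
def IsSmoothSubbundle (E F : Type*) [NormedAddCommGroup E] [NormedSpace ℝ E] {M : Type*}
    [TopologicalSpace M] [ChartedSpace E M] [NormedAddCommGroup F] [NormedSpace ℝ F]
    {V : M → Type*} [∀ x, AddCommGroup (V x)] [∀ x, Module K (V x)]
    [TopologicalSpace (TotalSpace F V)] [∀ x, TopologicalSpace (V x)] [FiberBundle F V]
    (A : ∀ x, Submodule K (V x)) : Prop :=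
  ∀ x₀ : M, ∃ U : Set M, IsOpen U ∧ x₀ ∈ U ∧ ∃ (n : ℕ) (s : Fin n → ∀ x, V x),
    (∀ i, ContMDiffOn 𝓘(ℝ, E) (𝓘(ℝ, E).prod 𝓘(ℝ, F)) ∞ (fun x => TotalSpace.mk' F x (s i x)) U) ∧
    ∀ x ∈ U, LinearIndependent K (fun i => s i x) ∧
      Submodule.span K (Set.range fun i => s i x) = A x

/-- A Lie pair `(L, A)`: a smooth subbundle `A` of `L` whose sections are closed under the
bracket. -/
structure LiePair (𝔏 : LieAlgebroid K E F V) where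
  A : ∀ x, Submodule K (V x)
  subbundle : IsSmoothSubbundle E F A
  bracket_mem : ∀ u v : Sections K E F V, (∀ x, u x ∈ A x) → (∀ x, v x ∈ A x) →
    ∀ x, 𝔏.bracket u v x ∈ A x

/-- A decomposition `L = A ⊕ B` with a smooth subbundle `B`. -/
structure LiePair.Splitting {𝔏 : LieAlgebroid K E F V} (P : LiePair 𝔏) where
  B : ∀ x, Submodule K (V x)
  subbundle : IsSmoothSubbundle E F B
  isCompl : ∀ x, IsCompl (P.A x) (B x)

/-- The sections of `V` with values in a family of subspaces. -/
def sectionsIn (A : ∀ x, Submodule K (V x)) :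
    Submodule (SmoothFun K E M) (Sections K E F V) where
  carrier := {u | ∀ x, u x ∈ A x}
  add_mem' hu hv x := (A x).add_mem (hu x) (hv x)
  zero_mem' x := (A x).zero_mem
  smul_mem' f _ hu x := (A x).smul_mem (f x) (hu x)

/-- The projection of a smooth section to a summand of a decomposition into smooth subbundles is
smooth. -/
theorem contMDiff_projection [FiniteDimensional K F] [ContMDiffVectorBundle ∞ F V 𝓘(ℝ, E)]
    {A B : ∀ x, Submodule K (V x)}
    (hA : IsSmoothSubbundle E F A) (hB : IsSmoothSubbundle E F B)
    (h : ∀ x, IsCompl (A x) (B x)) (u : Sections K E F V) :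
    ContMDiff 𝓘(ℝ, E) (𝓘(ℝ, E).prod 𝓘(ℝ, F)) ∞
      fun x => TotalSpace.mk' F x ((A x).projection (B x) (h x) (u x)) := by
  intro x₀
  obtain ⟨U, hUo, hxU, n, a, ha, hab⟩ := hA x₀
  obtain ⟨W, hWo, hxW, m, b, hb, hbb⟩ := hB x₀
  set t := trivializationAt F V x₀ with ht
  have hN : (U ∩ W) ∩ t.baseSet ∈ 𝓝 x₀ := Filter.inter_mem
    (Filter.inter_mem (hUo.mem_nhds hxU) (hWo.mem_nhds hxW))
    (t.open_baseSet.mem_nhds (mem_baseSet_trivializationAt F V x₀))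
  have hx₀ : x₀ ∈ (U ∩ W) ∩ t.baseSet := mem_of_mem_nhds hN
  let s : Fin n ⊕ Fin m → ∀ x, V x := Sum.elim a b
  -- the frame in the trivialization
  let φ : Fin n ⊕ Fin m → M → F := fun k x => (t ⟨x, s k x⟩).2
  have hφ : ∀ k, ContMDiffAt 𝓘(ℝ, E) 𝓘(ℝ, F) ∞ (φ k) x₀ := by
    rintro (i | i)
    · exact contMDiffAt_section x₀ |>.1 ((ha i).contMDiffAt (hUo.mem_nhds hxU))
    · exact contMDiffAt_section x₀ |>.1 ((hb i).contMDiffAt (hWo.mem_nhds hxW))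
  have hu : ContMDiffAt 𝓘(ℝ, E) 𝓘(ℝ, F) ∞ (fun x => (t ⟨x, u x⟩).2) x₀ :=
    contMDiffAt_section x₀ |>.1 (u.2 x₀)
  have : FiniteDimensional ℝ F := FiniteDimensional.trans ℝ K F
  let L : (Fin n ⊕ Fin m) → F →L[ℝ] ((Fin n ⊕ Fin m → K) →L[ℝ] F) := fun k =>
    ((ContinuousLinearMap.compL ℝ (Fin n ⊕ Fin m → K) K F).flip
      (ContinuousLinearMap.proj k)).comp (ContinuousLinearMap.lsmul ℝ K : K →L[ℝ] F →L[ℝ] F).flip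
  let T : M → ((Fin n ⊕ Fin m → K) →L[ℝ] F) := fun x => ∑ k, L k (φ k x)
  have hTapp : ∀ x c, T x c = ∑ k, c k • φ k x := fun x c => by
    simp [T, L]
  have hT : ContMDiffAt 𝓘(ℝ, E) 𝓘(ℝ, (Fin n ⊕ Fin m → K) →L[ℝ] F) ∞ T x₀ := by
    refine ContMDiffAt.sum fun k _ => ?_
    have hL : ContDiff ℝ ∞ (L k) :=
      ContinuousLinearMap.contDiff (𝕜 := ℝ) (E := F) (F := (Fin n ⊕ Fin m → K) →L[ℝ] F) (L k)
    exact hL.contMDiff.contMDiffAt.comp x₀ (hφ k)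
  -- near `x₀` the two frames together form a basis of each fiber
  have key : ∀ x ∈ (U ∩ W) ∩ t.baseSet, ∃ e : (Fin n ⊕ Fin m → K) ≃L[ℝ] F,
      T x = e ∧ ∀ v : V x, ∑ k, e.symm (t ⟨x, v⟩).2 k • s k x = v := by
    rintro x ⟨⟨hxU, hxW⟩, hxt⟩
    have hli : LinearIndependent K (fun k => s k x) := by
      have hs : (fun k => s k x) = Sum.elim (fun i => a i x) (fun i => b i x) := by
        funext k
        cases k <;> rfl
      rw [hs]
      exact (hab x hxU).1.sum_type (hbb x hxW).1
        (by rw [(hab x hxU).2, (hbb x hxW).2]; exact (h x).disjoint)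
    have hsp : ⊤ ≤ Submodule.span K (Set.range fun k => s k x) := by
      rw [← (h x).sup_eq_top, ← (hab x hxU).2, ← (hbb x hxW).2, ← Submodule.span_union]
      refine Submodule.span_mono ?_
      rintro _ (⟨i, rfl⟩ | ⟨i, rfl⟩)
      · exact ⟨Sum.inl i, rfl⟩
      · exact ⟨Sum.inr i, rfl⟩
    let bs := Module.Basis.mk hli hsp
    let e₀ : (Fin n ⊕ Fin m → K) ≃ₗ[K] F := bs.equivFun.symm ≪≫ₗ t.linearEquivAt K x hxt
    let e : (Fin n ⊕ Fin m → K) ≃L[ℝ] F := (e₀.restrictScalars ℝ).toContinuousLinearEquiv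
    have he : ∀ c, e c = t.linearEquivAt K x hxt (∑ k, c k • s k x) := fun c => by
      change t.linearEquivAt K x hxt (bs.equivFun.symm c) = _
      simp [Module.Basis.equivFun_symm_apply, bs]
    refine ⟨e, ?_, fun v => ?_⟩
    · ext1 c
      rw [hTapp, ContinuousLinearEquiv.coe_coe, he, map_sum]
      simp only [map_smul]
      rfl
    · apply (t.linearEquivAt K x hxt).injective
      rw [← he, ContinuousLinearEquiv.apply_symm_apply]
      rfl
  -- the coefficients of `u` in this frame are smooth
  let c : M → (Fin n ⊕ Fin m → K) := fun x => (T x).inverse (t ⟨x, u x⟩).2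
  have hc : ContMDiffAt 𝓘(ℝ, E) 𝓘(ℝ, Fin n ⊕ Fin m → K) ∞ c x₀ := by
    obtain ⟨e, he, -⟩ := key x₀ hx₀
    have h1 : ContDiffAt ℝ ∞ ContinuousLinearMap.inverse (T x₀) := by
      rw [he]; exact contDiffAt_map_inverse e
    exact (h1.contMDiffAt.comp x₀ hT).clm_apply hu
  have hcu : ∀ x ∈ (U ∩ W) ∩ t.baseSet, ∑ k, c x k • s k x = u x := by
    intro x hx
    obtain ⟨e, he, hv⟩ := key x hx
    simp only [c, he, ContinuousLinearMap.inverse_equiv]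
    exact hv (u x)
  -- the projection in the trivialization
  rw [contMDiffAt_section]
  have hsm : ContMDiffAt 𝓘(ℝ, E) 𝓘(ℝ, F) ∞
      (fun x => ∑ i : Fin n, c x (Sum.inl i) • φ (Sum.inl i) x) x₀ := by
    refine ContMDiffAt.sum fun i _ => ?_
    have hci : ContMDiffAt 𝓘(ℝ, E) 𝓘(ℝ, K) ∞ (fun x => c x (Sum.inl i)) x₀ :=
      (contMDiffAt_pi_space.1 hc) (Sum.inl i)
    exact ((ContinuousLinearMap.lsmul ℝ K : K →L[ℝ] F →L[ℝ] F).contMDiff.contMDiffAt.comp x₀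
      hci).clm_apply (hφ (Sum.inl i))
  refine hsm.congr_of_eventuallyEq ?_
  filter_upwards [hN] with x hx
  have hpr : (A x).projection (B x) (h x) (u x) = ∑ i, c x (Sum.inl i) • a i x := by
    have hAm : ∑ i, c x (Sum.inl i) • a i x ∈ A x := Submodule.sum_mem _ fun i _ =>
      Submodule.smul_mem _ _ ((hab x hx.1.1).2 ▸ Submodule.subset_span ⟨i, rfl⟩)
    have hBm : ∑ i, c x (Sum.inr i) • b i x ∈ B x := Submodule.sum_mem _ fun i _ =>
      Submodule.smul_mem _ _ ((hbb x hx.1.2).2 ▸ Submodule.subset_span ⟨i, rfl⟩)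
    have hux : u x = ∑ i, c x (Sum.inl i) • a i x + ∑ i, c x (Sum.inr i) • b i x := by
      rw [← hcu x hx, Fintype.sum_sum_type]
      rfl
    rw [hux, map_add, Submodule.projection_apply_of_mem_left _ hAm,
      (Submodule.projection_apply_eq_zero_iff (h x)).2 hBm, add_zero]
  change t.linearEquivAt K x hx.2 _ = _
  rw [hpr, map_sum]
  simp only [map_smul]
  rfl

variable [FiniteDimensional K F] [ContMDiffVectorBundle ∞ F V 𝓘(ℝ, E)]

theorem isCompl_sectionsIn {A B : ∀ x, Submodule K (V x)}
    (hA : IsSmoothSubbundle E F A) (hB : IsSmoothSubbundle E F B)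
    (h : ∀ x, IsCompl (A x) (B x)) :
    IsCompl (sectionsIn A : Submodule (SmoothFun K E M) (Sections K E F V)) (sectionsIn B) := by
  refine IsCompl.of_le (fun u hu => ?_) (fun u _ => ?_)
  · exact Subtype.ext <| funext fun x => Submodule.disjoint_def.1 (h x).disjoint _ (hu.1 x) (hu.2 x)
  · have hs := contMDiff_projection hA hB h u
    let a : Sections K E F V := ⟨fun x => (A x).projection (B x) (h x) (u x), hs⟩
    refine Submodule.mem_sup.2 ⟨a, fun x => ?_, u - a, fun x => ?_, add_sub_cancel _ _⟩
    · exact Submodule.projection_apply_mem (h x) (u x)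
    · change u x - (A x).projection (B x) (h x) (u x) ∈ B x
      rw [← Submodule.projection_apply_eq_zero_iff (h x), map_sub, sub_eq_zero]
      exact (Submodule.projection_apply_of_mem_left _ (Submodule.projection_apply_mem _ _)).symm

/-- The structure on `Γ(L) = Γ(A) ⊕ Γ(B)` given by a Lie pair and a decomposition `L = A ⊕ B`. -/
def LiePair.Splitting.toSplitPair {𝔏 : LieAlgebroid K E F V} {P : LiePair 𝔏} (S : P.Splitting) :
    SplitPair K (SmoothFun K E M) (Sections K E F V) where
  toLieRinehart := 𝔏.toLieRinehart
  A := sectionsIn P.A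
  B := sectionsIn S.B
  isCompl := isCompl_sectionsIn P.subbundle S.subbundle S.isCompl
  bracket_mem u hu v hv := P.bracket_mem u v hu hv

end Geometry

end LiePairs

end

/-! This is Voronov's derived bracket construction inside the Nijenhuis-Richardson graded Lie
algebra of alternating cochains on Γ(L) with values in Γ(L), additive but not necessarily linear
over functions. The bracket of L is an element `mu` of it with [mu, mu] = 0, which is the Jacobi
identity, so D = [mu, ·] is a derivation of square zero. The splitting gives a projection P
(`proj`): restrict the arguments to A and take the B-component of the value. Its image consists of
vertical cochains, which commute with each other. Its kernel, the cochains that preserve A, is a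
subalgebra, and it contains `mu` because A is a subalgebroid. Hence P[u, Pv] = P[u, v] whenever u
preserves A (`proj_nrBr_proj`). In these terms d_A^Bott = P D, [X, Y]_2 = -(-1)^p P[DX, Y] with p
the degree of X, and δ ▷ X = P[δ, X].

A form X is a cocycle exactly when DX preserves A, so for cocycles inner projections can be dropped
and the Jacobi identity of the big algebra applies. One correction is left: [DX, Y] is not vertical,
and replacing it by its projection inside a bracket with Z costs d of the ternary bracket P[[DX, Y],
Z] (`proj_nrBr_nrD`, `derBr_jacobi`). Skew-symmetry holds before passing to cohomology. A derivation
δ satisfies [δ, mu] = 0; if it also preserves A, it commutes with d and is a derivation of the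
bracket up to d of P[[δ, X], Y] (`actL_dL`, `actL_derBr`).

Two tasks remain. Neither `mu` nor δ is linear over functions, so linearity has to be checked for
the operations and for both homotopies; the derivative terms cancel, or lie in A before a projection
to B, or lie in B inside a slot of a vertical cochain (`isRAlt_dL`, `isRAlt_actL`, `isRAlt_derBr`,
`isRAlt_triBr`, `isRAlt_nrBr_nrBr_lift`). And the abstract operations have to be matched with the
explicit formulas (`res_dL`, `res_actL`, `res_derBr`), for the bracket through an expansion over
shuffles (`prB_nrBr_nrD`, `shSum_ofFn_shuffles`). -/

noncomputable section

namespace LiePairs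

/-! ## The Nijenhuis-Richardson bracket

Alternating cochains of all degrees on an additive group `G` are represented by functions on lists.
The parity of the number of arguments is recorded by a `Bool` (`true` for odd). -/

section NijenhuisRichardson

variable {G : Type*}

/-- The sign attached to a parity. -/
def sg (b : Bool) : ℤ := cond b (-1) 1

@[simp] theorem sg_true : sg true = -1 := rfl
@[simp] theorem sg_false : sg false = 1 := rfl

/-- Insertion of `v` into the first slot. -/
def contract (v : G) (X : List G → G) : List G → G := fun l => X (v :: l)

@[simp] theorem contract_apply (v : G) (X : List G → G) (l : List G) :
    contract v X l = X (v :: l) := rfl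

variable [AddCommGroup G]

/-- The Nijenhuis-Richardson bracket of cochains of parities `p` and `q`. -/
def nrBr : Bool → Bool → (List G → G) → (List G → G) → List G → G
  | _, _, X, Y, [] => X [Y []] - Y [X []]
  | p, q, X, Y, v :: l =>
    nrBr (!p) q (contract v X) Y l + sg (!p) • nrBr p (!q) X (contract v Y) l

theorem nrBr_nil (p q : Bool) (X Y : List G → G) : nrBr p q X Y [] = X [Y []] - Y [X []] := rfl

theorem nrBr_cons (p q : Bool) (X Y : List G → G) (v : G) (l : List G) :
    nrBr p q X Y (v :: l) =
      nrBr (!p) q (contract v X) Y l + sg (!p) • nrBr p (!q) X (contract v Y) l := rfl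

/-- Contraction is a graded derivation of the bracket. Since this is the defining recursion, bracket
identities can be proved by contracting until the list is empty. -/
theorem contract_nrBr (p q : Bool) (X Y : List G → G) (v : G) :
    contract v (nrBr p q X Y) =
      nrBr (!p) q (contract v X) Y + sg (!p) • nrBr p (!q) X (contract v Y) := rfl

/-- Alternating cochains of parity `p`. -/
structure IsAlt (p : Bool) (X : List G → G) : Prop where
  par : ∀ l, l.length.bodd ≠ p → X l = 0
  add : ∀ x y l, X ((x + y) :: l) = X (x :: l) + X (y :: l)
  swap : ∀ l₁ x y l₂, X (l₁ ++ x :: y :: l₂) = -X (l₁ ++ y :: x :: l₂)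

namespace IsAlt

variable {p q r : Bool} {X Y Z : List G → G}

/-- Additivity is demanded in the first slot only; `swap` transfers it to the second. -/
theorem contract (hX : IsAlt p X) (v : G) : IsAlt (!p) (contract v X) where
  par l hl := hX.par _ (by cases p <;> simp_all)
  add x y l := by
    have h := fun z => hX.swap [] v z l
    simp only [List.nil_append] at h
    simp only [contract_apply, h, hX.add, neg_add]
  swap l₁ x y l₂ := hX.swap (v :: l₁) x y l₂

theorem zero : IsAlt p (0 : List G → G) where
  par _ _ := rfl
  add _ _ _ := by simp
  swap _ _ _ _ := by simp

theorem addF (hX : IsAlt p X) (hY : IsAlt p Y) : IsAlt p (X + Y) where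
  par l hl := by simp [hX.par l hl, hY.par l hl]
  add x y l := by simp only [Pi.add_apply, hX.add, hY.add]; abel
  swap l₁ x y l₂ := by
    simp only [Pi.add_apply]; rw [hX.swap, hY.swap, neg_add]

theorem zsmul (n : ℤ) (hX : IsAlt p X) : IsAlt p (n • X) where
  par l hl := by simp [hX.par l hl]
  add x y l := by simp only [Pi.smul_apply, hX.add, smul_add]
  swap l₁ x y l₂ := by simp only [Pi.smul_apply]; rw [hX.swap, smul_neg]

theorem neg (hX : IsAlt p X) : IsAlt p (-X) := by simpa using hX.zsmul (-1)

theorem sub (hX : IsAlt p X) (hY : IsAlt p Y) : IsAlt p (X - Y) := by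
  simpa [sub_eq_add_neg] using hX.addF hY.neg

theorem contract_zero (hX : IsAlt p X) : LiePairs.contract 0 X = 0 := by
  funext l
  have := hX.add 0 0 l
  simpa using this

theorem contract_add (hX : IsAlt p X) (x y : G) :
    LiePairs.contract (x + y) X = LiePairs.contract x X + LiePairs.contract y X :=
  funext fun l => hX.add x y l

theorem map_cons_neg (hX : IsAlt p X) (x : G) (l : List G) : X (-x :: l) = -X (x :: l) := by
  have h := hX.add x (-x) l
  have h0 : X (0 :: l) = 0 := congrFun hX.contract_zero l
  rw [add_neg_cancel, h0] at h
  exact (neg_eq_of_add_eq_zero_right h.symm).symm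

theorem map_cons_sub (hX : IsAlt p X) (x y : G) (l : List G) :
    X ((x - y) :: l) = X (x :: l) - X (y :: l) := by
  rw [sub_eq_add_neg, hX.add, hX.map_cons_neg, sub_eq_add_neg]

theorem map_cons_zero (hX : IsAlt p X) (l : List G) : X (0 :: l) = 0 :=
  congrFun hX.contract_zero l

theorem nil (hX : IsAlt p X) (hp : p = true) : X [] = 0 := hX.par _ (by simp [hp])

theorem one (hX : IsAlt p X) (hp : p = false) (x : G) : X [x] = 0 := hX.par _ (by simp [hp])

theorem two (hX : IsAlt p X) (hp : p = true) (x y : G) : X [x, y] = 0 :=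
  hX.par _ (by simp [hp])

theorem map_cons_zsmul (hX : IsAlt p X) (n : ℤ) (x : G) (l : List G) :
    X ((n • x) :: l) = n • X (x :: l) :=
  map_zsmul (⟨⟨fun x => X (x :: l), hX.map_cons_zero l⟩, fun x y => hX.add x y l⟩ : G →+ G) n x

theorem map_cons_sg_smul (hX : IsAlt p X) (b : Bool) (x : G) (l : List G) :
    X ((sg b • x) :: l) = sg b • X (x :: l) := hX.map_cons_zsmul _ _ _

theorem contract_contract (hX : IsAlt p X) (x y : G) :
    LiePairs.contract x (LiePairs.contract y X) = -LiePairs.contract y (LiePairs.contract x X) :=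
  funext fun l => hX.swap [] y x l

end IsAlt

variable {p q r : Bool} {X X' Y Y' Z : List G → G}

theorem contract_addF (v : G) (X Y : List G → G) :
    contract v (X + Y) = contract v X + contract v Y := rfl

theorem contract_neg (v : G) (X : List G → G) : contract v (-X) = -contract v X := rfl

theorem nrBr_add_left (hY : IsAlt q Y) (X X' : List G → G) :
    nrBr p q (X + X') Y = nrBr p q X Y + nrBr p q X' Y := by
  funext l
  induction l generalizing p q X X' Y with
  | nil => simp only [nrBr_nil, Pi.add_apply, hY.add]; abel
  | cons v l ih =>
    simp only [nrBr_cons, Pi.add_apply, contract_addF] at ih ⊢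
    rw [ih hY, ih (hY.contract v), smul_add]
    abel

theorem nrBr_add_right (hX : IsAlt p X) (Y Y' : List G → G) :
    nrBr p q X (Y + Y') = nrBr p q X Y + nrBr p q X Y' := by
  funext l
  induction l generalizing p q X Y Y' with
  | nil => simp only [nrBr_nil, Pi.add_apply, hX.add]; abel
  | cons v l ih =>
    simp only [nrBr_cons, Pi.add_apply, contract_addF] at ih ⊢
    rw [ih hX, ih (hX.contract v), smul_add]
    abel

theorem nrBr_zsmul_left (hY : IsAlt q Y) (n : ℤ) (X : List G → G) :
    nrBr p q (n • X) Y = n • nrBr p q X Y :=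
  map_zsmul (AddMonoidHom.mk' (fun X => nrBr p q X Y) (nrBr_add_left hY)) n X

theorem nrBr_zsmul_right (hX : IsAlt p X) (n : ℤ) (Y : List G → G) :
    nrBr p q X (n • Y) = n • nrBr p q X Y :=
  map_zsmul (AddMonoidHom.mk' (fun Y => nrBr p q X Y) (nrBr_add_right hX)) n Y

theorem nrBr_neg_left (hY : IsAlt q Y) (X : List G → G) :
    nrBr p q (-X) Y = -nrBr p q X Y :=
  map_neg (AddMonoidHom.mk' (fun X => nrBr p q X Y) (nrBr_add_left hY)) X

theorem nrBr_neg_right (hX : IsAlt p X) (Y : List G → G) :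
    nrBr p q X (-Y) = -nrBr p q X Y :=
  map_neg (AddMonoidHom.mk' (fun Y => nrBr p q X Y) (nrBr_add_right hX)) Y

theorem nrBr_zero_left (hY : IsAlt q Y) : nrBr p q 0 Y = 0 :=
  map_zero (AddMonoidHom.mk' (fun X => nrBr p q X Y) (nrBr_add_left hY))

theorem nrBr_zero_right (hX : IsAlt p X) : nrBr p q X 0 = 0 :=
  map_zero (AddMonoidHom.mk' (fun Y => nrBr p q X Y) (nrBr_add_right hX))

theorem nrBr_sub_left (hY : IsAlt q Y) (X X' : List G → G) :
    nrBr p q (X - X') Y = nrBr p q X Y - nrBr p q X' Y :=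
  map_sub (AddMonoidHom.mk' (fun X => nrBr p q X Y) (nrBr_add_left hY)) X X'

theorem nrBr_sub_right (hX : IsAlt p X) (Y Y' : List G → G) :
    nrBr p q X (Y - Y') = nrBr p q X Y - nrBr p q X Y' :=
  map_sub (AddMonoidHom.mk' (fun Y => nrBr p q X Y) (nrBr_add_right hX)) Y Y'

/-- One argument is used up by the insertion, so the parity is that of p + q - 1, which is `p == q`.
-/
theorem IsAlt.nrBr (hX : IsAlt p X) (hY : IsAlt q Y) : IsAlt (p == q) (nrBr p q X Y) where
  par l hl := by
    induction l generalizing p q X Y with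
    | nil =>
      rw [nrBr_nil]
      cases p <;> cases q <;> simp at hl <;>
        simp [hX.nil, hX.one, hY.nil, hY.one, hX.map_cons_zero, hY.map_cons_zero]
    | cons v l ih =>
      rw [nrBr_cons, ih (hX.contract v) hY, ih hX (hY.contract v), smul_zero, add_zero] <;>
      · revert hl
        simp only [List.length_cons, Nat.bodd_succ]
        cases p <;> cases q <;> cases l.length.bodd <;> simp
  add x y l := by
    rw [nrBr_cons, hX.contract_add, hY.contract_add, nrBr_add_left hY, nrBr_add_right hX,
      nrBr_cons, nrBr_cons]
    simp only [Pi.add_apply, smul_add]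
    abel
  swap l₁ x y l₂ := by
    induction l₁ generalizing p q X Y with
    | nil =>
      simp only [List.nil_append, nrBr_cons]
      -- Contractions anticommute, and the two mixed terms, with one contraction on each factor,
      -- carry opposite signs; exchanging x and y therefore negates everything.
      rw [hX.contract_contract x y, hY.contract_contract x y, nrBr_neg_left hY, nrBr_neg_right hX]
      cases p <;> simp <;> abel
    | cons v l ih =>
      rw [List.cons_append, nrBr_cons, ih (hX.contract v) hY, ih hX (hY.contract v),
        List.cons_append, nrBr_cons, smul_neg, neg_add]

/-- The Lie degree is the number of arguments minus one, hence the negated parities in the sign. -/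
theorem nrBr_skew (hX : IsAlt p X) (hY : IsAlt q Y) :
    nrBr p q X Y = -sg (!p && !q) • nrBr q p Y X := by
  funext l
  induction l generalizing p q X Y with
  | nil =>
    rw [Pi.smul_apply, nrBr_nil, nrBr_nil]
    cases p <;> cases q <;>
        simp [hX.nil, hX.one, hY.nil, hY.one, hX.map_cons_zero, hY.map_cons_zero]
  | cons v l ih =>
    rw [Pi.smul_apply, nrBr_cons, nrBr_cons, ih (hX.contract v) hY, ih hX (hY.contract v)]
    simp only [Pi.smul_apply, smul_add, smul_smul]
    rw [add_comm]
    congr 2 <;> cases p <;> cases q <;> simp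

/-- Contraction is a derivation of the bracket, so contracting both sides yields the same identity
with one of the three cochains contracted. Only the empty list needs computation. -/
theorem nrBr_jacobi (hX : IsAlt p X) (hY : IsAlt q Y) (hZ : IsAlt r Z) :
    nrBr p (q == r) X (nrBr q r Y Z) = nrBr (p == q) r (nrBr p q X Y) Z +
      sg (!p && !q) • nrBr q (p == r) Y (nrBr p r X Z) := by
  funext l
  induction l generalizing p q r X Y Z with
  | nil =>
    simp only [nrBr_nil, nrBr_cons, Pi.add_apply, Pi.smul_apply, contract_apply]
    have hx := fun x y => hX.swap [] x y []
    have hy := fun x y => hY.swap [] x y []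
    have hz := fun x y => hZ.swap [] x y []
    simp only [List.nil_append] at hx hy hz
    cases p <;> cases q <;> cases r <;>
        simp [hX.nil, hX.one, hX.two, hY.nil, hY.one, hY.two, hZ.nil, hZ.one, hZ.two,
          hX.map_cons_zero, hY.map_cons_zero, hZ.map_cons_zero, hX.map_cons_neg, hY.map_cons_neg,
          hZ.map_cons_neg, hx _ 0, hy _ 0, hz _ 0]
    -- Three even cochains: the terms evaluate the cochains on pairs of constants, and antisymmetry
    -- matches them.
    · rw [hx (Z []), hy (Z []), hz (X [])]; abel
    · abel
  | cons v l ih =>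
    have e1 := ih (hX.contract v) hY hZ
    have e2 := ih hX (hY.contract v) hZ
    have e3 := ih hX hY (hZ.contract v)
    simp only [Pi.add_apply, Pi.smul_apply] at e1 e2 e3 ⊢
    simp only [nrBr_cons, contract_nrBr]
    rw [nrBr_add_right hX, nrBr_zsmul_right hX, nrBr_add_left hZ, nrBr_zsmul_left hZ,
      nrBr_add_right hY, nrBr_zsmul_right hY]
    simp only [Pi.add_apply, Pi.smul_apply]
    cases p <;> cases q <;> cases r <;> simp at e1 e2 e3 ⊢ <;> rw [e1, e2, e3] <;> abel

end NijenhuisRichardson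

theorem IsAlt.map_zero_mem {G : Type*} [AddCommGroup G] {p : Bool} {X : List G → G}
    (hX : IsAlt p X) {l : List G} (h : (0 : G) ∈ l) : X l = 0 := by
  induction l generalizing p X with
  | nil => simp at h
  | cons v l ih =>
    rcases List.mem_cons.1 h with rfl | h
    · exact hX.map_cons_zero l
    · exact ih (hX.contract v) h

/-! ### Cochains preserving A, vertical cochains, and the projection between them -/

namespace SplitPair

variable {K R 𝓛 : Type*} [Field K] [CommRing R] [Algebra K R] [AddCommGroup 𝓛]
  [Module K 𝓛] [Module R 𝓛] (S : SplitPair K R 𝓛)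

theorem coe_prA_of_mem {u : 𝓛} (hu : u ∈ S.A) : (S.prA u : 𝓛) = u :=
  congrArg Subtype.val (Submodule.projectionOnto_apply_left S.isCompl ⟨u, hu⟩)

theorem coe_prB_of_mem {u : 𝓛} (hu : u ∈ S.B) : (S.prB u : 𝓛) = u :=
  congrArg Subtype.val (Submodule.projectionOnto_apply_left S.isCompl.symm ⟨u, hu⟩)

theorem prB_eq_zero_iff {u : 𝓛} : S.prB u = 0 ↔ u ∈ S.A :=
  Submodule.projectionOnto_apply_eq_zero_iff S.isCompl.symm

theorem prA_eq_zero_iff {u : 𝓛} : S.prA u = 0 ↔ u ∈ S.B :=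
  Submodule.projectionOnto_apply_eq_zero_iff S.isCompl

theorem prA_add_prB (u : 𝓛) : (S.prA u : 𝓛) + S.prB u = u :=
  Submodule.projection_add_projection_eq_self S.isCompl u

/-- Cochains on `𝓛` that preserve `A`. -/
def Stable (w : List 𝓛 → 𝓛) : Prop := ∀ l, (∀ x ∈ l, x ∈ S.A) → w l ∈ S.A

/-- Cochains with values in `B` that vanish when an argument lies in `B`. -/
structure IsVert (X : List 𝓛 → 𝓛) : Prop where
  mem : ∀ l, X l ∈ S.B
  zero : ∀ l, ∀ x ∈ l, x ∈ S.B → X l = 0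

/-- The projection of cochains on `𝓛` to cochains on `A` with values in `B`. -/
def proj (w : List 𝓛 → 𝓛) : List 𝓛 → 𝓛 := fun l => S.prB (w (l.map fun x => S.prA x))

variable {S} {p q r : Bool} {X Y Z u v w : List 𝓛 → 𝓛}

theorem map_prA {l : List 𝓛} (hl : ∀ x ∈ l, x ∈ S.A) : (l.map fun x => (S.prA x : 𝓛)) = l := by
  conv_rhs => rw [← List.map_id l]
  exact List.map_congr_left fun x hx => S.coe_prA_of_mem (hl x hx)

theorem mem_map_prA (l : List 𝓛) : ∀ x ∈ l.map (fun x => (S.prA x : 𝓛)), x ∈ S.A := by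
  simp only [List.mem_map]
  rintro _ ⟨x, -, rfl⟩
  exact (S.prA x).2

theorem Stable.contract (hw : S.Stable w) {a : 𝓛} (ha : a ∈ S.A) : S.Stable (contract a w) :=
  fun l hl => hw (a :: l) (by simpa using ⟨ha, hl⟩)

/-- The kernel of `proj` is thus a graded Lie subalgebra; see `proj_eq_zero_iff`. -/
theorem Stable.nrBr (hu : S.Stable u) (hv : S.Stable v) : S.Stable (nrBr p q u v) := by
  intro l hl
  induction l generalizing p q u v with
  | nil =>
    refine sub_mem (hu _ ?_) (hv _ ?_) <;> simp only [List.mem_singleton, forall_eq]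
    exacts [hv [] (by simp), hu [] (by simp)]
  | cons a l ih =>
    simp only [List.mem_cons, forall_eq_or_imp] at hl
    rw [nrBr_cons]
    exact add_mem (ih (hu.contract hl.1) hv hl.2) (zsmul_mem (ih hu (hv.contract hl.1) hl.2) _)

theorem IsVert.contract (hX : S.IsVert X) (a : 𝓛) : S.IsVert (contract a X) where
  mem _ := hX.mem _
  zero l x hx hxB := hX.zero (a :: l) x (List.mem_cons_of_mem _ hx) hxB

theorem IsVert.contract_eq_zero (hX : S.IsVert X) {b : 𝓛} (hb : b ∈ S.B) :
    LiePairs.contract b X = 0 :=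
  funext fun _ => hX.zero _ b List.mem_cons_self hb

/-- The bracket inserts a value of one cochain, an element of B, into a slot of the other, where it
is killed. -/
theorem IsVert.nrBr_eq_zero (hX : S.IsVert X) (hY : S.IsVert Y) : nrBr p q X Y = 0 := by
  funext l
  induction l generalizing p q X Y with
  | nil =>
    rw [nrBr_nil, hX.zero _ _ List.mem_cons_self (hY.mem _),
      hY.zero _ _ List.mem_cons_self (hX.mem _)]
    simp
  | cons a l ih =>
    rw [nrBr_cons, ih (hX.contract a) hY, ih hX (hY.contract a)]
    simp

theorem proj_eq_zero_iff : S.proj w = 0 ↔ S.Stable w := by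
  constructor
  · intro h l hl
    have := congrFun h l
    simp only [proj, map_prA hl, Pi.zero_apply, ZeroMemClass.coe_eq_zero] at this
    exact S.prB_eq_zero_iff.1 this
  · intro h
    funext l
    simp only [proj, Pi.zero_apply, ZeroMemClass.coe_eq_zero]
    exact S.prB_eq_zero_iff.2 (h _ (mem_map_prA l))

theorem proj_add : S.proj (u + v) = S.proj u + S.proj v := by
  funext l; simp [proj]

theorem proj_sub : S.proj (u - v) = S.proj u - S.proj v := by
  funext l; simp [proj]

theorem proj_zsmul (n : ℤ) : S.proj (n • u) = n • S.proj u := by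
  funext l; simp [proj]

theorem proj_zero : S.proj (0 : List 𝓛 → 𝓛) = 0 := by
  funext l; simp [proj]

theorem isAlt_proj (hw : IsAlt p w) : IsAlt p (S.proj w) where
  par l hl := by simp [proj, hw.par (l.map fun x => (S.prA x : 𝓛)) (by simpa using hl)]
  add x y l := by simp [proj, hw.add]
  swap l₁ x y l₂ := by
    simp only [proj, List.map_append, List.map_cons]
    rw [hw.swap]
    simp

theorem isVert_proj (hw : IsAlt p w) : S.IsVert (S.proj w) where
  mem l := (S.prB _).2
  zero l x hx hxB := by
    have h0 : (0 : 𝓛) ∈ l.map fun x => (S.prA x : 𝓛) :=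
      List.mem_map.2 ⟨x, hx, by simp [S.prA_eq_zero_iff.2 hxB]⟩
    simp [proj, hw.map_zero_mem h0]

theorem stable_sub_proj (w : List 𝓛 → 𝓛) : S.Stable (w - S.proj w) := by
  intro l hl
  rw [Pi.sub_apply, proj, map_prA hl, ← S.prA_add_prB (w l), add_sub_assoc]
  simpa only [map_add, S.prA_add_prB, sub_self, add_zero] using (S.prA (w l)).2

/-- The difference of v and its projection preserves A, hence so does its bracket with u. This is
what allows inner projections to be dropped in iterated derived brackets. -/
theorem proj_nrBr_proj (hu : S.Stable u) (hua : IsAlt p u) (v : List 𝓛 → 𝓛) :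
    S.proj (nrBr p q u (S.proj v)) = S.proj (nrBr p q u v) := by
  have h : S.proj (nrBr p q u (v - S.proj v)) = 0 :=
    proj_eq_zero_iff.2 (hu.nrBr (stable_sub_proj v))
  rw [nrBr_sub_right hua, proj_sub, sub_eq_zero] at h
  exact h.symm

/-! ### Cochains of low degree -/

section LowDegree

/-- A section as a cochain with no arguments. -/
def const (v : 𝓛) : List 𝓛 → 𝓛
  | [] => v
  | _ => 0

/-- An operator as a cochain with one argument. -/
def lift (δ : 𝓛 →ₗ[K] 𝓛) : List 𝓛 → 𝓛
  | [x] => δ x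
  | _ => 0

variable (S) in
/-- The Lie bracket as a cochain with two arguments. -/
def mu : List 𝓛 → 𝓛
  | [x, y] => S.bracket x y
  | _ => 0

/-- The sum over all slots of `X` with `δ` applied to the argument in the slot. -/
def ins (δ : 𝓛 → 𝓛) : (List 𝓛 → 𝓛) → List 𝓛 → 𝓛
  | _, [] => 0
  | X, x :: l => X (δ x :: l) + ins δ (contract x X) l

theorem ins_zero (δ : 𝓛 → 𝓛) (l : List 𝓛) : ins δ 0 l = 0 := by
  induction l with
  | nil => rfl
  | cons z l ih => 
    have h : contract z (0 : List 𝓛 → 𝓛) = 0 := rfl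
    rw [ins, h, ih, Pi.zero_apply, add_zero]

theorem bracket_skew (u v : 𝓛) : S.bracket u v = -S.bracket v u := by
  have h := S.bracket_self (u + v)
  simp only [map_add, LinearMap.add_apply, S.bracket_self, zero_add, add_zero] at h
  exact eq_neg_of_add_eq_zero_right h

theorem isAlt_lift (δ : 𝓛 →ₗ[K] 𝓛) : IsAlt true (lift δ) where
  par l hl := by
    rcases l with _ | ⟨x, _ | ⟨y, l⟩⟩
    · rfl
    · simp at hl
    · rfl
  add x y l := by
    rcases l with _ | ⟨z, l⟩
    · exact map_add δ x y
    · simp [lift]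
  swap l₁ x y l₂ := by
    rcases l₁ with _ | ⟨z, _ | ⟨z', l₁⟩⟩ <;> simp [lift]

theorem isAlt_mu : IsAlt false S.mu where
  par l hl := by
    rcases l with _ | ⟨x, _ | ⟨y, _ | ⟨z, l⟩⟩⟩
    · rfl
    · rfl
    · simp at hl
    · rfl
  add x y l := by
    rcases l with _ | ⟨z, _ | ⟨z', l⟩⟩ <;> simp [mu]
  swap l₁ x y l₂ := by
    rcases l₁ with _ | ⟨z, _ | ⟨z', _ | ⟨z'', l₁⟩⟩⟩ <;> rcases l₂ with _ | ⟨t, l₂⟩ <;> simp [mu]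
    exact bracket_skew x y

theorem contract_mu (x : 𝓛) : contract x S.mu = lift (S.bracket x) := by
  funext l
  rcases l with _ | ⟨y, _ | ⟨z, l⟩⟩ <;> rfl

theorem contract_lift (δ : 𝓛 →ₗ[K] 𝓛) (x : 𝓛) : contract x (lift δ) = const (δ x) := by
  funext l
  rcases l with _ | ⟨y, l⟩ <;> rfl

theorem contract_const (v x : 𝓛) : contract x (const v) = 0 := rfl

/-- Contraction is an inner derivation up to sign; the recursion for the bracket is the Jacobi
identity with a constant. -/
theorem nrBr_const (hX : IsAlt q X) (v : 𝓛) : nrBr false q (const v) X = -contract v X := by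
  funext l
  induction l generalizing q X with
  | nil => simp [nrBr_nil, const]
  | cons x l ih =>
    have h := hX.swap [] x v l
    rw [nrBr_cons, ih (hX.contract x), contract_const, nrBr_zero_left hX]
    simpa using h

/-- The Lie derivative along δ. Each contraction turns `lift δ` into a constant, whose bracket with
X contributes one slot of `ins`. -/
theorem nrBr_lift (hX : IsAlt q X) (δ : 𝓛 →ₗ[K] 𝓛) (l : List 𝓛) :
    nrBr true q (lift δ) X l = δ (X l) - ins δ X l := by
  induction l generalizing q X with
  | nil => simp [nrBr_nil, lift, ins, hX.map_cons_zero]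
  | cons x l ih =>
    rw [nrBr_cons, contract_lift, Bool.not_true, nrBr_const hX, ih (hX.contract x)]
    simp [ins]
    abel

theorem nrBr_lift_lift (δ δ' : 𝓛 →ₗ[K] 𝓛) :
    nrBr true true (lift δ) (lift δ') = lift (δ ∘ₗ δ' - δ' ∘ₗ δ) := by
  funext l
  rw [nrBr_lift (isAlt_lift δ')]
  rcases l with _ | ⟨x, _ | ⟨y, l⟩⟩
  · simp [lift, ins]
  · simp [lift, ins]
  · have h : ins δ (contract y (contract x (lift δ'))) l = 0 := by
      rw [contract_lift, contract_const, ins_zero]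
    simp [lift, ins, h, contract]

theorem nrBr_lift_mu {δ : 𝓛 →ₗ[K] 𝓛}
    (hδ : ∀ x y, δ (S.bracket x y) = S.bracket (δ x) y + S.bracket x (δ y)) :
    nrBr true false (lift δ) S.mu = 0 := by
  funext l
  rw [nrBr_lift isAlt_mu]
  rcases l with _ | ⟨x, _ | ⟨y, _ | ⟨z, l⟩⟩⟩
  · simp [mu, ins]
  · simp [mu, ins]
  · simp [mu, ins, hδ]
  · have h : contract z (contract y (contract x S.mu)) = 0 := by
      rw [contract_mu, contract_lift, contract_const]
    simp [mu, ins, h, ins_zero]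

/-- Contracting with x leaves brackets of `mu` with the operator [x, ·], which is a derivation by
the Jacobi identity and so commutes with `mu`. -/
theorem nrBr_mu_mu : nrBr false false S.mu S.mu = 0 := by
  funext l
  rcases l with _ | ⟨x, l⟩
  · simp [nrBr_nil, mu]
  · have h : nrBr true false (lift (S.bracket x)) S.mu = 0 := nrBr_lift_mu (S.jacobi x)
    have h' : nrBr false true S.mu (lift (S.bracket x)) = 0 := by
      rw [nrBr_skew isAlt_mu (isAlt_lift _), h, smul_zero]
    simp [nrBr_cons, contract_mu, h, h']

theorem stable_mu : S.Stable S.mu := by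
  intro l hl
  rcases l with _ | ⟨x, _ | ⟨y, _ | ⟨z, l⟩⟩⟩
  · exact zero_mem _
  · exact zero_mem _
  · simp only [List.mem_cons, List.not_mem_nil, or_false, forall_eq_or_imp, forall_eq] at hl
    exact S.bracket_mem _ hl.1 _ hl.2
  · exact zero_mem _

theorem stable_lift {δ : 𝓛 →ₗ[K] 𝓛} (hδ : ∀ x ∈ S.A, δ x ∈ S.A) : S.Stable (lift δ) := by
  intro l hl
  rcases l with _ | ⟨x, _ | ⟨y, l⟩⟩
  · exact zero_mem _
  · exact hδ _ (hl _ (by simp))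
  · exact zero_mem _

end LowDegree

/-! ### The derived bracket -/

section Derived

variable (S) in
/-- The adjoint action of the Lie bracket. -/
def nrD (p : Bool) (X : List 𝓛 → 𝓛) : List 𝓛 → 𝓛 := nrBr false p S.mu X

theorem isAlt_nrD (hX : IsAlt p X) : IsAlt (!p) (S.nrD p X) := by
  simpa [nrD] using (isAlt_mu (S := S)).nrBr hX

theorem nrD_sub (X Y : List 𝓛 → 𝓛) : S.nrD p (X - Y) = S.nrD p X - S.nrD p Y :=
  nrBr_sub_right isAlt_mu _ _

theorem nrD_zsmul (n : ℤ) (X : List 𝓛 → 𝓛) : S.nrD p (n • X) = n • S.nrD p X :=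
  nrBr_zsmul_right isAlt_mu _ _

theorem nrD_zero : S.nrD p 0 = 0 := nrBr_zero_right (isAlt_mu (S := S))

/-- Cartan's formula: contraction by x and D anticommute up to the Lie derivative along x. -/
theorem contract_nrD (x : 𝓛) : contract x (S.nrD p X) =
    nrBr true p (lift (S.bracket x)) X - S.nrD (!p) (contract x X) := by
  rw [nrD, contract_nrBr, contract_mu]
  simp [nrD, sub_eq_add_neg]

/-- The Jacobi identity for `mu`, `mu`, X together with [mu, mu] = 0 gives 2 D² X = 0;
characteristic zero removes the factor 2. -/
theorem nrD_nrD [CharZero K] (hX : IsAlt p X) : S.nrD (!p) (S.nrD p X) = 0 := by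
  have h := nrBr_jacobi (isAlt_mu (S := S)) (isAlt_mu (S := S)) hX
  rw [nrBr_mu_mu, nrBr_zero_left hX] at h
  simp only [Bool.false_beq, Bool.not_false, Bool.and_self, sg_true, neg_smul, one_smul,
    zero_add, eq_neg_iff_add_eq_zero] at h
  rw [← two_smul K] at h
  funext l
  exact (smul_eq_zero.1 (congrFun h l)).resolve_left two_ne_zero

theorem nrD_nrBr (hu : IsAlt p u) (hv : IsAlt q v) : S.nrD (p == q) (nrBr p q u v) =
    nrBr (!p) q (S.nrD p u) v + sg (!p) • nrBr p (!q) u (S.nrD q v) := by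
  simpa [nrD] using nrBr_jacobi (isAlt_mu (S := S)) hu hv

variable (S) in
/-- The differential of cochains on `A` with values in `B`. -/
def dL (p : Bool) (X : List 𝓛 → 𝓛) : List 𝓛 → 𝓛 := S.proj (S.nrD p X)

variable (S) in
/-- The derived bracket of cochains on `A` with values in `B`. -/
def derBr (p q : Bool) (X Y : List 𝓛 → 𝓛) : List 𝓛 → 𝓛 :=
  S.proj (nrBr (!p) q (S.nrD p X) Y)

variable (S) in
/-- The action of an operator on cochains on `A` with values in `B`. -/
def actL (δ : 𝓛 →ₗ[K] 𝓛) (p : Bool) (X : List 𝓛 → 𝓛) : List 𝓛 → 𝓛 :=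
  S.proj (nrBr true p (lift δ) X)

theorem dL_proj (p : Bool) (w : List 𝓛 → 𝓛) : S.dL p (S.proj w) = S.proj (S.nrD p w) :=
  proj_nrBr_proj stable_mu isAlt_mu w

theorem isAlt_dL (hX : IsAlt p X) : IsAlt (!p) (S.dL p X) := isAlt_proj (isAlt_nrD hX)

theorem isAlt_derBr (hX : IsAlt p X) (hY : IsAlt q Y) : IsAlt (p ^^ q) (S.derBr p q X Y) := by
  have := isAlt_proj (S := S) ((isAlt_nrD (S := S) hX).nrBr hY)
  cases p <;> cases q <;> exact this

theorem isAlt_actL (hX : IsAlt p X) (δ : 𝓛 →ₗ[K] 𝓛) : IsAlt p (S.actL δ p X) := by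
  simpa [actL] using isAlt_proj (S := S) ((isAlt_lift δ).nrBr hX)

theorem dL_dL [CharZero K] (hX : IsAlt p X) : S.dL (!p) (S.dL p X) = 0 := by
  rw [dL.eq_1 S p X, dL_proj, nrD_nrD hX, proj_zero]

theorem stable_nrD (h : S.dL p X = 0) : S.Stable (S.nrD p X) := proj_eq_zero_iff.1 h

/-- D is a derivation of square zero, so D[DX, Y] has only the term with DY. -/
theorem nrBr_nrD_nrD [CharZero K] (hX : IsAlt p X) (hY : IsAlt q Y) :
    nrBr (!p) (!q) (S.nrD p X) (S.nrD q Y) =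
      sg p • S.nrD (p ^^ q) (nrBr (!p) q (S.nrD p X) Y) := by
  have h := nrD_nrBr (S := S) (isAlt_nrD (S := S) hX) hY
  rw [nrD_nrD hX, nrBr_zero_left hY, zero_add] at h
  cases p <;> cases q <;> simp at h ⊢ <;> simp [h]

/-- For cocycles both DX and DY preserve A, hence so does their bracket, which is D[DX, Y] up to
sign. -/
theorem dL_derBr [CharZero K] (hX : IsAlt p X) (hY : IsAlt q Y) (hdX : S.dL p X = 0)
    (hdY : S.dL q Y = 0) : S.dL (p ^^ q) (S.derBr p q X Y) = 0 := by
  have h := proj_eq_zero_iff.2 ((stable_nrD hdX).nrBr (p := !p) (q := !q) (stable_nrD hdY))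
  rw [nrBr_nrD_nrD hX hY, proj_zsmul] at h
  rw [derBr, dL_proj]
  cases p <;> simpa using h

theorem derBr_dL [CharZero K] (hX : IsAlt p X) (hY : IsAlt q Y) (hdX : S.dL p X = 0) :
    S.derBr p (!q) X (S.dL q Y) = sg p • S.dL (p ^^ q) (S.derBr p q X Y) := by
  rw [derBr, dL, proj_nrBr_proj (stable_nrD hdX) (isAlt_nrD hX), nrBr_nrD_nrD hX hY, proj_zsmul,
    derBr, dL_proj]

/-- Apply D to [X, Y] = 0, the commutation of vertical cochains. No cocycle condition is involved.
-/
theorem derBr_skew (hX : IsAlt p X) (hY : IsAlt q Y) (hvX : S.IsVert X) (hvY : S.IsVert Y) :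
    S.derBr p q X Y = sg (p ^^ (q ^^ !(p && q))) • S.derBr q p Y X := by
  have h := nrD_nrBr (S := S) hX hY
  rw [hvX.nrBr_eq_zero hvY, nrD_zero, nrBr_skew hX (isAlt_nrD hY)] at h
  rw [derBr, derBr, ← proj_zsmul, eq_neg_of_add_eq_zero_left h.symm]
  congr 1
  cases p <;> cases q <;> simp

/-- The cost of replacing w by its vertical part is exact. Put w' = w - P w and expand D[w', Z]: the
term [w', DZ] is killed by P since both factors preserve A, and [w', Z] = [w, Z] since P w and Z
commute. All homotopies below come from here. -/
theorem proj_nrBr_nrD (hw : IsAlt p w) (hZ : IsAlt r Z) (hvZ : S.IsVert Z) (hdZ : S.dL r Z = 0) :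
    S.proj (nrBr (!p) r (S.nrD p w) Z) =
      S.derBr p r (S.proj w) Z + S.dL (p == r) (S.proj (nrBr p r w Z)) := by
  have hw' := hw.sub (isAlt_proj (S := S) hw)
  have h := congrArg S.proj (nrD_nrBr (S := S) hw' hZ)
  rw [proj_add, proj_zsmul,
    proj_eq_zero_iff.2 ((stable_sub_proj w).nrBr (p := p) (q := !r) (stable_nrD hdZ)),
    smul_zero, add_zero, nrBr_sub_left hZ, (isVert_proj hw).nrBr_eq_zero hvZ, sub_zero,
    nrD_sub, nrBr_sub_left hZ, proj_sub] at h
  rw [dL_proj, h, derBr]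
  abel

/-- Jacobi for DX, DY, Z, where [DX, DY] is D of w = [DX, Y] up to sign. The vertical part of w is
the derived bracket of X and Y, and `proj_nrBr_nrD` accounts for the rest. -/
theorem derBr_jacobi [CharZero K] (hX : IsAlt p X) (hY : IsAlt q Y) (hZ : IsAlt r Z)
    (hvZ : S.IsVert Z) (hdX : S.dL p X = 0) (hdY : S.dL q Y = 0) (hdZ : S.dL r Z = 0) :
    S.derBr p (q ^^ r) X (S.derBr q r Y Z) =
      sg p • S.derBr (p ^^ q) r (S.derBr p q X Y) Z +
      sg (p && q) • S.derBr q (p ^^ r) Y (S.derBr p r X Z) +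
      sg p • S.dL (!(p ^^ q ^^ r)) (S.proj (nrBr (p ^^ q) r (nrBr (!p) q (S.nrD p X) Y) Z)) := by
  have hDX := isAlt_nrD (S := S) hX
  have hDY := isAlt_nrD (S := S) hY
  have hw : IsAlt (p ^^ q) (nrBr (!p) q (S.nrD p X) Y) := by
    have := hDX.nrBr hY
    cases p <;> cases q <;> exact this
  have e1 : ((!q) == r) = (q ^^ r) := by cases q <;> cases r <;> rfl
  have e2 : ((!p) == r) = (p ^^ r) := by cases p <;> cases r <;> rfl
  have e3 : ((!p) == !q) = !(p ^^ q) := by cases p <;> cases q <;> rfl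
  have e4 : ((p ^^ q) == r) = !(p ^^ q ^^ r) := by cases p <;> cases q <;> cases r <;> rfl
  have h := nrBr_jacobi hDX hDY hZ
  rw [nrBr_nrD_nrD hX hY, nrBr_zsmul_left hZ, e1, e2, e3, Bool.not_not, Bool.not_not] at h
  simp only [derBr] at *
  rw [proj_nrBr_proj (stable_nrD hdX) hDX, proj_nrBr_proj (stable_nrD hdY) hDY, h, proj_add,
    proj_zsmul, proj_zsmul, proj_nrBr_nrD hw hZ hvZ hdZ, e4, derBr, smul_add]
  abel

variable {δ δ' : 𝓛 →ₗ[K] 𝓛}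

/-- A derivation of the bracket commutes with `mu`, hence with D; since δ and `mu` preserve A, this
survives the projection. -/
theorem actL_dL (hX : IsAlt p X) (hA : ∀ x ∈ S.A, δ x ∈ S.A)
    (hδ : ∀ x y, δ (S.bracket x y) = S.bracket (δ x) y + S.bracket x (δ y)) :
    S.actL δ (!p) (S.dL p X) = S.dL p (S.actL δ p X) := by
  have h := nrBr_jacobi (isAlt_lift δ) (isAlt_mu (S := S)) hX
  rw [nrBr_lift_mu hδ, nrBr_zero_left hX] at h
  rw [actL, actL, dL_proj, dL, proj_nrBr_proj (stable_lift hA) (isAlt_lift δ)]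
  simpa [nrD] using congrArg S.proj h

/-- Jacobi for δ, DX, Y, with [δ, DX] = D[δ, X]. As [δ, X] need not be vertical, `proj_nrBr_nrD`
produces the exact term. -/
theorem actL_derBr [CharZero K] (hX : IsAlt p X) (hY : IsAlt q Y) (hA : ∀ x ∈ S.A, δ x ∈ S.A)
    (hvY : S.IsVert Y) (hdX : S.dL p X = 0) (hdY : S.dL q Y = 0)
    (hδ : ∀ x y, δ (S.bracket x y) = S.bracket (δ x) y + S.bracket x (δ y)) :
    S.actL δ (p ^^ q) (S.derBr p q X Y) =
      S.derBr p q (S.actL δ p X) Y + S.derBr p q X (S.actL δ q Y) +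
      S.dL (p == q) (S.proj (nrBr p q (nrBr true p (lift δ) X) Y)) := by
  have hDX := isAlt_nrD (S := S) hX
  have h := nrBr_jacobi (isAlt_lift δ) hDX hY
  have h' := nrBr_jacobi (isAlt_lift δ) (isAlt_mu (S := S)) hX
  rw [nrBr_lift_mu hδ, nrBr_zero_left hX] at h'
  have e1 : ((!p) == q) = (p ^^ q) := by cases p <;> cases q <;> rfl
  have hw : IsAlt p (nrBr true p (lift δ) X) := by simpa using (isAlt_lift δ).nrBr hX
  simp only [Bool.false_beq, Bool.true_beq, Bool.not_true, Bool.not_false, Bool.false_and,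
    sg_false, one_smul, zero_add] at h h'
  rw [e1] at h
  change nrBr true (!p) (lift δ) (S.nrD p X) = S.nrD p (nrBr true p (lift δ) X) at h'
  rw [h'] at h
  rw [actL, derBr, proj_nrBr_proj (stable_lift hA) (isAlt_lift δ), h, proj_add,
    proj_nrBr_nrD hw hY hvY hdY, derBr, derBr, derBr, actL, actL,
    proj_nrBr_proj (stable_nrD hdX) hDX]
  abel

theorem actL_comm (hX : IsAlt p X) (hA : ∀ x ∈ S.A, δ x ∈ S.A) (hA' : ∀ x ∈ S.A, δ' x ∈ S.A) :
    S.actL (δ ∘ₗ δ' - δ' ∘ₗ δ) p X =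
      S.actL δ p (S.actL δ' p X) - S.actL δ' p (S.actL δ p X) := by
  have h := nrBr_jacobi (isAlt_lift δ) (isAlt_lift δ') hX
  simp only [Bool.true_beq, Bool.not_true, Bool.false_and, sg_false, one_smul, beq_self_eq_true,
    nrBr_lift_lift] at h
  simp only [actL]
  rw [proj_nrBr_proj (stable_lift hA) (isAlt_lift δ),
    proj_nrBr_proj (stable_lift hA') (isAlt_lift δ'), h, proj_add, add_sub_cancel_right]

end Derived

end SplitPair

namespace SplitPair

/-! ### Shuffle sums -/

section ShuffleSum

variable {𝓛 V : Type*} [AddCommGroup V]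

/-- The signed sum over all `(l₁, l₂)`-shuffles of a list. -/
def shSum : (List 𝓛 → List 𝓛 → V) → List 𝓛 → V
  | Φ, [] => Φ [] []
  | Φ, v :: l => shSum (fun l₁ l₂ => Φ (v :: l₁) l₂) l +
      shSum (fun l₁ l₂ => sg l₁.length.bodd • Φ l₁ (v :: l₂)) l

theorem shSum_add (Φ Ψ : List 𝓛 → List 𝓛 → V) (l : List 𝓛) :
    shSum (fun l₁ l₂ => Φ l₁ l₂ + Ψ l₁ l₂) l = shSum Φ l + shSum Ψ l := by
  induction l generalizing Φ Ψ with
  | nil => rfl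
  | cons v l ih => simp only [shSum, smul_add, ih]; abel

theorem shSum_map {V' : Type*} [AddCommGroup V'] (g : V →+ V') (Φ : List 𝓛 → List 𝓛 → V)
    (l : List 𝓛) : shSum (fun l₁ l₂ => g (Φ l₁ l₂)) l = g (shSum Φ l) := by
  induction l generalizing Φ with
  | nil => rfl
  | cons v l ih => simp only [shSum, ← map_zsmul, ih, map_add]

theorem shSum_zsmul (n : ℤ) (Φ : List 𝓛 → List 𝓛 → V) (l : List 𝓛) :
    shSum (fun l₁ l₂ => n • Φ l₁ l₂) l = n • shSum Φ l :=
  shSum_map (zsmulAddGroupHom n) Φ l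

theorem shSum_neg (Φ : List 𝓛 → List 𝓛 → V) (l : List 𝓛) :
    shSum (fun l₁ l₂ => -Φ l₁ l₂) l = -shSum Φ l :=
  shSum_map (-AddMonoidHom.id V) Φ l

theorem shSum_mem (H : AddSubgroup V) {Φ : List 𝓛 → List 𝓛 → V} (h : ∀ l₁ l₂, Φ l₁ l₂ ∈ H)
    (l : List 𝓛) : shSum Φ l ∈ H := by
  induction l generalizing Φ with
  | nil => exact h _ _
  | cons v l ih => exact add_mem (ih fun _ _ => h _ _) (ih fun _ _ => zsmul_mem (h _ _) _)

end ShuffleSum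

/-! ### Linearity over the algebra of functions -/

section Linearity

/-- Alternating cochains of parity `p` that are linear over `R`. -/
structure IsRAlt (R : Type*) {𝓛 : Type*} [CommRing R] [AddCommGroup 𝓛] [Module R 𝓛]
    (p : Bool) (X : List 𝓛 → 𝓛) : Prop extends IsAlt p X where
  smul : ∀ (f : R) x l, X ((f • x) :: l) = f • X (x :: l)

variable {K R 𝓛 : Type*} [Field K] [CommRing R] [Algebra K R] [AddCommGroup 𝓛]
  [Module K 𝓛] [Module R 𝓛] {S : SplitPair K R 𝓛}
  {p q r : Bool} {X Y Z w : List 𝓛 → 𝓛}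

theorem _root_.LiePairs.IsAlt.rsmul (hX : IsAlt p X) (f : R) : IsAlt p (f • X) where
  par l hl := by simp [hX.par l hl]
  add x y l := by simp only [Pi.smul_apply, hX.add, smul_add]
  swap l₁ x y l₂ := by simp only [Pi.smul_apply]; rw [hX.swap, smul_neg]

theorem IsVert.rsmul (hX : S.IsVert X) (f : R) : S.IsVert (f • X) where
  mem l := Submodule.smul_mem _ f (hX.mem l)
  zero l x hx hxB := by simp [hX.zero l x hx hxB]

theorem IsRAlt.contract (hX : IsRAlt R p X) (v : 𝓛) : IsRAlt R (!p) (contract v X) where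
  toIsAlt := hX.toIsAlt.contract v
  smul f x l := by
    have h := fun z => hX.swap [] v z l
    simp only [List.nil_append] at h
    simp only [contract_apply, h, hX.smul, smul_neg]

theorem IsRAlt.rsmul (hX : IsRAlt R p X) (f : R) : IsRAlt R p (f • X) where
  toIsAlt := hX.toIsAlt.rsmul f
  smul g x l := by simp only [Pi.smul_apply, hX.smul, smul_smul, mul_comm]

theorem IsRAlt.contract_smul (hX : IsRAlt R p X) (f : R) (x : 𝓛) :
    LiePairs.contract (f • x) X = f • LiePairs.contract x X :=
  funext fun l => hX.smul f x l

theorem contract_rsmul (f : R) (x : 𝓛) (X : List 𝓛 → 𝓛) :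
    contract x (f • X) = f • contract x X := rfl

theorem isRAlt_proj (hw : IsRAlt R p w) : IsRAlt R p (S.proj w) where
  toIsAlt := isAlt_proj hw.toIsAlt
  smul f x l := by simp [proj, hw.smul]

theorem bracket_smul (u v : 𝓛) (f : R) :
    S.bracket u (f • v) = S.anchor u f • v + f • S.bracket u v := S.leibniz u f v

theorem smul_bracket (u v : 𝓛) (f : R) :
    S.bracket (f • u) v = f • S.bracket u v - S.anchor v f • u := by
  rw [bracket_skew, bracket_smul, bracket_skew v u, smul_neg]
  abel

theorem ins_rsmul (δ : 𝓛 → 𝓛) (f : R) (X : List 𝓛 → 𝓛) (l : List 𝓛) :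
    ins δ (f • X) l = f • ins δ X l := by
  induction l generalizing X with
  | nil => simp [ins]
  | cons x l ih => rw [ins, ins, contract_rsmul, ih, smul_add, Pi.smul_apply]

theorem ins_rsmul_left (hX : IsRAlt R p X) (f : R) (δ : 𝓛 → 𝓛) (l : List 𝓛) :
    ins (fun x => f • δ x) X l = f • ins δ X l := by
  induction l generalizing p X with
  | nil => simp [ins]
  | cons x l ih => rw [ins, ins, ih (hX.contract x), smul_add, hX.smul]

theorem ins_sub_left (hX : IsAlt p X) (δ δ' : 𝓛 → 𝓛) (l : List 𝓛) :
    ins (fun x => δ x - δ' x) X l = ins δ X l - ins δ' X l := by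
  induction l generalizing p X with
  | nil => simp [ins]
  | cons x l ih => rw [ins, ins, ins, ih (hX.contract x), hX.map_cons_sub]; abel

/-- The wedge product of a `1`-form and a cochain. -/
def wedge (φ : 𝓛 → R) : (List 𝓛 → 𝓛) → List 𝓛 → 𝓛
  | _, [] => 0
  | X, v :: l => φ v • X l - wedge φ (contract v X) l

theorem wedge_neg (φ : 𝓛 → R) (X : List 𝓛 → 𝓛) (l : List 𝓛) :
    wedge φ (-X) l = -wedge φ X l := by
  induction l generalizing X with
  | nil => simp [wedge]
  | cons x l ih => rw [wedge, wedge, contract_neg, ih, Pi.neg_apply, smul_neg]; abel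

/-- Moving a from the slot of v to the front produces the signs of the wedge product. -/
theorem ins_smul_const (hX : IsRAlt R p X) (φ : 𝓛 → R) (a : 𝓛) (l : List 𝓛) :
    ins (fun v => φ v • a) X l = wedge φ (contract a X) l := by
  induction l generalizing p X with
  | nil => simp [ins, wedge]
  | cons x l ih =>
    rw [ins, wedge, ih (hX.contract x), hX.toIsAlt.contract_contract a x, wedge_neg, hX.smul]
    simp [sub_eq_add_neg]

theorem nrD_nil (hX : IsAlt p X) : S.nrD p X [] = 0 := by
  simp [nrD, nrBr_nil, mu, hX.map_cons_zero]

theorem nrD_cons (hX : IsAlt p X) (v : 𝓛) (l : List 𝓛) : S.nrD p X (v :: l) =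
    S.bracket v (X l) - ins (S.bracket v) X l - S.nrD (!p) (contract v X) l := by
  have h := congrFun (contract_nrD (S := S) (p := p) (X := X) v) l
  rwa [Pi.sub_apply, nrBr_lift hX] at h

/-- The Leibniz rule D(fX) = f DX + df ∧ X, with df taken along the anchor. -/
theorem nrD_rsmul (hX : IsAlt p X) (f : R) (l : List 𝓛) :
    S.nrD p (f • X) l = f • S.nrD p X l + wedge (fun v => S.anchor v f) X l := by
  induction l generalizing p X with
  | nil => simp [nrD_nil hX, nrD_nil (hX.rsmul f), wedge]
  | cons v l ih =>
    rw [nrD_cons hX, nrD_cons (hX.rsmul f), contract_rsmul, ih (hX.contract v), ins_rsmul,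
      Pi.smul_apply, bracket_smul, wedge, smul_sub, smul_sub]
    abel

/-- On inserting f a, the wedge terms from the slots of X and from D of the contraction cancel. The
remaining derivative term is a multiple of a, which the projection to B kills because a lies in A.
-/
theorem isRAlt_dL (hX : IsRAlt R p X) : IsRAlt R (!p) (S.dL p X) where
  toIsAlt := isAlt_dL hX.toIsAlt
  smul f x l := by
    simp only [dL, proj, List.map_cons, map_smul, Submodule.coe_smul]
    generalize (l.map fun x => (S.prA x : 𝓛)) = l
    have ha := (S.prA x).2
    generalize (S.prA x : 𝓛) = a at ha
    have h : ⇑(S.bracket (f • a)) = fun v => f • S.bracket a v - S.anchor v f • a :=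
      funext fun v => smul_bracket a v f
    have hi : ins (S.bracket (f • a)) X l =
        f • ins (S.bracket a) X l - wedge (fun v => S.anchor v f) (contract a X) l := by
      rw [h, ins_sub_left hX.toIsAlt, ins_rsmul_left hX, ins_smul_const hX]
    rw [nrD_cons hX.toIsAlt, nrD_cons hX.toIsAlt, hi, hX.contract_smul,
      nrD_rsmul (hX.toIsAlt.contract a), smul_bracket]
    simp only [map_sub, map_add, map_smul, S.prB_eq_zero_iff.2 ha, smul_zero, sub_zero,
      ← Submodule.coe_smul, smul_sub]
    congr 1
    abel

/-- The symbol of δ appears once from the value of X and once from the slot of f x, with opposite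
signs. -/
theorem isRAlt_actL (hX : IsRAlt R p X) {δ : 𝓛 →ₗ[K] 𝓛} {s : R → R}
    (hδ : ∀ (f : R) u, δ (f • u) = s f • u + f • δ u) : IsRAlt R p (S.actL δ p X) where
  toIsAlt := isAlt_actL hX.toIsAlt δ
  smul f x l := by
    simp only [actL, proj, List.map_cons, map_smul, Submodule.coe_smul]
    generalize (l.map fun x => (S.prA x : 𝓛)) = l
    generalize (S.prA x : 𝓛) = a
    rw [nrBr_lift hX.toIsAlt, nrBr_lift hX.toIsAlt, ← Submodule.coe_smul, ← map_smul, ins, ins,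
      hX.contract_smul, ins_rsmul, hX.smul, hδ, hδ, hX.add, hX.smul, hX.smul]
    congr 2
    simp only [smul_add, smul_sub]
    abel

/-! ### The derived bracket as a sum over shuffles -/

theorem shSum_rsmul (f : R) (Φ : List 𝓛 → List 𝓛 → 𝓛) (l : List 𝓛) :
    shSum (fun l₁ l₂ => f • Φ l₁ l₂) l = f • shSum Φ l :=
  shSum_map (DistribSMul.toAddMonoidHom 𝓛 f) Φ l

theorem IsAlt.sg_length_smul (hX : IsAlt p X) (l : List 𝓛) :
    sg l.length.bodd • X l = sg p • X l := by
  by_cases h : l.length.bodd = p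
  · rw [h]
  · rw [hX.par l h, smul_zero, smul_zero]

theorem nrBr_nrBr_lift_nil (hX : IsAlt p X) (hvX : S.IsVert X) (hvY : S.IsVert Y)
    (δ : 𝓛 →ₗ[K] 𝓛) : nrBr p q (nrBr true p (lift δ) X) Y [] = -X [δ (Y [])] - Y [δ (X [])] := by
  rw [nrBr_nil, nrBr_lift hX, nrBr_lift hX]
  simp only [ins, sub_zero, add_zero]
  rw [hvX.zero _ _ List.mem_cons_self (hvY.mem _), map_zero, zero_sub]

/-- Contracting `lift δ` would add a bracket of Y with a contraction of X; both are vertical, so it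
vanishes. -/
theorem nrBr_nrBr_lift_cons (hX : IsAlt p X) (hY : IsAlt q Y) (hvX : S.IsVert X)
    (hvY : S.IsVert Y) (δ : 𝓛 →ₗ[K] 𝓛) (c : 𝓛) (l : List 𝓛) :
    nrBr p q (nrBr true p (lift δ) X) Y (c :: l) =
      nrBr (!p) q (nrBr true (!p) (lift δ) (contract c X)) Y l +
      sg (!p) • nrBr p (!q) (nrBr true p (lift δ) X) (contract c Y) l := by
  rw [nrBr_cons, contract_nrBr, contract_lift, Bool.not_true, nrBr_const hX, nrBr_add_left hY,
    nrBr_neg_left hY, (hvX.contract (δ c)).nrBr_eq_zero hvY, sg_false, one_smul]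
  simp

/-- Inserting X and Y directly into each other gives zero, so only insertions with δ in between
survive. -/
theorem nrBr_nrBr_lift (hX : IsAlt p X) (hY : IsAlt q Y) (hvX : S.IsVert X)
    (hvY : S.IsVert Y) (δ : 𝓛 →ₗ[K] 𝓛) (l : List 𝓛) :
    nrBr p q (nrBr true p (lift δ) X) Y l =
      sg p • shSum (fun l₁ l₂ => X (δ (Y l₂) :: l₁)) l -
        shSum (fun l₁ l₂ => Y (δ (X l₁) :: l₂)) l := by
  induction l generalizing p q X Y with
  | nil =>
    rw [nrBr_nrBr_lift_nil hX hvX hvY]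
    cases p <;> simp [shSum, hX.one]
  | cons c l ih =>
    rw [nrBr_nrBr_lift_cons hX hY hvX hvY, ih (hX.contract c) hY (hvX.contract c) hvY,
      ih hX (hY.contract c) hvX (hvY.contract c)]
    simp only [shSum, contract_apply]
    have e1 : (fun l₁ l₂ => X (c :: δ (Y l₂) :: l₁)) = fun l₁ l₂ => -X (δ (Y l₂) :: c :: l₁) :=
      funext fun _ => funext fun _ => hX.swap [] _ _ _
    -- Terms of the wrong parity vanish, so the sign depending on the length of l₁ is constant on
    -- the others.
    have e2 : (fun l₁ l₂ => sg l₁.length.bodd • X (δ (Y (c :: l₂)) :: l₁)) =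
        fun l₁ l₂ => sg (!p) • X (δ (Y (c :: l₂)) :: l₁) :=
      funext fun l₁ => funext fun l₂ =>
        IsAlt.sg_length_smul (hX.contract (δ (Y (c :: l₂)))) l₁
    have e3 : (fun l₁ l₂ => sg l₁.length.bodd • Y (δ (X l₁) :: c :: l₂)) =
        fun l₁ l₂ => sg (!p) • Y (c :: δ (X l₁) :: l₂) := by
      funext l₁ l₂
      rw [hY.map_cons_sg_smul .. |>.symm, ← map_zsmul, IsAlt.sg_length_smul hX, map_zsmul,
        hY.map_cons_sg_smul]
      have h := hY.swap [] (δ (X l₁)) c l₂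
      simp only [List.nil_append] at h
      rw [h]
      cases p <;> simp
    rw [e1, e2, e3, shSum_neg, shSum_zsmul, shSum_zsmul]
    cases p <;> simp <;> abel

variable (S) in
/-- The summand of the bracket of `X` and `Y` for a shuffle that splits the arguments into
`l₁` and `l₂`. -/
def brTerm (X Y : List 𝓛 → 𝓛) (l₁ l₂ : List 𝓛) : 𝓛 :=
  ins (S.bracket (Y l₂)) X l₁ - ins (S.bracket (X l₁)) Y l₂ + S.prB (S.bracket (X l₁) (Y l₂))

theorem brTerm_cons_left (X Y : List 𝓛 → 𝓛) (a : 𝓛) (l₁ l₂ : List 𝓛) :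
    S.brTerm X Y (a :: l₁) l₂ =
      X (S.bracket (Y l₂) a :: l₁) + S.brTerm (contract a X) Y l₁ l₂ := by
  simp only [brTerm, ins, contract_apply]
  abel

theorem brTerm_cons_right (X Y : List 𝓛 → 𝓛) (a : 𝓛) (l₁ l₂ : List 𝓛) :
    S.brTerm X Y l₁ (a :: l₂) =
      -Y (S.bracket (X l₁) a :: l₂) + S.brTerm X (contract a Y) l₁ l₂ := by
  simp only [brTerm, ins, contract_apply]
  abel

theorem ins_par (hX : IsAlt p X) (δ : 𝓛 → 𝓛) {l : List 𝓛} (hl : l.length.bodd ≠ p) :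
    ins δ X l = 0 := by
  induction l generalizing p X with
  | nil => rfl
  | cons x l ih =>
    rw [ins, hX.par _ (by simpa using hl), ih (hX.contract x) (by cases p <;> simp_all), add_zero]

theorem ins_bracket_zero (hX : IsAlt p X) (l : List 𝓛) : ins (S.bracket (0 : 𝓛)) X l = 0 := by
  induction l generalizing p X with
  | nil => rfl
  | cons x l ih =>
    rw [ins, ih (hX.contract x), map_zero, LinearMap.zero_apply, hX.map_cons_zero, add_zero]

theorem brTerm_par (hX : IsAlt p X) (hY : IsAlt q Y) {l₁ l₂ : List 𝓛} (h : l₁.length.bodd ≠ p) :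
    S.brTerm X Y l₁ l₂ = 0 := by
  rw [brTerm, ins_par hX _ h, hX.par _ h, ins_bracket_zero hY]
  simp

theorem sg_length_smul_brTerm (hX : IsAlt p X) (hY : IsAlt q Y) (l₁ l₂ : List 𝓛) :
    sg l₁.length.bodd • S.brTerm X Y l₁ l₂ = sg p • S.brTerm X Y l₁ l₂ := by
  by_cases h : l₁.length.bodd = p
  · rw [h]
  · rw [brTerm_par hX hY h, smul_zero, smul_zero]

theorem nrBr_nrD_nil (hX : IsAlt p X) (hY : IsAlt q Y) :
    nrBr (!p) q (S.nrD p X) Y [] = S.bracket (Y []) (X []) := by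
  rw [nrBr_nil, nrD_nil hX, hY.map_cons_zero, nrD_cons hX, nrD_nil (hX.contract _)]
  simp [ins]

theorem nrBr_nrD_cons (hY : IsAlt q Y) (a : 𝓛) (l : List 𝓛) :
    nrBr (!p) q (S.nrD p X) Y (a :: l) = nrBr p q (nrBr true p (lift (S.bracket a)) X) Y l -
      nrBr p q (S.nrD (!p) (contract a X)) Y l +
      sg p • nrBr (!p) (!q) (S.nrD p X) (contract a Y) l := by
  rw [nrBr_cons, contract_nrD, Bool.not_not, nrBr_sub_left hY, Pi.sub_apply]

/-- By Cartan's formula, peeling off an argument a leaves two brackets of the same shape and [[ad a,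
X], Y]. The latter, expanded by `nrBr_nrBr_lift`, supplies the terms in which a itself is bracketed.
-/
theorem prB_nrBr_nrD (hX : IsAlt p X) (hY : IsAlt q Y) (hvX : S.IsVert X) (hvY : S.IsVert Y)
    (l : List 𝓛) : (S.prB (nrBr (!p) q (S.nrD p X) Y l) : 𝓛) =
      -sg p • shSum (S.brTerm X Y) l := by
  induction l generalizing p q X Y with
  | nil =>
    rw [nrBr_nrD_nil hX hY, bracket_skew]
    cases p <;> simp [shSum, brTerm, ins, hX.nil]
  | cons a l ih =>
    have h1 := ih (hX.contract a) hY (hvX.contract a) hvY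
    have h2 := ih hX (hY.contract a) hvX (hvY.contract a)
    rw [Bool.not_not] at h1
    -- The shuffle formula shows that this term already takes values in B.
    have hF : (S.prB (nrBr p q (nrBr true p (lift (S.bracket a)) X) Y l) : 𝓛) =
        nrBr p q (nrBr true p (lift (S.bracket a)) X) Y l := by
      refine S.coe_prB_of_mem ?_
      rw [nrBr_nrBr_lift hX hY hvX hvY]
      exact sub_mem (zsmul_mem (shSum_mem S.B.toAddSubgroup (fun _ _ => hvX.mem _) l) _)
        (shSum_mem S.B.toAddSubgroup (fun _ _ => hvY.mem _) l)
    rw [nrBr_nrD_cons hY, map_add, map_sub, map_zsmul, Submodule.coe_add, Submodule.coe_sub,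
      AddSubgroupClass.coe_zsmul, h1, h2, hF, nrBr_nrBr_lift hX hY hvX hvY]
    have e1 : (fun l₁ l₂ => S.brTerm X Y (a :: l₁) l₂) = fun l₁ l₂ =>
        -X (S.bracket a (Y l₂) :: l₁) + S.brTerm (contract a X) Y l₁ l₂ := by
      funext l₁ l₂
      rw [brTerm_cons_left, bracket_skew, hX.map_cons_neg]
    have e2 : (fun l₁ l₂ => sg l₁.length.bodd • S.brTerm X Y l₁ (a :: l₂)) = fun l₁ l₂ =>
        sg p • Y (S.bracket a (X l₁) :: l₂) + sg p • S.brTerm X (contract a Y) l₁ l₂ := by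
      funext l₁ l₂
      rw [brTerm_cons_right, smul_add, sg_length_smul_brTerm hX (hY.contract a), bracket_skew,
        hY.map_cons_neg, neg_neg, ← hY.map_cons_sg_smul, ← map_zsmul, IsAlt.sg_length_smul hX,
        map_zsmul, hY.map_cons_sg_smul]
    rw [shSum, e1, e2, shSum_add, shSum_add, shSum_neg, shSum_zsmul, shSum_zsmul]
    cases p <;> simp <;> abel

theorem wedge_zero (φ : 𝓛 → R) (l : List 𝓛) : wedge φ 0 l = 0 := by
  induction l with
  | nil => rfl
  | cons v l ih =>
    have h : contract v (0 : List 𝓛 → 𝓛) = 0 := rfl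
    rw [wedge, h, ih, Pi.zero_apply, smul_zero, sub_zero]

/-- The derivative term of [f b, v] is a multiple of b, which X kills. -/
theorem ins_smul_bracket (hX : IsRAlt R p X) (hvX : S.IsVert X) {b : 𝓛} (hb : b ∈ S.B) (f : R)
    (l : List 𝓛) : ins (S.bracket (f • b)) X l = f • ins (S.bracket b) X l := by
  have h : ⇑(S.bracket (f • b)) = fun v => f • S.bracket b v - S.anchor v f • b :=
    funext fun v => smul_bracket b v f
  rw [h, ins_sub_left hX.toIsAlt, ins_rsmul_left hX, ins_smul_const hX, hvX.contract_eq_zero hb,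
    wedge_zero, sub_zero]

theorem brTerm_rsmul_left (hY : IsRAlt R q Y) (hvX : S.IsVert X) (hvY : S.IsVert Y) (f : R)
    (l₁ l₂ : List 𝓛) : S.brTerm (f • X) Y l₁ l₂ =
      f • S.brTerm X Y l₁ l₂ - S.anchor (Y l₂) f • X l₁ := by
  rw [brTerm, Pi.smul_apply, ins_smul_bracket hY hvY (hvX.mem _), ins_rsmul, smul_bracket, map_sub,
    map_smul, map_smul, Submodule.coe_sub, Submodule.coe_smul, Submodule.coe_smul,
    S.coe_prB_of_mem (hvX.mem _), brTerm, smul_add, smul_sub]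
  abel

theorem brTerm_rsmul_right (hX : IsRAlt R p X) (hvX : S.IsVert X) (hvY : S.IsVert Y) (f : R)
    (l₁ l₂ : List 𝓛) : S.brTerm X (f • Y) l₁ l₂ =
      f • S.brTerm X Y l₁ l₂ + S.anchor (X l₁) f • Y l₂ := by
  rw [brTerm, Pi.smul_apply, ins_smul_bracket hX hvX (hvY.mem _), ins_rsmul, bracket_smul, map_add,
    map_smul, map_smul, Submodule.coe_add, Submodule.coe_smul, Submodule.coe_smul,
    S.coe_prB_of_mem (hvY.mem _), brTerm, smul_add, smul_sub]
  abel

/-- The derivative of f along Y(l₂) occurs in the bracket with f a and, with opposite sign, in the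
bracket of the two values. -/
theorem brTerm_smul_cons_left (hX : IsRAlt R p X) (hY : IsRAlt R q Y) (hvX : S.IsVert X)
    (hvY : S.IsVert Y) (f : R) (a : 𝓛) (l₁ l₂ : List 𝓛) :
    S.brTerm X Y ((f • a) :: l₁) l₂ = f • S.brTerm X Y (a :: l₁) l₂ := by
  rw [brTerm_cons_left, brTerm_cons_left, bracket_smul, hX.contract_smul,
    brTerm_rsmul_left hY (hvX.contract a) hvY, hX.add, hX.smul, hX.smul, contract_apply, smul_add]
  abel

theorem brTerm_smul_cons_right (hX : IsRAlt R p X) (hY : IsRAlt R q Y) (hvX : S.IsVert X)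
    (hvY : S.IsVert Y) (f : R) (a : 𝓛) (l₁ l₂ : List 𝓛) :
    S.brTerm X Y l₁ ((f • a) :: l₂) = f • S.brTerm X Y l₁ (a :: l₂) := by
  rw [brTerm_cons_right, brTerm_cons_right, bracket_smul, hY.contract_smul,
    brTerm_rsmul_right hX hvX (hvY.contract a), hY.add, hY.smul, hY.smul, contract_apply,
    smul_add, smul_neg]
  abel

theorem isRAlt_derBr (hX : IsRAlt R p X) (hY : IsRAlt R q Y) (hvX : S.IsVert X)
    (hvY : S.IsVert Y) : IsRAlt R (p ^^ q) (S.derBr p q X Y) where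
  toIsAlt := isAlt_derBr hX.toIsAlt hY.toIsAlt
  smul f x l := by
    simp only [derBr, proj, List.map_cons, map_smul, Submodule.coe_smul]
    rw [prB_nrBr_nrD hX.toIsAlt hY.toIsAlt hvX hvY, prB_nrBr_nrD hX.toIsAlt hY.toIsAlt hvX hvY]
    simp only [shSum, brTerm_smul_cons_left hX hY hvX hvY, brTerm_smul_cons_right hX hY hvX hvY,
      smul_comm _ f, shSum_rsmul, ← smul_add]

/-! ### Linearity of the homotopies -/

/-- The symbol term of δ applied to a value of X or Y is again in B, and it is then inserted into a
vertical cochain. -/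
theorem nrBr_nrBr_lift_rsmul (hX : IsRAlt R p X) (hY : IsRAlt R q Y) (hvX : S.IsVert X)
    (hvY : S.IsVert Y) {δ : 𝓛 →ₗ[K] 𝓛} {s : R → R}
    (hδ : ∀ (f : R) u, δ (f • u) = s f • u + f • δ u) (f g : R) (l : List 𝓛) :
    nrBr p q (nrBr true p (lift δ) (f • X)) (g • Y) l =
      (f * g) • nrBr p q (nrBr true p (lift δ) X) Y l := by
  induction l generalizing p q X Y with
  | nil =>
    rw [nrBr_nrBr_lift_nil hX.toIsAlt hvX hvY,
      nrBr_nrBr_lift_nil (hX.rsmul f).toIsAlt (hvX.rsmul f) (hvY.rsmul g)]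
    simp only [Pi.smul_apply, hδ, hX.add, hY.add, hX.smul, hY.smul,
      hvX.zero _ _ List.mem_cons_self (hvY.mem _), hvY.zero _ _ List.mem_cons_self (hvX.mem _),
      smul_zero, zero_add, smul_sub, smul_neg, smul_smul, mul_comm g f]
  | cons c l ih =>
    rw [nrBr_nrBr_lift_cons hX.toIsAlt hY.toIsAlt hvX hvY,
      nrBr_nrBr_lift_cons (hX.rsmul f).toIsAlt (hY.rsmul g).toIsAlt (hvX.rsmul f) (hvY.rsmul g),
      contract_rsmul, contract_rsmul, ih (hX.contract c) hY (hvX.contract c) hvY,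
      ih hX (hY.contract c) hvX (hvY.contract c), smul_add, smul_comm (sg _)]

theorem isRAlt_nrBr_nrBr_lift (hX : IsRAlt R p X) (hY : IsRAlt R q Y) (hvX : S.IsVert X)
    (hvY : S.IsVert Y) {δ : 𝓛 →ₗ[K] 𝓛} {s : R → R}
    (hδ : ∀ (f : R) u, δ (f • u) = s f • u + f • δ u) :
    IsRAlt R (p == q) (nrBr p q (nrBr true p (lift δ) X) Y) where
  toIsAlt := by simpa using ((isAlt_lift δ).nrBr hX.toIsAlt).nrBr hY.toIsAlt
  smul f x l := by
    have h1 := nrBr_nrBr_lift_rsmul (hX.contract x) hY (hvX.contract x) hvY hδ f 1 l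
    have h2 := nrBr_nrBr_lift_rsmul hX (hY.contract x) hvX (hvY.contract x) hδ 1 f l
    simp only [one_smul, one_mul, mul_one] at h1 h2
    rw [nrBr_nrBr_lift_cons hX.toIsAlt hY.toIsAlt hvX hvY,
      nrBr_nrBr_lift_cons hX.toIsAlt hY.toIsAlt hvX hvY, hX.contract_smul, hY.contract_smul, h1,
      h2, smul_add, smul_comm (sg _)]

/-- Being vertical, [[δ, X], Y] commutes with any further vertical cochain; this removes a term from
the recursion for `triBr`. -/
theorem isVert_nrBr_nrBr_lift (hX : IsAlt p X) (hY : IsAlt q Y) (hvX : S.IsVert X)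
    (hvY : S.IsVert Y) (δ : 𝓛 →ₗ[K] 𝓛) : S.IsVert (nrBr p q (nrBr true p (lift δ) X) Y) where
  mem l := by
    rw [nrBr_nrBr_lift hX hY hvX hvY]
    exact sub_mem (zsmul_mem (shSum_mem S.B.toAddSubgroup (fun _ _ => hvX.mem _) l) _)
      (shSum_mem S.B.toAddSubgroup (fun _ _ => hvY.mem _) l)
  zero l x hx hxB := by
    induction l generalizing p q X Y with
    | nil => simp at hx
    | cons c l ih =>
      rw [nrBr_nrBr_lift_cons hX hY hvX hvY]
      rcases List.mem_cons.1 hx with rfl | hx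
      · have h : IsAlt p (nrBr true p (lift δ) X) := by simpa using (isAlt_lift δ).nrBr hX
        rw [hvX.contract_eq_zero hxB, hvY.contract_eq_zero hxB, nrBr_zero_right (isAlt_lift δ),
          nrBr_zero_left hY, nrBr_zero_right h]
        simp
      · rw [ih (hX.contract c) hY (hvX.contract c) hvY hx,
          ih hX (hY.contract c) hvX (hvY.contract c) hx]
        simp

variable (S) in
/-- The ternary bracket of vertical cochains. -/
def triBr (p q r : Bool) (X Y Z : List 𝓛 → 𝓛) : List 𝓛 → 𝓛 :=
  nrBr (p ^^ q) r (nrBr (!p) q (S.nrD p X) Y) Z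

theorem isAlt_nrBr_nrD (hX : IsAlt p X) (hY : IsAlt q Y) :
    IsAlt (p ^^ q) (nrBr (!p) q (S.nrD p X) Y) := by
  have := (isAlt_nrD (S := S) hX).nrBr hY
  cases p <;> cases q <;> exact this

theorem triBr_nil (hX : IsAlt p X) (hY : IsAlt q Y) (hvX : S.IsVert X)
    (hvY : S.IsVert Y) (hvZ : S.IsVert Z) : S.triBr p q r X Y Z [] =
      -X [S.bracket (Z []) (Y [])] - Y [S.bracket (Z []) (X [])] -
        Z [S.bracket (Y []) (X [])] := by
  have h0 : nrBr p q (S.nrD (!p) 0) Y [] = 0 := by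
    rw [nrD_zero, nrBr_zero_left hY, Pi.zero_apply]
  rw [triBr, nrBr_nil, nrBr_nrD_nil hX hY, nrBr_nrD_cons hY,
    nrBr_nrBr_lift_nil hX hvX hvY, hvX.contract_eq_zero (hvZ.mem _),
    hvY.contract_eq_zero (hvZ.mem _), h0, nrBr_zero_right (isAlt_nrD hX)]
  simp

/-- Cartan's formula produces the extra term [[[ad a, X], Y], Z], a bracket of vertical cochains,
hence zero. -/
theorem triBr_cons (hX : IsAlt p X) (hY : IsAlt q Y) (hZ : IsAlt r Z) (hvX : S.IsVert X)
    (hvY : S.IsVert Y) (hvZ : S.IsVert Z) (a : 𝓛) (l : List 𝓛) :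
    S.triBr p q r X Y Z (a :: l) = -S.triBr (!p) q r (contract a X) Y Z l +
      sg p • S.triBr p (!q) r X (contract a Y) Z l +
      sg (!(p ^^ q)) • S.triBr p q (!r) X Y (contract a Z) l := by
  have h : contract a (nrBr (!p) q (S.nrD p X) Y) =
      nrBr p q (nrBr true p (lift (S.bracket a)) X) Y -
      nrBr p q (S.nrD (!p) (contract a X)) Y +
      sg p • nrBr (!p) (!q) (S.nrD p X) (contract a Y) :=
    funext fun l => nrBr_nrD_cons hY a l
  rw [triBr, nrBr_cons, h, nrBr_add_left hZ, nrBr_sub_left hZ, nrBr_zsmul_left hZ,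
    (isVert_nrBr_nrBr_lift hX hY hvX hvY _).nrBr_eq_zero hvZ]
  simp [triBr]

/-- On the empty list the bracket of two values is inserted into the third cochain, and the Leibniz
terms are multiples of elements of B. The recursion then propagates linearity. -/
theorem triBr_rsmul (hX : IsRAlt R p X) (hY : IsRAlt R q Y) (hZ : IsRAlt R r Z)
    (hvX : S.IsVert X) (hvY : S.IsVert Y) (hvZ : S.IsVert Z) (f g h : R) (l : List 𝓛) :
    S.triBr p q r (f • X) (g • Y) (h • Z) l = (f * g * h) • S.triBr p q r X Y Z l := by
  induction l generalizing p q r X Y Z with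
  | nil =>
    rw [triBr_nil hX.toIsAlt hY.toIsAlt hvX hvY hvZ, triBr_nil (hX.rsmul f).toIsAlt
      (hY.rsmul g).toIsAlt (hvX.rsmul f) (hvY.rsmul g) (hvZ.rsmul h)]
    simp only [Pi.smul_apply, bracket_smul, smul_bracket, smul_sub, hX.toIsAlt.map_cons_sub,
      hY.toIsAlt.map_cons_sub, hZ.toIsAlt.map_cons_sub, hX.add, hY.add, hZ.add, hX.smul, hY.smul,
      hZ.smul, hvX.zero _ _ List.mem_cons_self (hvY.mem _),
      hvX.zero _ _ List.mem_cons_self (hvZ.mem _), hvY.zero _ _ List.mem_cons_self (hvX.mem _),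
      hvY.zero _ _ List.mem_cons_self (hvZ.mem _), hvZ.zero _ _ List.mem_cons_self (hvX.mem _),
      hvZ.zero _ _ List.mem_cons_self (hvY.mem _), smul_zero, zero_add, sub_zero, smul_neg,
      smul_smul, mul_comm, mul_left_comm]
  | cons c l ih =>
    rw [triBr_cons hX.toIsAlt hY.toIsAlt hZ.toIsAlt hvX hvY hvZ,
      triBr_cons (hX.rsmul f).toIsAlt (hY.rsmul g).toIsAlt (hZ.rsmul h).toIsAlt (hvX.rsmul f)
        (hvY.rsmul g) (hvZ.rsmul h),
      contract_rsmul, contract_rsmul, contract_rsmul, ih (hX.contract c) hY hZ (hvX.contract c)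
        hvY hvZ, ih hX (hY.contract c) hZ hvX (hvY.contract c) hvZ,
      ih hX hY (hZ.contract c) hvX hvY (hvZ.contract c), smul_add, smul_add, smul_neg,
      smul_comm (sg _), smul_comm (sg _)]

theorem isRAlt_triBr (hX : IsRAlt R p X) (hY : IsRAlt R q Y) (hZ : IsRAlt R r Z)
    (hvX : S.IsVert X) (hvY : S.IsVert Y) (hvZ : S.IsVert Z) :
    IsRAlt R (!(p ^^ q ^^ r)) (S.triBr p q r X Y Z) where
  toIsAlt := by
    have := (isAlt_nrBr_nrD (S := S) hX.toIsAlt hY.toIsAlt).nrBr hZ.toIsAlt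
    cases p <;> cases q <;> cases r <;> exact this
  smul f x l := by
    have h1 := triBr_rsmul (hX.contract x) hY hZ (hvX.contract x) hvY hvZ f 1 1 l
    have h2 := triBr_rsmul hX (hY.contract x) hZ hvX (hvY.contract x) hvZ 1 f 1 l
    have h3 := triBr_rsmul hX hY (hZ.contract x) hvX hvY (hvZ.contract x) 1 1 f l
    simp only [one_smul, one_mul, mul_one] at h1 h2 h3
    rw [triBr_cons hX.toIsAlt hY.toIsAlt hZ.toIsAlt hvX hvY hvZ,
      triBr_cons hX.toIsAlt hY.toIsAlt hZ.toIsAlt hvX hvY hvZ, hX.contract_smul,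
      hY.contract_smul, hZ.contract_smul, h1, h2, h3, smul_add, smul_add, smul_neg,
      smul_comm (sg _), smul_comm (sg _)]

end Linearity

end SplitPair

namespace SplitPair

/-! ### Shuffle sums in terms of permutations -/

section ShufflePerm

/-- The permutation of `Fin (n + 1)` that sends `i` to `0` and is given by `τ` on the other
elements. -/
def insPerm {n : ℕ} (i : Fin (n + 1)) (τ : Equiv.Perm (Fin n)) : Equiv.Perm (Fin (n + 1)) :=
  Equiv.Perm.decomposeFin.symm (0, τ) * i.cycleRange

theorem insPerm_self {n : ℕ} (i : Fin (n + 1)) (τ : Equiv.Perm (Fin n)) : insPerm i τ i = 0 := by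
  simp [insPerm]

theorem insPerm_succAbove {n : ℕ} (i : Fin (n + 1)) (τ : Equiv.Perm (Fin n)) (j : Fin n) :
    insPerm i τ (i.succAbove j) = (τ j).succ := by
  simp [insPerm, Fin.cycleRange_succAbove]

theorem sign_insPerm {n : ℕ} (i : Fin (n + 1)) (τ : Equiv.Perm (Fin n)) :
    Equiv.Perm.sign (insPerm i τ) = (-1) ^ (i : ℕ) * Equiv.Perm.sign τ := by
  rw [insPerm, Equiv.Perm.sign_mul, Equiv.Perm.decomposeFin.symm_sign, Fin.sign_cycleRange,
    if_pos rfl, one_mul, mul_comm]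

theorem insPerm_bijective (n : ℕ) :
    Function.Bijective fun x : Fin (n + 1) × Equiv.Perm (Fin n) => insPerm x.1 x.2 := by
  rw [Fintype.bijective_iff_injective_and_card]
  refine ⟨?_, by simp [Fintype.card_perm, Nat.factorial_succ]⟩
  rintro ⟨i, τ⟩ ⟨i', τ'⟩ h
  have hi : i = i' := by
    have h1 := insPerm_self i τ
    rw [show insPerm i τ = insPerm i' τ' from h, ← insPerm_self i' τ'] at h1
    exact (insPerm i' τ').injective h1
  subst hi
  have h' := Equiv.Perm.decomposeFin.symm.injective (mul_right_cancel h)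
  simpa using h'

/-- The permutations that are increasing on the first `p` elements and on the others. -/
def IsShuffle {n : ℕ} (p : ℕ) (σ : Equiv.Perm (Fin n)) : Prop :=
  ∀ i j : Fin n, i < j → ((j : ℕ) < p ∨ p ≤ (i : ℕ)) → σ i < σ j

instance {n : ℕ} (p : ℕ) (σ : Equiv.Perm (Fin n)) : Decidable (IsShuffle p σ) := by
  unfold IsShuffle; infer_instance

theorem isShuffle_insPerm_zero {n p : ℕ} (τ : Equiv.Perm (Fin n)) :
    IsShuffle (p + 1) (insPerm 0 τ) ↔ IsShuffle p τ := by
  have hs (j : Fin n) : insPerm 0 τ j.succ = (τ j).succ := by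
    simpa using insPerm_succAbove 0 τ j
  constructor
  · intro h i j hij hp
    have := h i.succ j.succ (by simpa using hij) (by simpa using hp)
    simpa [hs] using this
  · intro h i j hij hp
    cases j using Fin.cases with
    | zero => simp at hij
    | succ j =>
      cases i using Fin.cases with
      | zero => rw [insPerm_self, hs]; exact Fin.succ_pos _
      | succ i =>
        rw [hs, hs, Fin.succ_lt_succ_iff]
        exact h i j (by simpa using hij) (by simpa using hp)

theorem val_succAbove {n : ℕ} (i : Fin (n + 1)) (j : Fin n) :
    ((i.succAbove j : Fin (n + 1)) : ℕ) = if (j : ℕ) < i then (j : ℕ) else j + 1 := by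
  simp only [Fin.succAbove, Fin.lt_def, Fin.val_castSucc]
  split_ifs <;> simp

theorem isShuffle_insPerm {n : ℕ} (i : Fin (n + 1)) (τ : Equiv.Perm (Fin n)) :
    IsShuffle i (insPerm i τ) ↔ IsShuffle i τ := by
  constructor
  · intro h a b hab hp
    have := h (i.succAbove a) (i.succAbove b) (Fin.strictMono_succAbove i hab) (by
      rw [val_succAbove, val_succAbove]
      rw [Fin.lt_def] at hab
      split_ifs <;> omega)
    simpa [insPerm_succAbove] using this
  · intro h a b hab hp
    rcases Fin.eq_self_or_eq_succAbove i b with rfl | ⟨b, rfl⟩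
    · rw [Fin.lt_def] at hab; omega
    rcases Fin.eq_self_or_eq_succAbove i a with rfl | ⟨a, rfl⟩
    · rw [insPerm_self, insPerm_succAbove]; exact Fin.succ_pos _
    · rw [insPerm_succAbove, insPerm_succAbove, Fin.succ_lt_succ_iff]
      refine h a b ((Fin.strictMono_succAbove i).lt_iff_lt.1 hab) ?_
      rw [val_succAbove, val_succAbove] at hp
      split_ifs at hp <;> omega

/-- In a shuffle the value 0 can occur only at the start of one of the two increasing blocks. -/
theorem not_isShuffle_insPerm {n p : ℕ} {i : Fin (n + 1)} (h0 : (i : ℕ) ≠ 0) (hp : (i : ℕ) ≠ p)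
    (τ : Equiv.Perm (Fin n)) : ¬IsShuffle p (insPerm i τ) := by
  intro h
  have := h ⟨(i : ℕ) - 1, by omega⟩ i (by rw [Fin.lt_def]; exact Nat.sub_one_lt h0)
    (by change (i : ℕ) < p ∨ p ≤ (i : ℕ) - 1; omega)
  rw [insPerm_self] at this
  exact absurd this (Fin.not_lt_zero _)

theorem take_drop_ofFn {α : Type*} {n : ℕ} (f : Fin (n + 1) → α) (i : Fin (n + 1)) :
    (List.ofFn f).take i = (List.ofFn fun j => f (i.succAbove j)).take i ∧
    (List.ofFn f).drop i = f i :: (List.ofFn fun j => f (i.succAbove j)).drop i := by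
  induction n with
  | zero =>
    obtain rfl : i = 0 := Fin.ext (by omega)
    simp
  | succ n ih =>
    cases i using Fin.cases with
    | zero => simp [List.ofFn_succ]
    | succ i =>
      have h := ih (fun j => f j.succ) i
      rw [List.ofFn_succ, List.ofFn_succ (f := fun j => f (i.succ.succAbove j))]
      simpa using h

variable {𝓛 V : Type*} [AddCommGroup V]

theorem shSum_congr {Φ Ψ : List 𝓛 → List 𝓛 → V} {l : List 𝓛}
    (h : ∀ l₁ l₂, l₁.length + l₂.length = l.length → Φ l₁ l₂ = Ψ l₁ l₂) :
    shSum Φ l = shSum Ψ l := by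
  induction l generalizing Φ Ψ with
  | nil => exact h _ _ rfl
  | cons v l ih =>
    rw [shSum, shSum]
    congr 1
    · exact ih fun l₁ l₂ hl => h _ _ (by simp only [List.length_cons]; omega)
    · exact ih fun l₁ l₂ hl => by rw [h _ _ (by simp only [List.length_cons]; omega)]

theorem shSum_zero (l : List 𝓛) : shSum (fun _ _ => (0 : V)) l = 0 := by
  induction l with
  | nil => rfl
  | cons v l ih => simp only [shSum, smul_zero, ih, add_zero]

theorem sg_bodd (n : ℕ) : sg n.bodd = (-1) ^ n := by
  induction n with
  | zero => rfl
  | succ n ih =>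
    rw [pow_succ, ← ih, Nat.bodd_succ]
    cases n.bodd <;> rfl

/-- Sort the permutations by the position of the value 0. The positions 0 and p correspond to the
two branches of the recursion, and all others contribute nothing. -/
theorem shSum_ofFn {n p : ℕ} (hp : p ≤ n) {Φ : List 𝓛 → List 𝓛 → V}
    (hΦ : ∀ l₁ l₂, l₁.length ≠ p → Φ l₁ l₂ = 0) (b : Fin n → 𝓛) :
    shSum Φ (List.ofFn b) = ∑ σ : Equiv.Perm (Fin n), if IsShuffle p σ then
      ((Equiv.Perm.sign σ : ℤˣ) : ℤ) • Φ ((List.ofFn (b ∘ σ)).take p)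
        ((List.ofFn (b ∘ σ)).drop p) else 0 := by
  induction n generalizing p Φ with
  | zero =>
    have h (σ : Equiv.Perm (Fin 0)) : IsShuffle p σ := fun i => i.elim0
    simp [shSum, h]
  | succ n ih =>
    have hc (i : Fin (n + 1)) (τ : Equiv.Perm (Fin n)) :
        (fun j => (b ∘ insPerm i τ) (i.succAbove j)) = (fun j => b j.succ) ∘ τ :=
      funext fun j => congrArg b (insPerm_succAbove i τ j)
    have hb (i : Fin (n + 1)) (τ : Equiv.Perm (Fin n)) : (b ∘ insPerm i τ) i = b 0 :=
      congrArg b (insPerm_self i τ)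
    rw [← (insPerm_bijective n).sum_comp, Fintype.sum_prod_type, List.ofFn_succ, shSum]
    -- Value 0 at position p: the first argument opens the second block, and moving it past p
    -- entries gives (-1)^p.
    have key (i : Fin (n + 1)) (hi : (i : ℕ) = p) :
        (∑ τ : Equiv.Perm (Fin n), if IsShuffle p (insPerm i τ) then
          ((Equiv.Perm.sign (insPerm i τ) : ℤˣ) : ℤ) • Φ ((List.ofFn (b ∘ insPerm i τ)).take p)
            ((List.ofFn (b ∘ insPerm i τ)).drop p) else 0) =
        shSum (fun l₁ l₂ => sg l₁.length.bodd • Φ l₁ (b 0 :: l₂))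
          (List.ofFn fun j => b j.succ) := by
      subst hi
      rw [ih (p := i) (by omega) (fun l₁ l₂ h => by rw [hΦ _ _ h, smul_zero])]
      refine Finset.sum_congr rfl fun τ _ => ?_
      simp only [isShuffle_insPerm, take_drop_ofFn _ i, hc, hb, sign_insPerm]
      split_ifs
      · rw [List.length_take, List.length_ofFn, min_eq_left (by omega), sg_bodd, smul_smul]
        push_cast
        rw [mul_comm]
      · rfl
    rcases p with _ | p
    -- For p = 0 both positions coincide and the left branch is empty.
    · have h1 : shSum (fun l₁ l₂ => Φ (b 0 :: l₁) l₂) (List.ofFn fun j => b j.succ) = 0 := by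
        rw [shSum_congr (Ψ := fun _ _ => 0) fun _ _ _ => hΦ _ _ (by simp), shSum_zero]
      rw [h1, zero_add, ← key 0 rfl, Fin.sum_univ_succ]
      refine (add_eq_left.2 (Finset.sum_eq_zero fun i _ => Finset.sum_eq_zero fun τ _ => ?_)).symm
      exact if_neg (not_isShuffle_insPerm (by simp) (by simp) τ)
    · rw [Fin.sum_univ_succ]
      congr 1
      · rw [ih (p := p) (by omega) (fun l₁ l₂ h => hΦ _ _ (by simpa using h))]
        refine Finset.sum_congr rfl fun τ _ => ?_
        have h2 : List.ofFn (b ∘ insPerm 0 τ) = b 0 :: List.ofFn ((fun j => b j.succ) ∘ τ) := by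
          have := (take_drop_ofFn (b ∘ insPerm 0 τ) 0).2
          rwa [hc, hb] at this
        rw [h2, List.take_succ_cons, List.drop_succ_cons, sign_insPerm]
        simp only [isShuffle_insPerm_zero]
        simp
      · rcases Nat.lt_or_ge p n with hpn | hpn
        · rw [Finset.sum_eq_single ⟨p, hpn⟩, key _ (by simp)]
          · intro i _ hi
            refine Finset.sum_eq_zero fun τ _ => if_neg (not_isShuffle_insPerm (by simp) ?_ τ)
            simpa [Fin.ext_iff] using hi
          · simp
        -- Here p = n + 1: the second block is empty, and the right branch vanishes for reasons of
        -- length.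
        · rw [shSum_congr (Ψ := fun _ _ => 0) (fun l₁ l₂ h => ?_), shSum_zero]
          · refine (Finset.sum_eq_zero fun i _ => Finset.sum_eq_zero fun τ _ => ?_).symm
            exact if_neg (not_isShuffle_insPerm (by simp) (by simp; omega) τ)
          · rw [hΦ _ _ (by simp at h; omega), smul_zero]

theorem mem_shuffles_iff {p q : ℕ} (σ : Equiv.Perm (Fin (p + q))) :
    σ ∈ shuffles p q ↔ IsShuffle p σ := by
  simp only [shuffles, Finset.mem_filter, Finset.mem_univ, true_and, IsShuffle]
  constructor
  · rintro ⟨h1, h2⟩ i j hij hp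
    cases i using Fin.addCases with
    | left i =>
      cases j using Fin.addCases with
      | left j => exact h1 i j hij
      | right j => simp at hp; omega
    | right i =>
      cases j using Fin.addCases with
      | left j => simp [Fin.lt_def] at hij; omega
      | right j => exact h2 i j (by simpa using hij)
  · intro h
    exact ⟨fun i j hij => h _ _ hij (by simp),
      fun i j hij => h _ _ (by simpa using hij) (by simp)⟩

theorem shSum_ofFn_shuffles {p q : ℕ} {Φ : List 𝓛 → List 𝓛 → V}
    (hΦ : ∀ l₁ l₂, l₁.length ≠ p → Φ l₁ l₂ = 0) (b : Fin (p + q) → 𝓛) :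
    shSum Φ (List.ofFn b) = ∑ σ ∈ shuffles p q, ((Equiv.Perm.sign σ : ℤˣ) : ℤ) •
      Φ (List.ofFn fun i => b (σ (Fin.castAdd q i))) (List.ofFn fun j => b (σ (Fin.natAdd p j))) := by
  rw [shSum_ofFn (Nat.le_add_right p q) hΦ, ← Finset.sum_filter]
  refine Finset.sum_congr (Finset.ext fun σ => by simp [mem_shuffles_iff]) fun σ _ => ?_
  have h : List.ofFn (b ∘ σ) = List.ofFn (fun i => b (σ (Fin.castAdd q i))) ++
      List.ofFn fun j => b (σ (Fin.natAdd p j)) := by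
    rw [← List.ofFn_fin_append]
    congr 1
    funext i
    cases i using Fin.addCases <;> simp
  rw [h, List.take_left' (by simp), List.drop_left' (by simp)]

end ShufflePerm

end SplitPair

namespace SplitPair

/-! ### Forms as cochains on lists -/

section Forms

variable {K R 𝓛 : Type*} [Field K] [CommRing R] [Algebra K R] [AddCommGroup 𝓛]
  [Module K 𝓛] [Module R 𝓛] {S : SplitPair K R 𝓛}
  {p q r : Bool} {k : ℕ}

/-- Cochains with exactly `k` arguments. -/
def HasDeg (k : ℤ) (X : List 𝓛 → 𝓛) : Prop := ∀ l : List 𝓛, (l.length : ℤ) ≠ k → X l = 0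

theorem HasDeg.contract {k : ℤ} {X : List 𝓛 → 𝓛} (hX : HasDeg k X) (v : 𝓛) :
    HasDeg (k - 1) (contract v X) := fun l hl => hX (v :: l) (by
  simp only [List.length_cons]; push_cast; omega)

/-- Degrees are integers so that m + n - 1 makes sense for two constants, whose bracket has degree
-1 and is zero. -/
theorem HasDeg.nrBr {m n : ℤ} {X Y : List 𝓛 → 𝓛} (hX : IsAlt p X) (hY : IsAlt q Y)
    (hm : HasDeg m X) (hn : HasDeg n Y) : HasDeg (m + n - 1) (nrBr p q X Y) := by
  intro l hl
  induction l generalizing p q X Y m n with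
  | nil =>
    rw [nrBr_nil]
    have h1 : X [Y []] = 0 := by
      by_cases h : n = 0
      · exact hm _ (by simp at hl ⊢; omega)
      · rw [hn [] (by simp; omega), hX.map_cons_zero]
    have h2 : Y [X []] = 0 := by
      by_cases h : m = 0
      · exact hn _ (by simp at hl ⊢; omega)
      · rw [hm [] (by simp; omega), hY.map_cons_zero]
    rw [h1, h2, sub_zero]
  | cons v l ih =>
    simp only [List.length_cons] at hl
    push_cast at hl
    rw [nrBr_cons, ih (hX.contract v) hY (hm.contract v) hn (by omega),
      ih hX (hY.contract v) hm (hn.contract v) (by omega)]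
    simp

theorem hasDeg_proj {m : ℤ} {w : List 𝓛 → 𝓛} (hw : HasDeg m w) : HasDeg m (S.proj w) := by
  intro l hl
  simp [proj, hw (l.map fun x => (S.prA x : 𝓛)) (by simpa using hl)]

theorem hasDeg_mu : HasDeg 2 S.mu := by
  intro l hl
  rcases l with _ | ⟨x, _ | ⟨y, _ | ⟨z, l⟩⟩⟩
  · rfl
  · rfl
  · simp at hl
  · rfl

theorem hasDeg_lift (δ : 𝓛 →ₗ[K] 𝓛) : HasDeg 1 (lift δ) := by
  intro l hl
  rcases l with _ | ⟨x, _ | ⟨y, l⟩⟩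
  · rfl
  · simp at hl
  · rfl

theorem hasDeg_nrD {m : ℤ} {X : List 𝓛 → 𝓛} (hX : IsAlt p X) (hm : HasDeg m X) :
    HasDeg (m + 1) (S.nrD p X) := by
  have := HasDeg.nrBr isAlt_mu hX (hasDeg_mu (S := S)) hm
  rwa [show 2 + m - 1 = m + 1 by ring] at this

/-- Cochains on lists that correspond to forms on `A` of degree `m` with values in `B`. -/
structure IsForm (S : SplitPair K R 𝓛) (p : Bool) (m : ℤ) (X : List 𝓛 → 𝓛) : Prop
    extends IsRAlt R p X, S.IsVert X where
  deg : HasDeg m X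

theorem IsForm.dL {m : ℤ} {X : List 𝓛 → 𝓛} (hX : S.IsForm p m X) :
    S.IsForm (!p) (m + 1) (S.dL p X) where
  toIsRAlt := isRAlt_dL hX.toIsRAlt
  toIsVert := isVert_proj (isAlt_nrD hX.toIsAlt)
  deg := hasDeg_proj (hasDeg_nrD hX.toIsAlt hX.deg)

theorem IsForm.derBr {m n : ℤ} {X Y : List 𝓛 → 𝓛} (hX : S.IsForm p m X) (hY : S.IsForm q n Y) :
    S.IsForm (p ^^ q) (m + n) (S.derBr p q X Y) where
  toIsRAlt := isRAlt_derBr hX.toIsRAlt hY.toIsRAlt hX.toIsVert hY.toIsVert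
  toIsVert := isVert_proj (isAlt_nrBr_nrD hX.toIsAlt hY.toIsAlt)
  deg := by
    have := HasDeg.nrBr (isAlt_nrD (S := S) hX.toIsAlt) hY.toIsAlt (hasDeg_nrD hX.toIsAlt hX.deg)
      hY.deg
    rw [show m + 1 + n - 1 = m + n by ring] at this
    exact hasDeg_proj this

theorem IsForm.actL {m : ℤ} {X : List 𝓛 → 𝓛} (hX : S.IsForm p m X) {δ : 𝓛 →ₗ[K] 𝓛} {s : R → R}
    (hδ : ∀ (f : R) u, δ (f • u) = s f • u + f • δ u) : S.IsForm p m (S.actL δ p X) where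
  toIsRAlt := isRAlt_actL hX.toIsRAlt hδ
  toIsVert := by
    have : IsAlt p (LiePairs.nrBr true p (lift δ) X) := by
      simpa using (isAlt_lift δ).nrBr hX.toIsAlt
    exact isVert_proj this
  deg := by
    have := HasDeg.nrBr (isAlt_lift δ) hX.toIsAlt (hasDeg_lift δ) hX.deg
    rw [show 1 + m - 1 = m by ring] at this
    exact hasDeg_proj this

/-- The homotopy in `derBr_jacobi` has to be a form for its differential to be a coboundary. -/
theorem IsForm.proj_triBr {l m n : ℤ} {X Y Z : List 𝓛 → 𝓛} (hX : S.IsForm p l X)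
    (hY : S.IsForm q m Y) (hZ : S.IsForm r n Z) :
    S.IsForm (!(p ^^ q ^^ r)) (l + m + n - 1) (S.proj (S.triBr p q r X Y Z)) where
  toIsRAlt := isRAlt_proj (isRAlt_triBr hX.toIsRAlt hY.toIsRAlt hZ.toIsRAlt hX.toIsVert
    hY.toIsVert hZ.toIsVert)
  toIsVert := isVert_proj (isRAlt_triBr hX.toIsRAlt hY.toIsRAlt hZ.toIsRAlt hX.toIsVert
    hY.toIsVert hZ.toIsVert).toIsAlt
  deg := by
    have := HasDeg.nrBr (isAlt_nrD (S := S) hX.toIsAlt) hY.toIsAlt (hasDeg_nrD hX.toIsAlt hX.deg)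
      hY.deg
    have := HasDeg.nrBr (isAlt_nrBr_nrD (S := S) hX.toIsAlt hY.toIsAlt) hZ.toIsAlt this hZ.deg
    rw [show l + 1 + m - 1 + n - 1 = l + m + n - 1 by ring] at this
    exact hasDeg_proj this

theorem IsForm.proj_nrBr_nrBr_lift {m n : ℤ} {X Y : List 𝓛 → 𝓛} (hX : S.IsForm p m X)
    (hY : S.IsForm q n Y) {δ : 𝓛 →ₗ[K] 𝓛} {s : R → R}
    (hδ : ∀ (f : R) u, δ (f • u) = s f • u + f • δ u) :
    S.IsForm (p == q) (m + n - 1) (S.proj (LiePairs.nrBr p q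
      (LiePairs.nrBr true p (lift δ) X) Y)) where
  toIsRAlt := isRAlt_proj (isRAlt_nrBr_nrBr_lift hX.toIsRAlt hY.toIsRAlt hX.toIsVert
    hY.toIsVert hδ)
  toIsVert := isVert_proj (isRAlt_nrBr_nrBr_lift hX.toIsRAlt hY.toIsRAlt hX.toIsVert
    hY.toIsVert hδ).toIsAlt
  deg := by
    have h : IsAlt p (LiePairs.nrBr true p (lift δ) X) := by
      simpa using (isAlt_lift δ).nrBr hX.toIsAlt
    have := HasDeg.nrBr (isAlt_lift δ) hX.toIsAlt (hasDeg_lift δ) hX.deg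
    have := HasDeg.nrBr h hY.toIsAlt this hY.deg
    rw [show 1 + m - 1 + n - 1 = m + n - 1 by ring] at this
    exact hasDeg_proj this

variable (S) in
/-- A cochain on `A` as a function on lists of sections of `𝓛`. -/
def ext : ∀ k, S.Cochain k → List 𝓛 → 𝓛
  | 0, X, [] => X Fin.elim0
  | k + 1, X, x :: l => ext k (fun v => X (Fin.cons (S.prA x) v)) l
  | _, _, _ => 0

variable (S) in
/-- The restriction of a function on lists to a cochain on `A`. -/
def res (k : ℕ) (w : List 𝓛 → 𝓛) : S.Cochain k :=
  fun a => S.prB (w (List.ofFn fun i => (a i : 𝓛)))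

theorem res_add {n : ℕ} (u v : List 𝓛 → 𝓛) : S.res n (u + v) = S.res n u + S.res n v := by
  funext a; simp [res]

theorem res_zsmul {n : ℕ} (c : ℤ) (u : List 𝓛 → 𝓛) : S.res n (c • u) = c • S.res n u := by
  funext a; simp [res]

theorem contract_ext (x : 𝓛) (X : S.Cochain (k + 1)) :
    contract x (S.ext (k + 1) X) = S.ext k fun v => X (Fin.cons (S.prA x) v) := rfl

theorem prA_coe (a : S.A) : S.prA a = a := Subtype.ext (S.coe_prA_of_mem a.2)

theorem prB_coe (b : S.B) : S.prB b = b := Subtype.ext (S.coe_prB_of_mem b.2)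

theorem ext_ofFn (X : S.Cochain k) (a : Fin k → S.A) :
    S.ext k X (List.ofFn fun i => (a i : 𝓛)) = X a := by
  induction k with
  | zero => exact congrArg (fun v => (X v : 𝓛)) (Subsingleton.elim _ _)
  | succ k ih =>
    rw [List.ofFn_succ, ext, ih fun v => X (Fin.cons (S.prA (a 0)) v), prA_coe]
    exact congrArg (fun v => (X v : 𝓛)) (Fin.cons_self_tail a)

theorem res_ext (X : S.Cochain k) : S.res k (S.ext k X) = X := by
  funext a
  rw [res, ext_ofFn, prB_coe]

/-- `ext` projects the arguments to A and `res` projects the value to B. -/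
theorem ext_res {w : List 𝓛 → 𝓛} (hw : HasDeg k w) : S.ext k (S.res k w) = S.proj w := by
  funext l
  induction k generalizing w l with
  | zero =>
    cases l with
    | nil => rfl
    | cons x l => exact (hasDeg_proj hw (x :: l) (by simp; omega)).symm
  | succ k ih =>
    cases l with
    | nil => exact (hasDeg_proj hw [] (by simp; omega)).symm
    | cons x l =>
      have h := hw.contract (S.prA x)
      rw [Nat.cast_succ, add_sub_cancel_right] at h
      have := ih h l
      rw [ext]
      refine Eq.trans ?_ this
      congr 1
      funext v
      simp [res, List.ofFn_succ, contract]

theorem ext_injective : Function.Injective (S.ext k) :=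
  Function.LeftInverse.injective res_ext

theorem ext_add (X Y : S.Cochain k) : S.ext k (X + Y) = S.ext k X + S.ext k Y := by
  funext l
  induction k generalizing l with
  | zero => cases l <;> simp [ext]
  | succ k ih =>
    cases l with
    | nil => simp [ext]
    | cons x l =>
      exact ih (fun v => X (Fin.cons (S.prA x) v)) (fun v => Y (Fin.cons (S.prA x) v)) l

theorem ext_smul (f : R) (X : S.Cochain k) : S.ext k (f • X) = f • S.ext k X := by
  funext l
  induction k generalizing l with
  | zero => cases l <;> simp [ext]
  | succ k ih =>
    cases l with
    | nil => simp [ext]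
    | cons x l => exact ih (fun v => X (Fin.cons (S.prA x) v)) l

theorem ext_mem (X : S.Cochain k) (l : List 𝓛) : S.ext k X l ∈ S.B := by
  induction k generalizing l with
  | zero => cases l <;> simp [ext]
  | succ k ih =>
    cases l with
    | nil => simp [ext]
    | cons x l => exact ih _ l

theorem hasDeg_ext (X : S.Cochain k) : HasDeg k (S.ext k X) := by
  intro l hl
  induction k generalizing l with
  | zero =>
    cases l with
    | nil => simp at hl
    | cons x l => rfl
  | succ k ih =>
    cases l with
    | nil => rfl
    | cons x l => exact ih _ l (by simpa using hl)

theorem curryLeft_eq (w : S.A [⋀^Fin (k + 1)]→ₗ[R] S.B) (a : S.A) :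
    (fun v => w (Fin.cons a v)) = ⇑(w.curryLeft a) := rfl

theorem ext_swap (w : S.A [⋀^Fin k]→ₗ[R] S.B) (l₁ : List 𝓛) (x y : 𝓛) (l₂ : List 𝓛) :
    S.ext k w (l₁ ++ x :: y :: l₂) = -S.ext k w (l₁ ++ y :: x :: l₂) := by
  induction l₁ generalizing k with
  | nil =>
    rcases k with _ | _ | k
    · simp [ext]
    · simp [ext]
    · rw [List.nil_append, List.nil_append, ext, ext, ext, ext, ← neg_one_smul R, ← Pi.smul_apply,
        ← ext_smul]
      congr 1
      funext v
      have h := w.map_swap (Fin.cons (S.prA y) (Fin.cons (S.prA x) v)) (i := 0) (j := 1) (by simp)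
      rw [Pi.smul_apply, neg_one_smul, ← h]
      congr 1
      funext i
      cases i using Fin.cases with
      | zero => simp
      | succ i =>
        cases i using Fin.cases with
        | zero => simp
        | succ i =>
          have hs : Equiv.swap (0 : Fin (k + 1 + 1)) 1 i.succ.succ = i.succ.succ :=
            Equiv.swap_apply_of_ne_of_ne (Fin.succ_ne_zero _) (by simp [Fin.ext_iff])
          rw [Function.comp_apply, hs]
          simp
  | cons z l ih =>
    rcases k with _ | k
    · simp [ext]
    · rw [List.cons_append, List.cons_append, ext, ext, curryLeft_eq, ih]

theorem isForm_ext [IsScalarTower K R 𝓛] {X : S.Cochain k} (hX : X ∈ S.forms k) :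
    S.IsForm k.bodd k (S.ext k X) := by
  obtain ⟨w, rfl⟩ := hX
  have hadd : ∀ x y l, S.ext k w ((x + y) :: l) = S.ext k w (x :: l) + S.ext k w (y :: l) := by
    intro x y l
    rcases k with _ | k
    · simp [ext]
    · simp only [ext, curryLeft_eq, map_add]
      exact congrFun (ext_add (w.curryLeft (S.prA x)) (w.curryLeft (S.prA y))) l
  have hsmul : ∀ (f : R) x l, S.ext k w ((f • x) :: l) = f • S.ext k w (x :: l) := by
    intro f x l
    rcases k with _ | k
    · simp [ext]
    · simp only [ext, curryLeft_eq, map_smul]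
      exact congrFun (ext_smul f (w.curryLeft (S.prA x))) l
  have halt : IsAlt k.bodd (S.ext k w) :=
    ⟨fun l hl => hasDeg_ext _ l fun h => hl (by rw [Nat.cast_inj.1 h]), hadd, ext_swap w⟩
  refine ⟨⟨halt, hsmul⟩, ⟨ext_mem _, fun l x hx hxB => ?_⟩, hasDeg_ext _⟩
  have h : S.proj (S.ext k w) = S.ext k w := by
    rw [← ext_res (hasDeg_ext _), res_ext]
  rw [← h]
  exact (isVert_proj halt).zero l x hx hxB

end Forms

end SplitPair

namespace SplitPair

/-! ### Equivalence of forms with vertical cochains on lists -/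

section FormsOfLists

variable {K R 𝓛 : Type*} [Field K] [CommRing R] [Algebra K R] [AddCommGroup 𝓛]
  [Module K 𝓛] [Module R 𝓛] {S : SplitPair K R 𝓛}
  {p q r : Bool} {k : ℕ} {X Y : List 𝓛 → 𝓛}

theorem IsRAlt.map_append_add (hX : IsRAlt R p X) (l₁ : List 𝓛) (x y : 𝓛) (l₂ : List 𝓛) :
    X (l₁ ++ (x + y) :: l₂) = X (l₁ ++ x :: l₂) + X (l₁ ++ y :: l₂) := by
  induction l₁ generalizing p X with
  | nil => exact hX.add x y l₂
  | cons v l ih => exact ih (hX.contract v)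

theorem IsRAlt.map_append_smul (hX : IsRAlt R p X) (l₁ : List 𝓛) (f : R) (x : 𝓛) (l₂ : List 𝓛) :
    X (l₁ ++ (f • x) :: l₂) = f • X (l₁ ++ x :: l₂) := by
  induction l₁ generalizing p X with
  | nil => exact hX.smul f x l₂
  | cons v l ih => exact ih (hX.contract v)

-- Antisymmetry only gives 2 X = 0 on a repeated argument, so characteristic zero is needed to get
-- an alternating map.
variable (K) in
theorem _root_.LiePairs.IsAlt.map_cons_of_mem [CharZero K] (hX : IsAlt p X) {x : 𝓛} {l : List 𝓛}
    (h : x ∈ l) : X (x :: l) = 0 := by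
  induction l generalizing p X with
  | nil => simp at h
  | cons y l ih =>
    have hs := hX.swap [] x y l
    simp only [List.nil_append] at hs
    rcases List.mem_cons.1 h with rfl | h
    · rw [eq_neg_iff_add_eq_zero, ← two_smul K] at hs
      exact (smul_eq_zero.1 hs).resolve_left two_ne_zero
    · rw [hs, neg_eq_zero]
      exact ih (hX.contract y) h

variable (K) in
theorem _root_.LiePairs.IsAlt.map_of_not_nodup [CharZero K] (hX : IsAlt p X) {l : List 𝓛}
    (h : ¬l.Nodup) : X l = 0 := by
  induction l generalizing p X with
  | nil => simp at h
  | cons y l ih =>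
    by_cases hy : y ∈ l
    · exact hX.map_cons_of_mem K hy
    · exact ih (hX.contract y) fun hl => h (List.nodup_cons.2 ⟨hy, hl⟩)

theorem ofFn_update {α : Type*} (a : Fin k → α) (i : Fin k) :
    ∃ l₁ l₂, ∀ x, List.ofFn (Function.update a i x) = l₁ ++ x :: l₂ := by
  induction k with
  | zero => exact i.elim0
  | succ k ih =>
    cases i using Fin.cases with
    | zero =>
      refine ⟨[], List.ofFn fun j => a j.succ, fun x => ?_⟩
      simp [List.ofFn_succ]
    | succ i =>
      obtain ⟨l₁, l₂, h⟩ := ih (fun j => a j.succ) i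
      refine ⟨a 0 :: l₁, l₂, fun x => ?_⟩
      rw [List.cons_append, ← h, List.ofFn_succ, Function.update_of_ne (Fin.succ_ne_zero i).symm]
      congr 2
      funext j
      by_cases hj : j = i
      · subst hj; simp
      · rw [Function.update_of_ne hj, Function.update_of_ne (by simpa using hj)]

theorem res_mem_forms [IsScalarTower K R 𝓛] [CharZero K] (hX : IsRAlt R p X) :
    S.res k X ∈ S.forms k := by
  have hu (a : Fin k → S.A) (i : Fin k) : ∃ l₁ l₂, ∀ x : S.A,
      (List.ofFn fun j => (Function.update a i x j : 𝓛)) = l₁ ++ (x : 𝓛) :: l₂ := by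
    obtain ⟨l₁, l₂, h⟩ := ofFn_update a i
    refine ⟨l₁.map (↑), l₂.map (↑), fun x => ?_⟩
    have := congrArg (List.map ((↑) : S.A → 𝓛)) (h x)
    rw [List.map_ofFn, List.map_append, List.map_cons] at this
    exact this
  refine ⟨AlternatingMap.mk (MultilinearMap.mk' (S.res k X) ?_ ?_) ?_, rfl⟩
  · intro a i x y
    obtain ⟨l₁, l₂, h⟩ := hu a i
    simp only [res, h, Submodule.coe_add, hX.map_append_add, map_add]
  · intro a i f x
    obtain ⟨l₁, l₂, h⟩ := hu a i
    simp only [res, h, Submodule.coe_smul, hX.map_append_smul, map_smul]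
  · intro a i j hij hne
    change S.res k X a = 0
    rw [res, hX.map_of_not_nodup K, map_zero]
    rw [List.nodup_ofFn]
    intro hinj
    exact hne (hinj (congrArg Subtype.val hij))

/-- A vertical cochain sees only the A-components of its arguments, so its restriction to A
determines it. -/
theorem ext_res_of_isVert (hX : IsAlt p X) (hv : S.IsVert X) (hd : HasDeg k X) :
    S.ext k (S.res k X) = X := by
  funext l
  induction k generalizing p X l with
  | zero =>
    cases l with
    | nil => exact S.coe_prB_of_mem (hv.mem _)
    | cons x l => exact (hd (x :: l) (by simp; omega)).symm
  | succ k ih =>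
    cases l with
    | nil => exact (hd [] (by simp; omega)).symm
    | cons x l =>
      have h := hd.contract (S.prA x)
      rw [Nat.cast_succ, add_sub_cancel_right] at h
      have := ih (hX.contract _) (hv.contract _) h l
      have hx : X (x :: l) = X (S.prA x :: l) := by
        conv_lhs => rw [← S.prA_add_prB x, hX.add]
        rw [hv.zero _ _ List.mem_cons_self (S.prB x).2, add_zero]
      rw [ext, hx]
      refine Eq.trans ?_ this
      congr 1
      funext v
      simp [res, List.ofFn_succ, contract]

theorem IsForm.ext_res (hX : S.IsForm p k X) : S.ext k (S.res k X) = X :=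
  ext_res_of_isVert hX.toIsAlt hX.toIsVert hX.deg

/-! ### Comparison of the operations on cochains -/

theorem ins_ext (δ : 𝓛 → 𝓛) (X : S.Cochain k) (a : Fin k → S.A) :
    ins δ (S.ext k X) (List.ofFn fun i => (a i : 𝓛)) =
      ((∑ i, X (Function.update a i (S.prA (δ (a i)))) : S.B) : 𝓛) := by
  induction k with
  | zero => simp [ins]
  | succ k ih =>
    rw [List.ofFn_succ, ins, contract_ext, ih, ext, ext_ofFn fun v => X (Fin.cons _ v),
      Fin.sum_univ_succ, Submodule.coe_add, prA_coe]
    have ha : a = Fin.cons (a 0) fun i => a i.succ := (Fin.cons_self_tail a).symm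
    congr 2
    · congr 1
      conv_rhs => rw [ha]
      simp
    · refine Finset.sum_congr rfl fun i _ => ?_
      conv_rhs => rw [ha]
      simp only [Fin.cons_update, Fin.cons_succ]

theorem res_proj (w : List 𝓛 → 𝓛) : S.res k (S.proj w) = S.res k w := by
  funext a
  rw [res, proj, map_prA (by simp [List.mem_ofFn]), prB_coe, res]

theorem res_actL [IsScalarTower K R 𝓛] {X : S.Cochain k} (hX : IsAlt p (S.ext k X)) (δ : S.Der) :
    S.res k (S.actL δ.1 p (S.ext k X)) = S.act δ X := by
  rw [actL, res_proj]
  funext a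
  rw [res, nrBr_lift hX, ext_ofFn, ins_ext, map_sub, prB_coe, act]
  abel

theorem d_zero_apply [IsScalarTower K R 𝓛] (X : S.Cochain 0) (a : Fin 1 → S.A) :
    S.d 0 X a = S.nabla (a 0) (X Fin.elim0) := by
  change (∑ i : Fin 1, (-1 : K) ^ (i : ℕ) • S.nabla (a i) (X (fun l => a (i.succAbove l)))) +
    ∑ j : Fin 1, ∑ i : Fin 0, _ = _
  simp only [Finset.univ_eq_empty, Finset.sum_empty, Finset.sum_const_zero, add_zero,
    Fin.sum_univ_one, Fin.val_zero, pow_zero, one_smul]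
  rw [Subsingleton.elim (fun l => a (Fin.succAbove 0 l)) Fin.elim0]

theorem cons_succAbove_succ {α : Type*} (x : α) (v : Fin (k + 1) → α) (i : Fin (k + 1)) :
    (fun l => (Fin.cons x v : Fin (k + 2) → α) (i.succ.succAbove l)) =
      Fin.cons x fun l => v (i.succAbove l) := by
  funext l
  cases l using Fin.cases <;> simp

/-- Cartan's formula for the explicit Chevalley-Eilenberg sum, in the shape of `nrD_cons`, so that
the two differentials can be compared by induction. -/
theorem d_cons [IsScalarTower K R 𝓛] (w : S.A [⋀^Fin (k + 1)]→ₗ[R] S.B) (x : S.A)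
    (v : Fin (k + 1) → S.A) : S.d (k + 1) w (Fin.cons x v) = S.nabla x (w v) -
      ∑ i, w (Function.update v i (S.brA x (v i))) - S.d k (w.curryLeft x) v := by
  -- The summand with [x, v j] stands in slot 0 in the sum for d; moving it to slot j costs (-1)^j.
  have hupd (j : Fin (k + 1)) (y : S.A) : w (Function.update v j y) =
      (-1 : K) ^ (j : ℕ) • w (Fin.cons y fun l => v (j.succAbove l)) := by
    rw [← Fin.insertNth_removeNth, AlternatingMap.map_insertNth]
    obtain h | h := Nat.even_or_odd (j : ℕ)
    · simp only [h.neg_one_pow, one_smul]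
      rfl
    · simp only [h.neg_one_pow, neg_smul, one_smul]
      rfl
  change (∑ i : Fin (k + 2), (-1 : K) ^ (i : ℕ) • S.nabla ((Fin.cons x v : Fin (k + 2) → S.A) i)
      (w (fun l => (Fin.cons x v : Fin (k + 2) → S.A) (i.succAbove l)))) +
    (∑ j : Fin (k + 2), ∑ i : Fin (k + 1), if i.castSucc < j then
      (-1 : K) ^ (j : ℕ) • w (Function.update
        (fun l => (Fin.cons x v : Fin (k + 2) → S.A) (j.succAbove l)) i
        (S.brA ((Fin.cons x v : Fin (k + 2) → S.A) i.castSucc)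
          ((Fin.cons x v : Fin (k + 2) → S.A) j))) else 0) = _ - _ -
    ((∑ i : Fin (k + 1), (-1 : K) ^ (i : ℕ) • S.nabla (v i)
      (w (Fin.cons x fun l => v (i.succAbove l)))) +
    ∑ j : Fin (k + 1), ∑ i : Fin k, if i.castSucc < j then
      (-1 : K) ^ (j : ℕ) • w (Fin.cons x (Function.update (fun l => v (j.succAbove l)) i
        (S.brA (v i.castSucc) (v j)))) else 0)
  have h1 (i : Fin (k + 1)) : (-1 : K) ^ (i.succ : ℕ) • S.nabla (v i)
      (w (fun l => (Fin.cons x v : Fin (k + 2) → S.A) (i.succ.succAbove l))) =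
      -((-1 : K) ^ (i : ℕ) • S.nabla (v i) (w (Fin.cons x fun l => v (i.succAbove l)))) := by
    rw [cons_succAbove_succ, Fin.val_succ, pow_succ, mul_neg_one, neg_smul]
  have h2 (j : Fin (k + 1)) : (∑ i : Fin (k + 1), if i.castSucc < j.succ then
      (-1 : K) ^ (j.succ : ℕ) • w (Function.update
        (fun l => (Fin.cons x v : Fin (k + 2) → S.A) (j.succ.succAbove l)) i
        (S.brA ((Fin.cons x v : Fin (k + 2) → S.A) i.castSucc) (v j))) else 0) =
      -w (Function.update v j (S.brA x (v j))) - ∑ i : Fin k, if i.castSucc < j then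
      (-1 : K) ^ (j : ℕ) • w (Fin.cons x (Function.update (fun l => v (j.succAbove l)) i
        (S.brA (v i.castSucc) (v j)))) else 0 := by
    rw [Fin.sum_univ_succ, hupd, sub_eq_add_neg, ← Finset.sum_neg_distrib]
    congr 1
    · rw [if_pos (by simp), cons_succAbove_succ, Fin.val_succ, pow_succ, mul_neg_one, neg_smul]
      simp [Fin.update_cons_zero]
    · refine Finset.sum_congr rfl fun i _ => ?_
      rw [cons_succAbove_succ, ← Fin.cons_update, Fin.castSucc_succ, Fin.cons_succ]
      simp only [Fin.succ_lt_succ_iff, Fin.val_succ, pow_succ, mul_neg_one, neg_smul]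
      split_ifs <;> simp
  rw [Fin.sum_univ_succ (n := k + 1), Fin.sum_univ_succ (n := k + 1)]
  simp only [Fin.cons_succ, h1, h2, Finset.sum_neg_distrib, Finset.sum_sub_distrib]
  simp
  abel

theorem res_dL [IsScalarTower K R 𝓛] (w : S.A [⋀^Fin k]→ₗ[R] S.B) :
    S.res (k + 1) (S.dL k.bodd (S.ext k w)) = S.d k w := by
  rw [dL, res_proj]
  induction k with
  | zero =>
    funext a
    have hw := (isForm_ext (S := S) ⟨w, rfl⟩).toIsAlt
    have h0 : contract (a 0 : 𝓛) (S.ext 0 w) = 0 := funext fun _ => rfl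
    rw [res, List.ofFn_succ, nrD_cons hw, h0, nrD_zero, ext_ofFn, ins_ext, d_zero_apply]
    simp only [Finset.univ_eq_empty, Finset.sum_empty, Submodule.coe_zero, sub_zero, Pi.zero_apply,
      nabla]
    rw [Subsingleton.elim (fun i : Fin 0 => a i.succ) Fin.elim0]
  | succ k ih =>
    funext a
    have hw := (isForm_ext (S := S) ⟨w, rfl⟩).toIsAlt
    have hi := congrFun (ih (w.curryLeft (a 0))) fun i => a i.succ
    -- A is closed under the bracket, so the projection built into `ins_ext` does nothing here.
    have hb (y : S.A) : S.prA (S.bracket (a 0) y) = S.brA (a 0) y :=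
      Subtype.ext (S.coe_prA_of_mem (S.brA (a 0) y).2)
    have ha : a = Fin.cons (a 0) fun i => a i.succ := (Fin.cons_self_tail a).symm
    conv_rhs => rw [ha]
    rw [d_cons, ← hi, res, List.ofFn_succ, nrD_cons hw, contract_ext, ext_ofFn, ins_ext, prA_coe,
      curryLeft_eq, res]
    simp only [map_sub, prB_coe, hb, nabla, Nat.bodd_succ, Bool.not_not]

theorem HasDeg.ins {m : ℤ} {X : List 𝓛 → 𝓛} (hX : HasDeg m X) (δ : 𝓛 → 𝓛) {l : List 𝓛}
    (hl : (l.length : ℤ) ≠ m) : ins δ X l = 0 := by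
  induction l generalizing m X with
  | nil => rfl
  | cons x l ih =>
    rw [SplitPair.ins, hX _ (by simpa using hl), ih (hX.contract x), add_zero]
    simp only [List.length_cons] at hl
    push_cast at hl
    omega

theorem res_derBr [IsScalarTower K R 𝓛] {m n : ℕ} {X : S.Cochain m} {Y : S.Cochain n}
    (hX : X ∈ S.forms m) (hY : Y ∈ S.forms n) :
    S.res (m + n) (S.derBr m.bodd n.bodd (S.ext m X) (S.ext n Y)) =
      -sg m.bodd • S.bracket₂ X Y := by
  have hX' := isForm_ext hX
  have hY' := isForm_ext hY
  rw [derBr, res_proj]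
  funext a
  refine Subtype.ext ?_
  rw [res, prB_nrBr_nrD hX'.toIsAlt hY'.toIsAlt hX'.toIsVert hY'.toIsVert, Pi.smul_apply,
    AddSubgroupClass.coe_zsmul, shSum_ofFn_shuffles (p := m)]
  · congr 1
    rw [bracket₂, AddSubmonoidClass.coe_finsetSum]
    refine Finset.sum_congr rfl fun σ _ => ?_
    rw [AddSubgroupClass.coe_zsmul, brTerm, ext_ofFn X fun i => a (σ (Fin.castAdd n i)),
      ext_ofFn Y fun j => a (σ (Fin.natAdd m j)), ins_ext _ X fun i => a (σ (Fin.castAdd n i)),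
      ins_ext _ Y fun j => a (σ (Fin.natAdd m j))]
    rfl
  · intro l₁ l₂ h
    have h' : (l₁.length : ℤ) ≠ m := by exact_mod_cast h
    rw [brTerm, hX'.deg.ins _ h', hX'.deg _ h', ins_bracket_zero hY'.toIsAlt]
    simp

end FormsOfLists

end SplitPair

namespace SplitPair

/-! ### The operations on forms, transported from cochains on lists -/

section Cochains

variable {K R 𝓛 : Type*} [Field K] [CommRing R] [Algebra K R] [AddCommGroup 𝓛]
  [Module K 𝓛] [Module R 𝓛] {S : SplitPair K R 𝓛}
  {k m n : ℕ}

/-! ### Linearity over constants -/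

theorem ext_zsmul (c : ℤ) (X : S.Cochain k) : S.ext k (c • X) = c • S.ext k X :=
  map_zsmul (AddMonoidHom.mk' (S.ext k) ext_add) c X

section

variable {p q : Bool} {X Y X' Y' : List 𝓛 → 𝓛}

theorem ext_zero : S.ext k 0 = 0 := map_zero (AddMonoidHom.mk' (S.ext k) ext_add)

theorem IsForm.succ {p : Bool} {X : List 𝓛 → 𝓛} (hX : S.IsForm p ((k : ℤ) + 1) X) :
    S.IsForm p ((k + 1 : ℕ) : ℤ) X := by
  rwa [Nat.cast_succ]

theorem dL_zsmul (p : Bool) (c : ℤ) (X : List 𝓛 → 𝓛) : S.dL p (c • X) = c • S.dL p X := by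
  rw [dL, nrD_zsmul, proj_zsmul]; rfl

theorem nrD_add (X Y : List 𝓛 → 𝓛) : S.nrD p (X + Y) = S.nrD p X + S.nrD p Y :=
  nrBr_add_right isAlt_mu _ _

theorem derBr_add_left (hY : IsAlt q Y) (X X' : List 𝓛 → 𝓛) :
    S.derBr p q (X + X') Y = S.derBr p q X Y + S.derBr p q X' Y := by
  rw [derBr, nrD_add, nrBr_add_left hY, proj_add]; rfl

theorem derBr_add_right (hX : IsAlt p X) (Y Y' : List 𝓛 → 𝓛) :
    S.derBr p q X (Y + Y') = S.derBr p q X Y + S.derBr p q X Y' := by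
  rw [derBr, nrBr_add_right (isAlt_nrD hX), proj_add]; rfl

theorem derBr_zsmul_left (hY : IsAlt q Y) (c : ℤ) (X : List 𝓛 → 𝓛) :
    S.derBr p q (c • X) Y = c • S.derBr p q X Y := by
  rw [derBr, nrD_zsmul, nrBr_zsmul_left hY, proj_zsmul]; rfl

theorem derBr_zsmul_right (hX : IsAlt p X) (c : ℤ) (Y : List 𝓛 → 𝓛) :
    S.derBr p q X (c • Y) = c • S.derBr p q X Y := by
  rw [derBr, nrBr_zsmul_right (isAlt_nrD hX), proj_zsmul]; rfl

/-- The bracket is a first-order operator in X, and the derivative term vanishes for a constant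
factor. -/
theorem derBr_ksmul_left {i j : ℤ} (hX : S.IsForm p i X) (hY : S.IsForm q j Y) (c : K) :
    S.derBr p q (algebraMap K R c • X) Y = algebraMap K R c • S.derBr p q X Y := by
  funext l
  have h (l₁ l₂ : List 𝓛) : S.brTerm (algebraMap K R c • X) Y l₁ l₂ =
      algebraMap K R c • S.brTerm X Y l₁ l₂ := by
    rw [brTerm_rsmul_left hY.toIsRAlt hX.toIsVert hY.toIsVert, Derivation.map_algebraMap, zero_smul,
      sub_zero]
  rw [Pi.smul_apply, derBr, derBr, proj, proj, prB_nrBr_nrD hX.toIsAlt hY.toIsAlt hX.toIsVert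
    hY.toIsVert, prB_nrBr_nrD (hX.rsmul _).toIsAlt hY.toIsAlt (hX.toIsVert.rsmul _) hY.toIsVert,
    smul_comm _ (-sg p)]
  congr 1
  rw [← shSum_rsmul]
  exact congrArg (fun Φ => shSum Φ (l.map fun x => (S.prA x : 𝓛)))
    (funext fun l₁ => funext fun l₂ => h l₁ l₂)

theorem derBr_ksmul_right {i j : ℤ} (hX : S.IsForm p i X) (hY : S.IsForm q j Y) (c : K) :
    S.derBr p q X (algebraMap K R c • Y) = algebraMap K R c • S.derBr p q X Y := by
  funext l
  have h (l₁ l₂ : List 𝓛) : S.brTerm X (algebraMap K R c • Y) l₁ l₂ =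
      algebraMap K R c • S.brTerm X Y l₁ l₂ := by
    rw [brTerm_rsmul_right hX.toIsRAlt hX.toIsVert hY.toIsVert, Derivation.map_algebraMap,
      zero_smul, add_zero]
  rw [Pi.smul_apply, derBr, derBr, proj, proj, prB_nrBr_nrD hX.toIsAlt hY.toIsAlt hX.toIsVert
    hY.toIsVert, prB_nrBr_nrD hX.toIsAlt (hY.rsmul _).toIsAlt hX.toIsVert (hY.toIsVert.rsmul _),
    smul_comm _ (-sg p)]
  congr 1
  rw [← shSum_rsmul]
  exact congrArg (fun Φ => shSum Φ (l.map fun x => (S.prA x : 𝓛)))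
    (funext fun l₁ => funext fun l₂ => h l₁ l₂)

end

variable [IsScalarTower K R 𝓛]

theorem ext_ksmul (c : K) (X : S.Cochain k) :
    S.ext k (c • X) = algebraMap K R c • S.ext k X := by
  rw [← ext_smul]
  congr 1
  funext a
  exact (algebraMap_smul R c (X a)).symm

theorem prB_ksmul (c : K) (u : 𝓛) : S.prB (c • u) = c • S.prB u := by
  rw [← algebraMap_smul R c u, map_smul, algebraMap_smul]

theorem prA_ksmul (c : K) (u : 𝓛) : S.prA (c • u) = c • S.prA u := by
  rw [← algebraMap_smul R c u, map_smul, algebraMap_smul]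

/-! ### The operations preserve forms -/

/-- The symbol term s(f) a lies in A and is killed by the projection to B. -/
theorem kappa_mem_forms (δ : S.Der) : S.kappa δ ∈ S.forms 1 := by
  obtain ⟨s, h1, -, -⟩ := δ.2
  let g : S.A →ₗ[R] S.B :=
    { toFun := fun a => -S.prB (δ.1 a)
      map_add' := fun a b => by
        rw [Submodule.coe_add, map_add, map_add, neg_add]
      map_smul' := fun f a => by
        rw [Submodule.coe_smul, h1, map_add, map_smul, map_smul, S.prB_eq_zero_iff.2 a.2, smul_zero,
          zero_add, RingHom.id_apply, smul_neg] }
  exact ⟨AlternatingMap.ofSubsingleton R S.A S.B (0 : Fin 1) g, rfl⟩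

theorem mem_ker_kappa (δ : S.Der) : δ ∈ LinearMap.ker S.kappa ↔ ∀ a ∈ S.A, δ.1 a ∈ S.A := by
  rw [LinearMap.mem_ker]
  constructor
  · intro h a ha
    have := congrFun h fun _ => ⟨a, ha⟩
    exact S.prB_eq_zero_iff.1 (neg_eq_zero.1 this)
  · intro h
    funext a
    exact neg_eq_zero.2 (S.prB_eq_zero_iff.2 (h _ (a 0).2))

variable (S) in
/-- The derivations of `L` that preserve `A`. -/
def derPair : LieSubalgebra K S.Der where
  toSubmodule := LinearMap.ker S.kappa
  lie_mem' {δ δ'} h h' := by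
    have h1 := (mem_ker_kappa δ).1 h
    have h2 := (mem_ker_kappa δ').1 h'
    exact (mem_ker_kappa _).2 fun a ha => sub_mem (h1 _ (h2 a ha)) (h2 _ (h1 a ha))

theorem mem_derPair (δ : S.Der) : δ ∈ S.derPair ↔ ∀ a ∈ S.A, δ.1 a ∈ S.A := mem_ker_kappa δ

theorem isForm_derBr {X : S.Cochain m} {Y : S.Cochain n} (hX : X ∈ S.forms m)
    (hY : Y ∈ S.forms n) : S.IsForm (m + n).bodd ((m + n : ℕ) : ℤ)
      (S.derBr m.bodd n.bodd (S.ext m X) (S.ext n Y)) := by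
  have := (isForm_ext hX).derBr (isForm_ext hY)
  rwa [← Nat.bodd_add, ← Nat.cast_add] at this

theorem bracket₂_eq {X : S.Cochain m} {Y : S.Cochain n} (hX : X ∈ S.forms m)
    (hY : Y ∈ S.forms n) : S.bracket₂ X Y =
      -sg m.bodd • S.res (m + n) (S.derBr m.bodd n.bodd (S.ext m X) (S.ext n Y)) := by
  rw [res_derBr hX hY, smul_smul]
  cases m.bodd <;> simp

theorem ext_act (δ : S.Der) {X : S.Cochain k} (hX : X ∈ S.forms k) :
    S.ext k (S.act δ X) = S.actL δ.1 k.bodd (S.ext k X) := by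
  obtain ⟨s, h1, -, -⟩ := δ.2
  rw [← res_actL (isForm_ext hX).toIsAlt, ((isForm_ext hX).actL h1).ext_res]

theorem ext_d {X : S.Cochain k} (hX : X ∈ S.forms k) :
    S.ext (k + 1) (S.d k X) = S.dL k.bodd (S.ext k X) := by
  have hf := (isForm_ext hX).dL.succ
  obtain ⟨w, rfl⟩ := hX
  rw [← res_dL, hf.ext_res]

theorem ext_bracket₂ {X : S.Cochain m} {Y : S.Cochain n} (hX : X ∈ S.forms m)
    (hY : Y ∈ S.forms n) : S.ext (m + n) (S.bracket₂ X Y) =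
      -sg m.bodd • S.derBr m.bodd n.bodd (S.ext m X) (S.ext n Y) := by
  rw [bracket₂_eq hX hY, ext_zsmul, (isForm_derBr hX hY).ext_res]

theorem dL_ext {X : S.Cochain k} (hX : X ∈ S.cocycles k) : S.dL k.bodd (S.ext k X) = 0 := by
  rw [← ext_d hX.1, LinearMap.mem_ker.1 hX.2, ext_zero]

theorem mem_cocycles_iff {X : S.Cochain k} :
    X ∈ S.cocycles k ↔ X ∈ S.forms k ∧ S.dL k.bodd (S.ext k X) = 0 := by
  refine ⟨fun h => ⟨h.1, dL_ext h⟩, fun h => ⟨h.1, LinearMap.mem_ker.2 ?_⟩⟩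
  apply ext_injective (S := S)
  rw [ext_d h.1, h.2, ext_zero]

/-- With integer degrees a primitive has degree n - 1 also for n = 0, where it is zero; this avoids
a case distinction later. -/
theorem coboundary_eq {Y : S.Cochain n} (hY : Y ∈ S.coboundaries n) :
    ∃ W, S.IsForm (!n.bodd) ((n : ℤ) - 1) W ∧ S.ext n Y = S.dL (!n.bodd) W := by
  cases n with
  | zero =>
    obtain rfl : Y = 0 := (Submodule.mem_bot K).1 hY
    refine ⟨0, ⟨⟨IsAlt.zero, fun _ _ _ => by simp⟩, ⟨fun _ => zero_mem _, fun _ _ _ _ => rfl⟩,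
      fun _ _ => rfl⟩, ?_⟩
    rw [ext_zero, dL, nrD_zero, proj_zero]
  | succ k =>
    obtain ⟨Z, hZ, rfl⟩ := hY
    have := isForm_ext hZ
    refine ⟨S.ext k Z, ?_, ?_⟩
    · rwa [Nat.cast_succ, add_sub_cancel_right, Nat.bodd_succ, Bool.not_not]
    · rw [ext_d hZ, Nat.bodd_succ, Bool.not_not]

variable [CharZero K]

theorem d_mem_forms {X : S.Cochain k} (hX : X ∈ S.forms k) : S.d k X ∈ S.forms (k + 1) := by
  have hf := (isForm_ext hX).dL.succ
  obtain ⟨w, rfl⟩ := hX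
  rw [← res_dL]
  exact res_mem_forms hf.toIsRAlt

theorem d_d {X : S.Cochain k} (hX : X ∈ S.forms k) : S.d (k + 1) (S.d k X) = 0 := by
  apply ext_injective (S := S)
  rw [ext_d (d_mem_forms hX), ext_d hX, Nat.bodd_succ, dL_dL (isForm_ext hX).toIsAlt, ext_zero]

theorem bracket₂_mem_forms {X : S.Cochain m} {Y : S.Cochain n} (hX : X ∈ S.forms m)
    (hY : Y ∈ S.forms n) : S.bracket₂ X Y ∈ S.forms (m + n) := by
  rw [bracket₂_eq hX hY]
  exact zsmul_mem (res_mem_forms (isForm_derBr hX hY).toIsRAlt) _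

theorem act_mem_forms (δ : S.Der) {X : S.Cochain k} (hX : X ∈ S.forms k) :
    S.act δ X ∈ S.forms k := by
  obtain ⟨s, h1, -, -⟩ := δ.2
  rw [← res_actL (isForm_ext hX).toIsAlt]
  exact res_mem_forms ((isForm_ext hX).actL h1).toIsRAlt

/-! ### Cocycles -/

theorem bracket₂_mem_cocycles {X : S.Cochain m} {Y : S.Cochain n} (hX : X ∈ S.cocycles m)
    (hY : Y ∈ S.cocycles n) : S.bracket₂ X Y ∈ S.cocycles (m + n) := by
  rw [mem_cocycles_iff]
  refine ⟨bracket₂_mem_forms hX.1 hY.1, ?_⟩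
  rw [ext_bracket₂ hX.1 hY.1, dL_zsmul, Nat.bodd_add, dL_derBr (isForm_ext hX.1).toIsAlt
    (isForm_ext hY.1).toIsAlt (dL_ext hX) (dL_ext hY), smul_zero]

theorem act_mem_cocycles {δ : S.Der} (hδ : δ ∈ S.derPair) {X : S.Cochain k}
    (hX : X ∈ S.cocycles k) : S.act δ X ∈ S.cocycles k := by
  obtain ⟨s, -, -, h3⟩ := δ.2
  rw [mem_cocycles_iff]
  refine ⟨act_mem_forms δ hX.1, ?_⟩
  rw [ext_act δ hX.1, ← actL_dL (isForm_ext hX.1).toIsAlt ((mem_derPair δ).1 hδ) h3, dL_ext hX,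
    actL, nrBr_zero_right (isAlt_lift _), proj_zero]

theorem res_dL_mem_coboundaries {W : List 𝓛 → 𝓛} (hW : S.IsForm (!n.bodd) ((n : ℤ) - 1) W) :
    S.res n (S.dL (!n.bodd) W) ∈ S.coboundaries n := by
  cases n with
  | zero =>
    have h : W = 0 := funext fun l => hW.deg l (by simp)
    rw [h, dL, nrD_zero, proj_zero]
    exact (Submodule.mem_bot K).2 (funext fun a => by simp [res])
  | succ k =>
    rw [Nat.cast_succ, add_sub_cancel_right, Nat.bodd_succ, Bool.not_not] at hW
    have hm : S.res k W ∈ S.forms k := res_mem_forms hW.toIsRAlt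
    refine ⟨S.res k W, hm, ?_⟩
    apply ext_injective (S := S)
    rw [ext_d hm, hW.ext_res, Nat.bodd_succ, Bool.not_not, hW.dL.succ.ext_res]

end Cochains

end SplitPair

namespace SplitPair

/-! ### The bracket and the action on cohomology -/

section CohomologyBracket

variable {K R 𝓛 : Type*} [Field K] [CommRing R] [Algebra K R] [AddCommGroup 𝓛]
  [Module K 𝓛] [Module R 𝓛] [IsScalarTower K R 𝓛] {S : SplitPair K R 𝓛} {k m n : ℕ}

theorem bracket₂_add_left {X X' : S.Cochain m} {Y : S.Cochain n} (hX : X ∈ S.forms m)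
    (hX' : X' ∈ S.forms m) (hY : Y ∈ S.forms n) :
    S.bracket₂ (X + X') Y = S.bracket₂ X Y + S.bracket₂ X' Y := by
  apply ext_injective (S := S)
  rw [ext_add, ext_bracket₂ hX hY, ext_bracket₂ hX' hY, ext_bracket₂ (add_mem hX hX') hY, ext_add,
    derBr_add_left (isForm_ext hY).toIsAlt, smul_add]

theorem bracket₂_add_right {X : S.Cochain m} {Y Y' : S.Cochain n} (hX : X ∈ S.forms m)
    (hY : Y ∈ S.forms n) (hY' : Y' ∈ S.forms n) :
    S.bracket₂ X (Y + Y') = S.bracket₂ X Y + S.bracket₂ X Y' := by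
  apply ext_injective (S := S)
  rw [ext_add, ext_bracket₂ hX hY, ext_bracket₂ hX hY', ext_bracket₂ hX (add_mem hY hY'), ext_add,
    derBr_add_right (isForm_ext hX).toIsAlt, smul_add]

theorem bracket₂_smul_left (c : K) {X : S.Cochain m} {Y : S.Cochain n} (hX : X ∈ S.forms m)
    (hY : Y ∈ S.forms n) : S.bracket₂ (c • X) Y = c • S.bracket₂ X Y := by
  apply ext_injective (S := S)
  rw [ext_ksmul, ext_bracket₂ hX hY, ext_bracket₂ (Submodule.smul_mem _ c hX) hY, ext_ksmul,
    derBr_ksmul_left (isForm_ext hX) (isForm_ext hY), smul_comm]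

theorem bracket₂_smul_right (c : K) {X : S.Cochain m} {Y : S.Cochain n} (hX : X ∈ S.forms m)
    (hY : Y ∈ S.forms n) : S.bracket₂ X (c • Y) = c • S.bracket₂ X Y := by
  apply ext_injective (S := S)
  rw [ext_ksmul, ext_bracket₂ hX hY, ext_bracket₂ hX (Submodule.smul_mem _ c hY), ext_ksmul,
    derBr_ksmul_right (isForm_ext hX) (isForm_ext hY), smul_comm]

/-- The two brackets live in the different types for m + n and n + m, so they are compared as
cochains on lists. -/
theorem ext_bracket₂_skew {X : S.Cochain m} {Y : S.Cochain n} (hX : X ∈ S.forms m)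
    (hY : Y ∈ S.forms n) : S.ext (m + n) (S.bracket₂ X Y) =
      -sg (m * n).bodd • S.ext (n + m) (S.bracket₂ Y X) := by
  have hx := isForm_ext hX
  have hy := isForm_ext hY
  rw [ext_bracket₂ hX hY, ext_bracket₂ hY hX,
    derBr_skew hx.toIsAlt hy.toIsAlt hx.toIsVert hy.toIsVert, smul_smul, smul_smul, Nat.bodd_mul]
  congr 1
  cases m.bodd <;> cases n.bodd <;> rfl

theorem act_add (δ : S.Der) (X Y : S.Cochain k) : S.act δ (X + Y) = S.act δ X + S.act δ Y := by
  funext a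
  simp only [act, Pi.add_apply, Submodule.coe_add, map_add, Finset.sum_add_distrib]
  abel

theorem act_smul (δ : S.Der) (c : K) (X : S.Cochain k) : S.act δ (c • X) = c • S.act δ X := by
  funext a
  simp only [act, Pi.smul_apply, Submodule.coe_smul_of_tower, map_smul, prB_ksmul,
    ← Finset.smul_sum, smul_add, smul_neg]

theorem add_act (δ δ' : S.Der) {X : S.Cochain k} (hX : X ∈ S.forms k) :
    S.act (δ + δ') X = S.act δ X + S.act δ' X := by
  obtain ⟨w, rfl⟩ := hX
  have h (u : 𝓛) : (δ + δ').1 u = δ.1 u + δ'.1 u := rfl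
  funext a
  simp only [act, Pi.add_apply, h, map_add, AlternatingMap.map_update_add,
    Finset.sum_add_distrib]
  abel

theorem smul_act (c : K) (δ : S.Der) {X : S.Cochain k} (hX : X ∈ S.forms k) :
    S.act (c • δ) X = c • S.act δ X := by
  obtain ⟨w, rfl⟩ := hX
  have h (a : Fin k → S.A) (j : Fin k) (x : S.A) :
      w (Function.update a j (c • x)) = c • w (Function.update a j x) := by
    rw [← algebraMap_smul R c x, AlternatingMap.map_update_smul, algebraMap_smul]
  have hδ (u : 𝓛) : (c • δ).1 u = c • δ.1 u := rfl
  funext a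
  simp only [act, Pi.smul_apply, hδ, prA_ksmul, prB_ksmul, h, smul_add, smul_neg, Finset.smul_sum]

variable (S) in
/-- The linear map that sends a cocycle to its class. -/
def clsHom (k : ℕ) : S.cocycles k →ₗ[K] S.H :=
  DirectSum.lof K ℕ S.Cohomology k ∘ₗ S.toCohomology k

theorem toCohomology_surjective : Function.Surjective (S.toCohomology k) :=
  Submodule.mkQ_surjective _

theorem toCohomology_eq_zero {x : S.cocycles k} (hx : x.1 ∈ S.coboundaries k) :
    S.toCohomology k x = 0 :=
  (Submodule.Quotient.mk_eq_zero ((S.coboundaries k).submoduleOf (S.cocycles k))).2 hx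

theorem mem_coboundaries_of_toCohomology {x : S.cocycles k} (hx : S.toCohomology k x = 0) :
    x.1 ∈ S.coboundaries k :=
  (Submodule.Quotient.mk_eq_zero ((S.coboundaries k).submoduleOf (S.cocycles k))).1 hx

theorem clsHom_eq_zero {x : S.cocycles k} (hx : x.1 ∈ S.coboundaries k) : S.clsHom k x = 0 := by
  rw [clsHom, LinearMap.comp_apply, toCohomology_eq_zero hx, map_zero]

theorem H_induction {P : S.H → Prop} (h : ∀ k (x : S.cocycles k), P (S.clsHom k x))
    (hadd : ∀ x y, P x → P y → P (x + y)) (x : S.H) : P x := by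
  induction x using DirectSum.induction_on with
  | zero => simpa using h 0 0
  | of k y =>
    obtain ⟨x, rfl⟩ := toCohomology_surjective y
    exact h k x
  | add x y hx hy => exact hadd x y hx hy

variable (S) in
/-- A linear choice of representatives. -/
def repr (k : ℕ) : S.Cohomology k →ₗ[K] S.cocycles k :=
  ((S.toCohomology k).exists_rightInverse_of_surjective
    (LinearMap.range_eq_top.2 toCohomology_surjective)).choose

theorem toCohomology_repr (x : S.Cohomology k) : S.toCohomology k (S.repr k x) = x :=
  LinearMap.congr_fun ((S.toCohomology k).exists_rightInverse_of_surjective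
    (LinearMap.range_eq_top.2 toCohomology_surjective)).choose_spec x

theorem repr_sub_mem (x : S.cocycles k) :
    (S.repr k (S.toCohomology k x) - x).1 ∈ S.coboundaries k :=
  mem_coboundaries_of_toCohomology (by rw [map_sub, toCohomology_repr, sub_self])

theorem act_mem_coboundaries [CharZero K] {δ : S.Der} (hδ : δ ∈ S.derPair) {X : S.Cochain k}
    (hX : X ∈ S.coboundaries k) (hX' : X ∈ S.forms k) : S.act δ X ∈ S.coboundaries k := by
  obtain ⟨W, hW, he⟩ := coboundary_eq hX
  obtain ⟨s, h1, -, h3⟩ := δ.2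
  have := res_dL_mem_coboundaries (hW.actL h1)
  rwa [← actL_dL hW.toIsAlt ((mem_derPair δ).1 hδ) h3, ← he, Bool.not_not, ← ext_act δ hX',
    res_ext] at this

/-- For a cocycle X, the bracket with d W is, up to sign, d of the derived bracket with W, by
`derBr_dL`. -/
theorem bracket₂_mem_coboundaries_right [CharZero K] {X : S.Cochain m} {Y : S.Cochain n}
    (hX : X ∈ S.cocycles m) (hY : Y ∈ S.coboundaries n) (hY' : Y ∈ S.forms n) :
    S.bracket₂ X Y ∈ S.coboundaries (m + n) := by
  obtain ⟨W, hW, he⟩ := coboundary_eq hY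
  have hx := isForm_ext hX.1
  have hV := hx.derBr hW
  have h := derBr_dL hx.toIsAlt hW.toIsAlt (dL_ext hX)
  have hp : (m.bodd ^^ !n.bodd) = !(m + n).bodd := by
    rw [Nat.bodd_add]; cases m.bodd <;> cases n.bodd <;> rfl
  rw [Bool.not_not, ← he, hp] at h
  rw [hp, show (m : ℤ) + (n - 1) = ((m + n : ℕ) : ℤ) - 1 by push_cast; ring] at hV
  have hm := zsmul_mem (res_dL_mem_coboundaries hV) (-1)
  convert hm using 1
  apply ext_injective (S := S)
  have hd := hV.dL
  rw [Bool.not_not, sub_add_cancel] at hd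
  rw [ext_bracket₂ hX.1 hY', h, ext_zsmul, hd.ext_res, smul_smul]
  congr 1
  cases m.bodd <;> rfl

theorem res_ext_mem_coboundaries (h : m = n) {X : S.Cochain m} (hX : X ∈ S.coboundaries m) :
    S.res n (S.ext m X) ∈ S.coboundaries n := by
  subst h
  rwa [res_ext]

theorem bracket₂_mem_coboundaries_left [CharZero K] {X : S.Cochain m} {Y : S.Cochain n}
    (hX : X ∈ S.coboundaries m) (hX' : X ∈ S.forms m) (hY : Y ∈ S.cocycles n) :
    S.bracket₂ X Y ∈ S.coboundaries (m + n) := by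
  have h := res_ext_mem_coboundaries (add_comm n m)
    (zsmul_mem (bracket₂_mem_coboundaries_right hY hX hX') (-sg (m * n).bodd))
  rwa [ext_zsmul, ← ext_bracket₂_skew hX' hY.1, res_ext] at h

theorem res_ext_mem_cocycles (h : m = n) (x : S.cocycles m) :
    S.res n (S.ext m x.1) ∈ S.cocycles n := by
  subst h
  rw [res_ext]
  exact x.2

theorem neg_one_pow_smul (n : ℕ) (x : S.H) : (-1 : K) ^ n • x = sg n.bodd • x := by
  rw [sg_bodd]
  obtain h | h := Nat.even_or_odd n
  · simp only [h.neg_one_pow, one_smul]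
  · simp only [h.neg_one_pow, neg_smul, one_smul]

variable (S) in
/-- The class of a cochain on lists. -/
def clsL (n : ℕ) (w : List 𝓛 → 𝓛) : S.H :=
  open Classical in if h : S.res n w ∈ S.cocycles n then S.clsHom n ⟨_, h⟩ else 0

theorem clsL_add {u v : List 𝓛 → 𝓛} (hu : S.res n u ∈ S.cocycles n)
    (hv : S.res n v ∈ S.cocycles n) : S.clsL n (u + v) = S.clsL n u + S.clsL n v := by
  have h : S.res n (u + v) ∈ S.cocycles n := by rw [res_add]; exact add_mem hu hv
  rw [clsL, clsL, clsL, dif_pos hu, dif_pos hv, dif_pos h, ← map_add]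
  exact congrArg _ (Subtype.ext (res_add u v))

theorem clsL_zsmul (c : ℤ) {u : List 𝓛 → 𝓛} (hu : S.res n u ∈ S.cocycles n) :
    S.clsL n (c • u) = c • S.clsL n u := by
  have h : S.res n (c • u) ∈ S.cocycles n := by rw [res_zsmul]; exact zsmul_mem hu c
  rw [clsL, clsL, dif_pos hu, dif_pos h, ← map_zsmul]
  exact congrArg _ (Subtype.ext (res_zsmul c u))

/-- Cochains on lists do not carry their degree in the type, so classes in propositionally equal
degrees can be added and compared. -/
theorem clsHom_eq_clsL (h : m = n) (x : S.cocycles m) :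
    S.clsHom m x = S.clsL n (S.ext m x.1) := by
  rw [clsL, dif_pos (res_ext_mem_cocycles h x)]
  subst h
  exact congrArg _ (Subtype.ext (res_ext x.1).symm)

variable [CharZero K]

variable (S) in
/-- The bracket of cocycles. -/
def bracketHom (m n : ℕ) : S.cocycles m →ₗ[K] S.cocycles n →ₗ[K] S.cocycles (m + n) :=
  LinearMap.mk₂ K (fun X Y => ⟨S.bracket₂ X.1 Y.1, bracket₂_mem_cocycles X.2 Y.2⟩)
    (fun X X' Y => Subtype.ext (bracket₂_add_left X.2.1 X'.2.1 Y.2.1))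
    (fun c X Y => Subtype.ext (bracket₂_smul_left c X.2.1 Y.2.1))
    (fun X Y Y' => Subtype.ext (bracket₂_add_right X.2.1 Y.2.1 Y'.2.1))
    (fun c X Y => Subtype.ext (bracket₂_smul_right c X.2.1 Y.2.1))

variable (S) in
/-- The bracket on cohomology. -/
def bracketH : S.H →ₗ[K] S.H →ₗ[K] S.H :=
  DirectSum.toModule K ℕ (S.H →ₗ[K] S.H) fun m => LinearMap.flip <|
    DirectSum.toModule K ℕ (S.Cohomology m →ₗ[K] S.H) fun n => LinearMap.flip <|
      ((S.bracketHom m n).compl₁₂ (S.repr m) (S.repr n)).compr₂ (S.clsHom (m + n))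

/-- Independence of the representatives: changing either argument by a coboundary changes the
bracket by a coboundary. -/
theorem bracketH_clsHom (x : S.cocycles m) (y : S.cocycles n) :
    S.bracketH (S.clsHom m x) (S.clsHom n y) = S.clsHom (m + n) (S.bracketHom m n x y) := by
  set x' := S.repr m (S.toCohomology m x) with hx'
  set y' := S.repr n (S.toCohomology n y) with hy'
  have h : S.bracketH (S.clsHom m x) (S.clsHom n y) =
      S.clsHom (m + n) (S.bracketHom m n x' y') := by
    simp only [bracketH, clsHom, LinearMap.comp_apply, DirectSum.toModule_lof, LinearMap.flip_apply,
      LinearMap.compr₂_apply, LinearMap.compl₁₂_apply, hx', hy']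
  have e : S.bracketHom m n x' y' = S.bracketHom m n x y +
      S.bracketHom m n (x' - x) y' + S.bracketHom m n x (y' - y) := by
    simp only [map_sub, LinearMap.sub_apply]
    abel
  have h1 : S.clsHom (m + n) (S.bracketHom m n (x' - x) y') = 0 :=
    clsHom_eq_zero (bracket₂_mem_coboundaries_left (repr_sub_mem x) (x' - x).2.1 y'.2)
  have h2 : S.clsHom (m + n) (S.bracketHom m n x (y' - y)) = 0 :=
    clsHom_eq_zero (bracket₂_mem_coboundaries_right x.2 (repr_sub_mem y) (y' - y).2.1)
  rw [h, e, map_add, map_add, h1, h2, add_zero, add_zero]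

/-- The action of a derivation that preserves `A` on cocycles. -/
def actHom (δ : S.derPair) (k : ℕ) : S.cocycles k →ₗ[K] S.cocycles k where
  toFun X := ⟨S.act δ.1 X.1, act_mem_cocycles δ.2 X.2⟩
  map_add' X Y := Subtype.ext (act_add δ.1 X.1 Y.1)
  map_smul' c X := Subtype.ext (act_smul δ.1 c X.1)

/-- The action of a derivation that preserves `A` on cohomology. -/
def actEnd (δ : S.derPair) : Module.End K S.H :=
  DirectSum.toModule K ℕ S.H fun k => S.clsHom k ∘ₗ actHom δ k ∘ₗ S.repr k

theorem actEnd_clsHom (δ : S.derPair) (x : S.cocycles k) :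
    actEnd δ (S.clsHom k x) = S.clsHom k (actHom δ k x) := by
  have h : actEnd δ (S.clsHom k x) = S.clsHom k (actHom δ k (S.repr k (S.toCohomology k x))) := by
    rw [actEnd, clsHom, LinearMap.comp_apply, DirectSum.toModule_lof]
    rfl
  rw [h, ← sub_eq_zero, ← map_sub, ← map_sub]
  exact clsHom_eq_zero (act_mem_coboundaries δ.2 (repr_sub_mem x) (S.repr k _ - x).2.1)

variable (S) in
/-- The representation of the derivations that preserve `A` on cohomology. -/
def actRep : S.derPair →ₗ⁅K⁆ Module.End K S.H where
  toFun := actEnd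
  map_add' δ δ' := LinearMap.ext <| H_induction (fun k x => by
    rw [LinearMap.add_apply, actEnd_clsHom, actEnd_clsHom, actEnd_clsHom, ← map_add]
    exact congrArg _ (Subtype.ext (add_act δ.1 δ'.1 x.2.1)))
    fun x y hx hy => by rw [map_add, map_add, hx, hy]
  map_smul' c δ := LinearMap.ext <| H_induction (fun k x => by
    rw [LinearMap.smul_apply, actEnd_clsHom, RingHom.id_apply, actEnd_clsHom, ← map_smul]
    exact congrArg _ (Subtype.ext (smul_act c δ.1 x.2.1)))
    fun x y hx hy => by rw [map_add, map_add, hx, hy]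
  -- Compatibility with commutators already holds on forms, by `actL_comm`; no homotopy appears.
  map_lie' {δ δ'} := LinearMap.ext <| H_induction (fun k x => by
    rw [Ring.lie_def, LinearMap.sub_apply, Module.End.mul_apply, Module.End.mul_apply]
    simp only [actEnd_clsHom]
    rw [← map_sub]
    refine congrArg _ (Subtype.ext (ext_injective (S := S) ?_))
    change S.ext k (S.act ⁅δ.1, δ'.1⁆ x.1) =
      S.ext k (S.act δ.1 (S.act δ'.1 x.1) - S.act δ'.1 (S.act δ.1 x.1))
    have h1 := act_mem_forms δ.1 x.2.1
    have h2 := act_mem_forms δ'.1 x.2.1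
    rw [ext_act _ x.2.1, sub_eq_add_neg, ← neg_one_zsmul, ext_add, ext_zsmul, neg_one_zsmul,
      ← sub_eq_add_neg, ext_act _ h1, ext_act _ h2, ext_act _ x.2.1, ext_act _ x.2.1]
    exact actL_comm (isForm_ext x.2.1).toIsAlt ((mem_derPair δ.1).1 δ.2)
      ((mem_derPair δ'.1).1 δ'.2))
    fun x y hx hy => by rw [map_add, map_add, hx, hy]

/-! ### The identities on cohomology -/

theorem coboundaries_le (n : ℕ) : S.coboundaries n ≤ S.cocycles n := by
  cases n with
  | zero => exact bot_le
  | succ k =>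
    rintro _ ⟨Z, hZ, rfl⟩
    exact ⟨d_mem_forms hZ, LinearMap.mem_ker.2 (d_d hZ)⟩

theorem clsL_dL {W : List 𝓛 → 𝓛} (hW : S.IsForm (!n.bodd) ((n : ℤ) - 1) W) :
    S.clsL n (S.dL (!n.bodd) W) = 0 := by
  have h := res_dL_mem_coboundaries hW
  rw [clsL, dif_pos (coboundaries_le n h)]
  exact clsHom_eq_zero h

theorem bracketH_skew (x : S.cocycles m) (y : S.cocycles n) :
    S.bracketH (S.clsHom m x) (S.clsHom n y) =
      -(-1 : K) ^ (m * n) • S.bracketH (S.clsHom n y) (S.clsHom m x) := by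
  rw [bracketH_clsHom, bracketH_clsHom, neg_smul, neg_one_pow_smul, ← neg_smul,
    clsHom_eq_clsL rfl, clsHom_eq_clsL (add_comm n m),
    ← clsL_zsmul _ (res_ext_mem_cocycles (add_comm n m) _)]
  exact congrArg _ (ext_bracket₂_skew x.2.1 y.2.1)

theorem bracketH_jacobi (x : S.cocycles k) (y : S.cocycles m) (z : S.cocycles n) :
    S.bracketH (S.clsHom k x) (S.bracketH (S.clsHom m y) (S.clsHom n z)) =
      S.bracketH (S.bracketH (S.clsHom k x) (S.clsHom m y)) (S.clsHom n z) +
      (-1 : K) ^ (k * m) •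
        S.bracketH (S.clsHom m y) (S.bracketH (S.clsHom k x) (S.clsHom n z)) := by
  have e1 : k + m + n = k + (m + n) := add_assoc k m n
  have e2 : m + (k + n) = k + (m + n) := add_left_comm m k n
  have hx := isForm_ext x.2.1
  have hy := isForm_ext y.2.1
  have hz := isForm_ext z.2.1
  have hW := hx.proj_triBr hy hz
  have hp : (!(k.bodd ^^ m.bodd ^^ n.bodd)) = !(k + (m + n)).bodd := by
    simp only [Nat.bodd_add, Bool.xor_assoc]
  rw [hp, show (k : ℤ) + m + n - 1 = ((k + (m + n) : ℕ) : ℤ) - 1 by push_cast; ring] at hW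
  have hj := derBr_jacobi hx.toIsAlt hy.toIsAlt hz.toIsAlt hz.toIsVert (dL_ext x.2) (dL_ext y.2)
    (dL_ext z.2)
  simp only [bracketH_clsHom]
  -- The zero class added on the right is that of d of the ternary bracket. Its sign is the product
  -- of those of the two binary brackets, for X and Y, and that of X in `derBr_jacobi`, which leaves
  -- the sign of Y.
  rw [neg_one_pow_smul, clsHom_eq_clsL rfl, clsHom_eq_clsL e1, clsHom_eq_clsL e2,
    ← clsL_zsmul _ (res_ext_mem_cocycles e2 _), ← clsL_add (res_ext_mem_cocycles e1 _) (by
      rw [res_zsmul]; exact zsmul_mem (res_ext_mem_cocycles e2 _) _),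
    ← add_zero (S.clsL _ (_ + _)), ← smul_zero (sg m.bodd), ← clsL_dL hW, ← clsL_zsmul _
      (coboundaries_le _ (res_dL_mem_coboundaries hW)), ← clsL_add]
  · have f1 := bracket₂_mem_forms y.2.1 z.2.1
    have f2 := bracket₂_mem_forms x.2.1 y.2.1
    have f3 := bracket₂_mem_forms x.2.1 z.2.1
    refine congrArg _ ?_
    change S.ext _ (S.bracket₂ x.1 (S.bracket₂ y.1 z.1)) =
      S.ext _ (S.bracket₂ (S.bracket₂ x.1 y.1) z.1) +
        sg (k * m).bodd • S.ext _ (S.bracket₂ y.1 (S.bracket₂ x.1 z.1)) + _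
    rw [ext_bracket₂ x.2.1 f1, ext_bracket₂ f2 z.2.1, ext_bracket₂ y.2.1 f3,
      ext_bracket₂ x.2.1 y.2.1, ext_bracket₂ x.2.1 z.2.1, ext_bracket₂ y.2.1 z.2.1,
      derBr_zsmul_right hx.toIsAlt, derBr_zsmul_right hy.toIsAlt, derBr_zsmul_left hz.toIsAlt]
    rw [hp] at hj
    simp only [Nat.bodd_add, Nat.bodd_mul] at hj ⊢
    rw [hj, triBr]
    simp only [smul_add, smul_smul]
    congr 2 <;> congr 1 <;> cases k.bodd <;> cases m.bodd <;> rfl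
  · rw [res_add, res_zsmul]
    exact add_mem (res_ext_mem_cocycles e1 _) (zsmul_mem (res_ext_mem_cocycles e2 _) _)
  · rw [res_zsmul]
    exact zsmul_mem (coboundaries_le _ (res_dL_mem_coboundaries hW)) _

theorem actEnd_bracketH (δ : S.derPair) (x : S.cocycles m) (y : S.cocycles n) :
    actEnd δ (S.bracketH (S.clsHom m x) (S.clsHom n y)) =
      S.bracketH (actEnd δ (S.clsHom m x)) (S.clsHom n y) +
      S.bracketH (S.clsHom m x) (actEnd δ (S.clsHom n y)) := by
  obtain ⟨s, h1, -, h3⟩ := δ.1.2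
  have hx := isForm_ext x.2.1
  have hy := isForm_ext y.2.1
  have hW := hx.proj_nrBr_nrBr_lift hy h1
  have hp : (m.bodd == n.bodd) = !(m + n).bodd := by
    rw [Nat.bodd_add]; cases m.bodd <;> cases n.bodd <;> rfl
  rw [hp, ← Nat.cast_add] at hW
  have hj := actL_derBr hx.toIsAlt hy.toIsAlt ((mem_derPair δ.1).1 δ.2) hy.toIsVert (dL_ext x.2)
    (dL_ext y.2) h3
  simp only [bracketH_clsHom, actEnd_clsHom]
  rw [← map_add, clsHom_eq_clsL rfl, clsHom_eq_clsL rfl]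
  -- The added zero is the class of the exact term in `actL_derBr`, with the sign relating `derBr`
  -- to `bracket₂`.
  conv_rhs => rw [← add_zero (S.clsL _ _)]
  rw [← smul_zero (-sg m.bodd), ← clsL_dL hW, ← clsL_zsmul _
      (coboundaries_le _ (res_dL_mem_coboundaries hW)), ← clsL_add]
  · refine congrArg _ ?_
    change S.ext _ (S.act δ.1 (S.bracket₂ x.1 y.1)) =
      S.ext _ (S.bracket₂ (S.act δ.1 x.1) y.1 + S.bracket₂ x.1 (S.act δ.1 y.1)) + _
    rw [ext_act _ (bracket₂_mem_forms x.2.1 y.2.1), ext_add,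
      ext_bracket₂ (act_mem_forms δ.1 x.2.1) y.2.1, ext_bracket₂ x.2.1 (act_mem_forms δ.1 y.2.1),
      ext_bracket₂ x.2.1 y.2.1, ext_act _ x.2.1, ext_act _ y.2.1]
    rw [hp] at hj
    have hs : S.actL δ.1.1 (m + n).bodd (-sg m.bodd • S.derBr m.bodd n.bodd (S.ext m x.1)
        (S.ext n y.1)) = -sg m.bodd • S.actL δ.1.1 (m + n).bodd (S.derBr m.bodd n.bodd
        (S.ext m x.1) (S.ext n y.1)) := by
      rw [actL, nrBr_zsmul_right (isAlt_lift _), proj_zsmul, actL]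
    rw [hs, Nat.bodd_add, hj, smul_add, smul_add, Nat.bodd_add]
  · exact res_ext_mem_cocycles rfl _
  · rw [res_zsmul]
    exact zsmul_mem (coboundaries_le _ (res_dL_mem_coboundaries hW)) _

theorem isGradedLieBracket_bracketH : IsGradedLieBracket S.bracketH where
  degree m n x y := by
    obtain ⟨x, rfl⟩ := toCohomology_surjective x
    obtain ⟨y, rfl⟩ := toCohomology_surjective y
    exact ⟨_, bracketH_clsHom x y⟩
  skew m n x y := by
    obtain ⟨x, rfl⟩ := toCohomology_surjective x
    obtain ⟨y, rfl⟩ := toCohomology_surjective y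
    exact bracketH_skew x y
  jacobi m n x y z := by
    obtain ⟨x, rfl⟩ := toCohomology_surjective x
    obtain ⟨y, rfl⟩ := toCohomology_surjective y
    induction z using H_induction with
    | h k z => exact bracketH_jacobi x y z
    | hadd z z' hz hz' =>
      simp only [map_add, hz, hz', smul_add]
      abel

theorem actRep_bracketH (δ : S.derPair) (x y : S.H) : S.actRep δ (S.bracketH x y) =
    S.bracketH (S.actRep δ x) y + S.bracketH x (S.actRep δ y) := by
  induction x using H_induction with
  | h m x =>
    induction y using H_induction with
    | h n y => exact actEnd_bracketH δ x y
    | hadd y y' hy hy' =>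
      simp only [map_add, hy, hy']
      abel
  | hadd x x' hx hx' =>
    simp only [map_add, LinearMap.add_apply, hx, hx']
    abel

end CohomologyBracket

end SplitPair

end LiePairs

end

/-! ### The theorem for Lie pairs over a manifold -/

theorem corollary4p4
    {K : Type*} [RCLike K]
    {E : Type*} [NormedAddCommGroup E] [NormedSpace ℝ E] [FiniteDimensional ℝ E]
    {M : Type*} [TopologicalSpace M] [ChartedSpace E M] [IsManifold 𝓘(ℝ, E) ∞ M]
    [T2Space M] [SecondCountableTopology M]
    {F : Type*} [NormedAddCommGroup F] [NormedSpace ℝ F] [NormedSpace K F] [IsScalarTower ℝ K F]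
    [FiniteDimensional K F]
    {V : M → Type*} [∀ x, AddCommGroup (V x)] [∀ x, Module ℝ (V x)] [∀ x, Module K (V x)]
    [∀ x, IsScalarTower ℝ K (V x)]
    [TopologicalSpace (TotalSpace F V)] [∀ x, TopologicalSpace (V x)]
    [FiberBundle F V] [VectorBundle ℝ F V] [VectorBundle K F V]
    [ContMDiffVectorBundle ∞ F V 𝓘(ℝ, E)]
    (L : LiePairs.LieAlgebroid K E F V) (P : LiePairs.LiePair L) (S : P.Splitting) :
    let Ω := S.toSplitPair
    -- the complex, the binary bracket and the action maps are well defined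
    (∀ k, ∀ X ∈ Ω.forms k, Ω.d k X ∈ Ω.forms (k + 1)) ∧
    (∀ k, ∀ X ∈ Ω.forms k, Ω.d (k + 1) (Ω.d k X) = 0) ∧
    (∀ p q, ∀ X ∈ Ω.forms p, ∀ Y ∈ Ω.forms q, Ω.bracket₂ X Y ∈ Ω.forms (p + q)) ∧
    (∀ δ : Ω.Der, Ω.kappa δ ∈ Ω.forms 1) ∧
    (∀ δ : Ω.Der, ∀ k, ∀ X ∈ Ω.forms k, Ω.act δ X ∈ Ω.forms k) ∧
    -- `Der(L, A) = ker κ` consists of the derivations preserving `Γ(A)` and is a Lie subalgebra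
    ∃ 𝔥 : LieSubalgebra K Ω.Der,
      𝔥.toSubmodule = LinearMap.ker Ω.kappa ∧
      (∀ δ : Ω.Der, δ ∈ 𝔥 ↔ ∀ a ∈ Ω.A, δ.1 a ∈ Ω.A) ∧
      -- the binary bracket induces a graded Lie algebra structure on `H_CE(A; B)`
      ∃ br : Ω.H →ₗ[K] Ω.H →ₗ[K] Ω.H,
        LiePairs.IsGradedLieBracket br ∧
        (∀ p q (X : Ω.Cochain p) (Y : Ω.Cochain q)
          (hX : X ∈ Ω.cocycles p) (hY : Y ∈ Ω.cocycles q),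
          ∃ hXY : Ω.bracket₂ X Y ∈ Ω.cocycles (p + q),
            br (Ω.cls X hX) (Ω.cls Y hY) = Ω.cls (Ω.bracket₂ X Y) hXY) ∧
        -- the `1`-action induces an action of `Der(L, A)` on `H_CE(A; B)` by derivations
        ∃ ρ : 𝔥 →ₗ⁅K⁆ Module.End K Ω.H,
          (∀ (δ : 𝔥) k (X : Ω.Cochain k) (hX : X ∈ Ω.cocycles k),
            ∃ hδX : Ω.act δ.1 X ∈ Ω.cocycles k,
              ρ δ (Ω.cls X hX) = Ω.cls (Ω.act δ.1 X) hδX) ∧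
          ∀ (δ : 𝔥) (x y : Ω.H), ρ δ (br x y) = br (ρ δ x) y + br x (ρ δ y) := by
  intro Ω
  -- The geometry enters only through `toSplitPair`; everything else is algebra over a field of
  -- characteristic zero.
  exact ⟨fun k X hX => LiePairs.SplitPair.d_mem_forms hX,
    fun k X hX => LiePairs.SplitPair.d_d hX,
    fun p q X hX Y hY => LiePairs.SplitPair.bracket₂_mem_forms hX hY,
    LiePairs.SplitPair.kappa_mem_forms,
    fun δ k X hX => LiePairs.SplitPair.act_mem_forms δ hX,
    Ω.derPair, rfl, LiePairs.SplitPair.mem_derPair, Ω.bracketH,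
    LiePairs.SplitPair.isGradedLieBracket_bracketH,
    fun p q X Y hX hY => ⟨LiePairs.SplitPair.bracket₂_mem_cocycles hX hY,
      LiePairs.SplitPair.bracketH_clsHom ⟨X, hX⟩ ⟨Y, hY⟩⟩,
    Ω.actRep,
    fun δ k X hX => ⟨LiePairs.SplitPair.act_mem_cocycles δ.2 hX,
      LiePairs.SplitPair.actEnd_clsHom δ ⟨X, hX⟩⟩,
    LiePairs.SplitPair.actRep_bracketH⟩
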